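/- \textbf{Setting.} Let $K$ be a field or skew field of characteristic $\ne 2$ with an involution $a\mapsto\bar a$ (additive, $\overline{ab}=\bar b\bar a$, $\bar{\bar a}=a$) and centre $P$; vector spaces over $K$ are right vector spaces. Let $\mathcal C$ be a category linear over $P$ with an involution: to each object $u$ is assigned an object $u^*\neq u$ with $u^{**}=u$, and to each morphism $\alpha\colon u\to v$ a morphism $\alpha^*\colon v^*\to u^*$, additively in $\alpha$, with $\alpha^{**}=\alpha$, $(\alpha\beta)^*=\beta^*\alpha^*$, $(\alpha a)^*=\alpha^*\bar a$ for $a\in P$. Fix a set $S_0$ of objects containing exactly one of $u,u^*$ for each $u$. A \emph{representation} $A$ of $\mathcal C$ is a $P$-linear functor $u\mapsto A_u$, $\alpha\mapsto A_\alpha$ to finite-dimensional vector spaces over $K$ with $\sum_u\dim A_u<\infty$; morphisms are natural transformations. For a space $V$ let $V^*$ be the space of semilinear forms $\varphi\colon V\to K$, $\varphi(xa)=\bar a\varphi(x)$, with $(\varphi b)(x)=\varphi(x)b$, and identify $V^{**}=V$; for linear $g$ put $g^*\varphi=\varphi g$. The adjoint representation $A^\circ$ is given by $A^\circ_u=(A_{u^*})^*$,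 $A^\circ_\alpha=(A_{\alpha^*})^*$, and the adjoint $f^\circ\colon B^\circ\to A^\circ$ of $f\colon A\to B$ by $f^\circ_u=(f_{u^*})^*$. A \emph{selfadjoint} representation is a representation $A$ identified with $A^\circ$, i.e. with an isomorphism $A\cong A^\circ$ given by actions of $A_{u}$ on $A_{u^*}$ as semilinear forms, the action of $A_{u^*}$ on $A_{u^{**}}=A_u$ being the conjugate of that of $A_u$ on $A_{u^*}$. A \emph{congruence} of selfadjoint representations is an isomorphism $f$ with $f^\circ=f^{-1}$. The \emph{orthogonal sum} $\bot$ is the direct sum with $(\varphi+\psi)(a+b)=\varphi(a)+\psi(b)$. For a representation $A$, $A^+$ is $A\oplus A^\circ$ made selfadjoint by letting $(a,\varphi)\in A_u\oplus A_{u^*}^*$ act on $(b,\psi)\in A_{u^*}\oplus A_u^*$ as $\varphi(b)+\overline{\psi(a)}$. For a selfadjoint $B$ and an automorphism $f=f^\circ$ of $B$, $B^f$ is the selfadjoint representation with the spaces of $B$ (and the same identification) and $B^f_\alpha=\tilde f_v^{-1}B_\alpha\tilde f_u$ for $\alpha\colon u\to v$, where $\tilde f_u=f_u$ if $u\in S_0$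 and $\tilde f_u=1$ otherwise. Let $\mathrm{ind}(\mathcal C)$ be a complete system of pairwise nonisomorphic direct-sum-indecomposable representations. Let $\mathrm{ind}_0(\mathcal C)$ consist of one selfadjoint representation isomorphic to $A$ for each $A\in\mathrm{ind}(\mathcal C)$ that is isomorphic to a selfadjoint one. Let $\mathrm{ind}_1(\mathcal C)$ consist of all $A\in\mathrm{ind}(\mathcal C)$ that are isomorphic to $A^\circ$ but not to a selfadjoint representation, together with one representation from each pair $\{A,B\}\subset\mathrm{ind}(\mathcal C)$ such that $A\not\cong A^\circ$ and $A\cong B^\circ$. \textbf{Theorem 1.} (i) For $B\in\mathrm{ind}_0(\mathcal C)$, $T(B)=\mathrm{End}(B)/\mathrm{rad}\,\mathrm{End}(B)$, with the involution induced by $f\mapsto f^\circ$, is a skew field, and each $a=a^\circ\ne0$ in $T(B)$ contains an automorphism $f_a=f_a^\circ$ of $B$. Fix such an $f_a$ for every $B$ and $a$, put $B^a=B^{f_a}$, and for a Hermitian form $\varphi(x)=x_1^\circ a_1x_1+\dots+x_r^\circ a_rx_r$ ($r\ge1$, $0\neq a_i=a_i^\circ\in T(B)$) put $B^{\varphi(x)}=B^{a_1}\bot\cdots\bot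 B^{a_r}$. (ii) Every selfadjoint representation of $\mathcal C$ over $K$ is congruent to an orthogonal sum \[A_1^+\bot\cdots\bot A_m^+\bot B_1^{\varphi_1(x)}\bot\cdots\bot B_n^{\varphi_n(x)}\qquad(m,n\ge 0),\] where $A_i\in\mathrm{ind}_1(\mathcal C)$, $B_j\in\mathrm{ind}_0(\mathcal C)$, $B_j\ne B_{j'}$ for $j\neq j'$, and $\varphi_j$ is a Hermitian form over $T(B_j)$. (iii) Two such sums are congruent if and only if they coincide up to permutation of summands and replacement of each $B_j^{\varphi_j(x)}$ by $B_j^{\psi_j(x)}$, where $\varphi_j(x)$ and $\psi_j(x)$ are equivalent Hermitian forms over the skew field $T(B_j)$. -/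

import Mathlib

open CategoryTheory

set_option linter.unusedSectionVars false

namespace CatInv

universe k v u

/-- The involution of the skew field `K` restricted to its centre. -/
def starCenter {K : Type k} [DivisionRing K] [StarRing K] (c : Subring.center K) :
    Subring.center K :=
  ⟨star (c : K), Set.star_mem_center c.2⟩

/-- An involution on a category: `u ↦ u*` on objects, without fixed points, and
`(α : u ⟶ v) ↦ (α* : v* ⟶ u*)` on morphisms, with `u** = u`, `α** = α`, `(αβ)* = β* α*`.
The equation `α** = α` is written by means of `eqToHom` as the two sides have propositionally
equal types. -/
class Involution (C : Type u) [Category.{v} C] where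
  ob : C → C
  mor : ∀ {x y : C}, (x ⟶ y) → (ob y ⟶ ob x)
  ob_ob : ∀ x : C, ob (ob x) = x
  ob_ne : ∀ x : C, ob x ≠ x
  mor_id : ∀ x : C, mor (𝟙 x) = 𝟙 (ob x)
  mor_comp : ∀ {x y z : C} (α : x ⟶ y) (β : y ⟶ z), mor (α ≫ β) = mor β ≫ mor α
  mor_mor : ∀ {x y : C} (α : x ⟶ y),
    mor (mor α) = eqToHom (ob_ob x) ≫ α ≫ eqToHom (ob_ob y).symm

/-- The involution of a category that is linear over the centre of `K` is additive and
conjugate-linear with respect to the involution of `K`. -/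
class LinearInvolution (K : Type k) [DivisionRing K] [StarRing K]
    (C : Type u) [Category.{v} C] [Preadditive C] [Linear (Subring.center K) C]
    [Involution C] : Prop where
  mor_add : ∀ {x y : C} (α β : x ⟶ y),
    Involution.mor (α + β) = Involution.mor α + Involution.mor β
  mor_smul : ∀ {x y : C} (c : Subring.center K) (α : x ⟶ y),
    Involution.mor (c • α) = starCenter c • Involution.mor α

section Dual

/-- For right vector spaces `V` over `K` (that is, modules over `Kᵐᵒᵖ`), the adjoint space `V*` of
all semilinear forms `φ : V → K`, `φ (x a) = ā (φ x)`. It is a right vector space by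
`(φ b) x = (φ x) b`. -/
abbrev Dual (K : Type k) [DivisionRing K] [StarRing K] (V : Type k) [AddCommGroup V]
    [Module Kᵐᵒᵖ V] : Type k :=
  V →ₛₗ[((starRingEquiv (R := K)).symm : Kᵐᵒᵖ →+* K)] K

variable {K : Type k} [DivisionRing K] [StarRing K] {V W X : Type k}
  [AddCommGroup V] [Module Kᵐᵒᵖ V] [AddCommGroup W] [Module Kᵐᵒᵖ W]
  [AddCommGroup X] [Module Kᵐᵒᵖ X]

theorem Dual.apply_smul (φ : Dual K V) (a : K) (x : V) :
    φ (MulOpposite.op a • x) = star a * φ x := by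
  rw [map_smulₛₗ]; rfl

theorem Dual.smul_apply' (φ : Dual K V) (b : K) (x : V) :
    (MulOpposite.op b • φ) x = φ x * b := rfl

/-- The adjoint linear mapping `f* φ = φ ∘ f`. -/
def dualMap (f : V →ₗ[Kᵐᵒᵖ] W) : Dual K W →ₗ[Kᵐᵒᵖ] Dual K V where
  toFun φ := φ.comp f
  map_add' _ _ := rfl
  map_smul' _ _ := rfl

@[simp] theorem dualMap_apply (f : V →ₗ[Kᵐᵒᵖ] W) (φ : Dual K W) (x : V) :
    dualMap f φ x = φ (f x) := rfl

/-- The canonical map `V → V**`, `x ↦ (φ ↦ star (φ x))`. -/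
def evalMap : V →ₗ[Kᵐᵒᵖ] Dual K (Dual K V) where
  toFun x :=
    { toFun := fun φ => star (φ x)
      map_add' := fun φ ψ => by simp
      map_smul' := fun c φ => by
        induction c using MulOpposite.rec' with
        | _ c => rw [Dual.smul_apply', star_mul]; rfl }
  map_add' x y := by ext φ; simp
  map_smul' c x := by
    ext φ
    induction c using MulOpposite.rec' with
    | _ c =>
      change star (φ (MulOpposite.op c • x)) = star (φ x) * c
      rw [Dual.apply_smul, star_mul, star_star]

@[simp] theorem evalMap_apply (x : V) (φ : Dual K V) : evalMap x φ = star (φ x) := rfl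

/-- Coordinates of semilinear forms with respect to a basis. -/
noncomputable def dualEquivFun {ι : Type*} [Finite ι] (b : Module.Basis ι Kᵐᵒᵖ V) :
    Dual K V ≃ₗ[Kᵐᵒᵖ] (ι → K) :=
  LinearEquiv.ofBijective
    { toFun := fun φ i => φ (b i)
      map_add' := fun _ _ => rfl
      map_smul' := fun _ _ => rfl } <| by
    have := Fintype.ofFinite ι
    constructor
    · intro φ ψ h
      exact b.ext fun i => congrFun h i
    · intro g
      refine ⟨
        { toFun := fun x => ∑ i, star (b.repr x i).unop * g i
          map_add' := fun x y => by simp [add_mul, Finset.sum_add_distrib]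
          map_smul' := fun c x => by
            induction c using MulOpposite.rec' with
            | _ c => simp [Finset.mul_sum, mul_assoc, starRingEquiv] }, ?_⟩
      funext i
      classical
      simp [Finsupp.single_apply, apply_ite]

theorem finrank_self {K : Type k} [DivisionRing K] : Module.finrank Kᵐᵒᵖ K = 1 :=
  finrank_eq_one (1 : K) one_ne_zero fun w => ⟨MulOpposite.op w, by simp⟩

instance finite_self {K : Type k} [DivisionRing K] : Module.Finite Kᵐᵒᵖ K :=
  Module.finite_of_finrank_eq_succ (n := 0) finrank_self

instance Dual.finite [Module.Finite Kᵐᵒᵖ V] : Module.Finite Kᵐᵒᵖ (Dual K V) :=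
  Module.Finite.equiv (dualEquivFun (K := K) (Module.finBasis Kᵐᵒᵖ V)).symm

theorem Dual.finrank_eq [Module.Finite Kᵐᵒᵖ V] :
    Module.finrank Kᵐᵒᵖ (Dual K V) = Module.finrank Kᵐᵒᵖ V := by
  rw [(dualEquivFun (K := K) (Module.finBasis Kᵐᵒᵖ V)).finrank_eq, Module.finrank_pi_fintype]
  simp [finrank_self]

theorem evalMap_injective [Module.Finite Kᵐᵒᵖ V] :
    Function.Injective (evalMap : V →ₗ[Kᵐᵒᵖ] Dual K (Dual K V)) := by
  rw [← LinearMap.ker_eq_bot, LinearMap.ker_eq_bot']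
  intro x hx
  let b := Module.finBasis Kᵐᵒᵖ V
  apply b.repr.injective
  ext i
  have h : ∀ φ : Dual K V, φ x = 0 := fun φ => by
    have := congrArg (fun Φ : Dual K (Dual K V) => Φ φ) hx
    simpa using this
  let φ : Dual K V :=
    { toFun := fun x => star (b.repr x i).unop
      map_add' := fun x y => by simp
      map_smul' := fun c x => by
        induction c using MulOpposite.rec' with
        | _ c => simp [starRingEquiv] }
  have := h φ
  simpa [φ] using this

theorem evalMap_bijective [Module.Finite Kᵐᵒᵖ V] :
    Function.Bijective (evalMap : V →ₗ[Kᵐᵒᵖ] Dual K (Dual K V)) := by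
  refine ⟨evalMap_injective, ?_⟩
  exact (LinearMap.injective_iff_surjective_of_finrank_eq_finrank
    (by rw [Dual.finrank_eq, Dual.finrank_eq])).1 evalMap_injective

theorem Dual.subsingleton [Subsingleton V] : Subsingleton (Dual K V) :=
  ⟨fun φ ψ => by ext x; rw [Subsingleton.elim x 0, map_zero, map_zero]⟩

/-- The hyperbolic pairing: `(a, φ)` in `V ⊕ W*` acts on `(b, ψ)` in `W ⊕ V*` as
`φ b + star (ψ a)`. -/
def hyper : (V × Dual K W) →ₗ[Kᵐᵒᵖ] Dual K (W × Dual K V) where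
  toFun p :=
    { toFun := fun q => p.2 q.1 + star (q.2 p.1)
      map_add' := fun q q' => by
        simp only [Prod.fst_add, Prod.snd_add, map_add, LinearMap.add_apply, star_add]
        abel
      map_smul' := fun c q => by
        induction c using MulOpposite.rec' with
        | _ c =>
          change p.2 (MulOpposite.op c • q.1) + star (q.2 p.1 * c) = star c * (_ + _)
          rw [Dual.apply_smul, star_mul, mul_add] }
  map_add' p p' := by
    refine LinearMap.ext fun q => ?_
    change (p.2 + p'.2) q.1 + star (q.2 (p.1 + p'.1)) =
      (p.2 q.1 + star (q.2 p.1)) + (p'.2 q.1 + star (q.2 p'.1))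
    rw [LinearMap.add_apply, map_add, star_add]
    abel
  map_smul' c p := by
    refine LinearMap.ext fun q => ?_
    induction c using MulOpposite.rec' with
    | _ c =>
      change p.2 q.1 * c + star (q.2 (MulOpposite.op c • p.1)) =
        (p.2 q.1 + star (q.2 p.1)) * c
      rw [Dual.apply_smul, star_mul, star_star, add_mul]

@[simp] theorem hyper_apply (p : V × Dual K W) (q : W × Dual K V) :
    hyper p q = p.2 q.1 + star (q.2 p.1) := rfl

theorem hyper_bijective [Module.Finite Kᵐᵒᵖ V] :
    Function.Bijective (hyper : (V × Dual K W) →ₗ[Kᵐᵒᵖ] Dual K (W × Dual K V)) := by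
  constructor
  · rintro ⟨a, φ⟩ ⟨a', φ'⟩ h
    have h' := fun q : W × Dual K V => congrArg (fun Φ : Dual K (W × Dual K V) => Φ q) h
    refine Prod.ext ?_ ?_
    · apply evalMap_injective (K := K)
      refine LinearMap.ext fun ψ => ?_
      simpa using h' (0, ψ)
    · refine LinearMap.ext fun b => ?_
      simpa using h' (b, 0)
  · intro Φ
    obtain ⟨a, ha⟩ := (evalMap_bijective (K := K)).2
      (Φ.comp (LinearMap.inr Kᵐᵒᵖ W (Dual K V)))
    refine ⟨(a, Φ.comp (LinearMap.inl Kᵐᵒᵖ W (Dual K V))), ?_⟩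
    refine LinearMap.ext fun q => ?_
    have h := congrArg (fun Ψ : Dual K (Dual K V) => Ψ q.2) ha
    change star (q.2 a) = Φ (0, q.2) at h
    change Φ (q.1, 0) + star (q.2 a) = Φ q
    rw [h, ← map_add]
    simp

end Dual

/-- Representations over `K` of a category `C` linear over the centre of `K`: linear functors to
right vector spaces over `K`, of finite total dimension. -/
structure LRep (K : Type k) [DivisionRing K]
    (C : Type u) [Category.{v} C] [Preadditive C] [Linear (Subring.center K) C] where
  obj : C → Type k
  [addCommGroup : ∀ x, AddCommGroup (obj x)]
  [module : ∀ x, Module Kᵐᵒᵖ (obj x)]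
  [finite : ∀ x, Module.Finite Kᵐᵒᵖ (obj x)]
  finite_support : {x | Nontrivial (obj x)}.Finite
  map : ∀ {x y : C}, (x ⟶ y) → obj x →ₗ[Kᵐᵒᵖ] obj y
  map_id : ∀ x : C, map (𝟙 x) = LinearMap.id
  map_comp : ∀ {x y z : C} (α : x ⟶ y) (β : y ⟶ z), map (α ≫ β) = map β ∘ₗ map α
  map_add : ∀ {x y : C} (α β : x ⟶ y), map (α + β) = map α + map β
  map_smul : ∀ {x y : C} (c : Subring.center K) (α : x ⟶ y) (a : obj x),
    map (c • α) a = MulOpposite.op (c : K) • map α a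

attribute [instance] LRep.addCommGroup LRep.module LRep.finite

section LRep

variable {K : Type k} [DivisionRing K] {C : Type u} [Category.{v} C] [Preadditive C]
  [Linear (Subring.center K) C]

/-- Morphisms of representations: natural transformations. -/
@[ext]
structure LRep.Hom (A B : LRep K C) where
  app : ∀ x : C, A.obj x →ₗ[Kᵐᵒᵖ] B.obj x
  naturality : ∀ {x y : C} (α : x ⟶ y), app y ∘ₗ A.map α = B.map α ∘ₗ app x

instance : Category (LRep K C) where
  Hom A B := LRep.Hom A B
  id A := ⟨fun _ => LinearMap.id, fun _ => rfl⟩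
  comp f g := ⟨fun x => g.app x ∘ₗ f.app x, fun α => by
    rw [LinearMap.comp_assoc, f.naturality, ← LinearMap.comp_assoc, g.naturality,
      LinearMap.comp_assoc]⟩

namespace LRep

/-- The component of a morphism of representations at an object. -/
def app {A B : LRep K C} (f : A ⟶ B) (x : C) : A.obj x →ₗ[Kᵐᵒᵖ] B.obj x := LRep.Hom.app f x

theorem app_naturality {A B : LRep K C} (f : A ⟶ B) {x y : C} (α : x ⟶ y) (a : A.obj x) :
    app f y (A.map α a) = B.map α (app f x a) :=
  LinearMap.congr_fun (LRep.Hom.naturality f α) a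

@[ext]
theorem hom_ext {A B : LRep K C} {f g : A ⟶ B} (h : ∀ x a, app f x a = app g x a) : f = g :=
  LRep.Hom.ext (funext fun x => LinearMap.ext (h x))

@[simp] theorem id_app (A : LRep K C) (x : C) (a : A.obj x) : app (𝟙 A) x a = a := rfl

@[simp] theorem comp_app {A B D : LRep K C} (f : A ⟶ B) (g : B ⟶ D) (x : C) (a : A.obj x) :
    app (f ≫ g) x a = app g x (app f x a) := rfl

@[simp] theorem map_id_apply (A : LRep K C) (x : C) (a : A.obj x) : A.map (𝟙 x) a = a := by
  rw [A.map_id]; rfl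

@[simp] theorem map_comp_apply (A : LRep K C) {x y z : C} (α : x ⟶ y) (β : y ⟶ z) (a : A.obj x) :
    A.map (α ≫ β) a = A.map β (A.map α a) := by
  rw [A.map_comp]; rfl

/-- Natural transformations as a subgroup of the families of linear maps. -/
def homSubgroup (A B : LRep K C) : AddSubgroup (∀ x, A.obj x →ₗ[Kᵐᵒᵖ] B.obj x) where
  carrier := {f | ∀ {x y : C} (α : x ⟶ y), f y ∘ₗ A.map α = B.map α ∘ₗ f x}
  zero_mem' := fun α => by simp
  add_mem' := fun hf hg _ _ α => by
    simp only [Pi.add_apply, LinearMap.add_comp, LinearMap.comp_add, hf α, hg α]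
  neg_mem' := fun hf _ _ α => by
    simp only [Pi.neg_apply, LinearMap.neg_comp, LinearMap.comp_neg, hf α]

/-- Morphisms of representations are added componentwise. -/
instance (A B : LRep K C) : AddCommGroup (A ⟶ B) :=
  Equiv.addCommGroup (β := homSubgroup A B)
    { toFun := fun f => ⟨LRep.Hom.app f, LRep.Hom.naturality f⟩
      invFun := fun f => (⟨f.1, f.2⟩ : LRep.Hom A B)
      left_inv := fun _ => rfl
      right_inv := fun _ => rfl }

@[simp] theorem add_app {A B : LRep K C} (f g : A ⟶ B) (x : C) (a : A.obj x) :
    app (f + g) x a = app f x a + app g x a := rfl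

instance : Preadditive (LRep K C) where
  add_comp _ _ _ f f' g := by ext x a; simp
  comp_add _ _ _ f g g' := by ext x a; simp

/-- A componentwise bijective morphism is an isomorphism. -/
noncomputable def isoOfBijective {A B : LRep K C} (f : A ⟶ B)
    (hf : ∀ x, Function.Bijective (app f x)) : A ≅ B where
  hom := f
  inv := (⟨fun x => (LinearEquiv.ofBijective (app f x) (hf x)).symm, fun {x y} α => by
    ext b
    obtain ⟨a, rfl⟩ := (hf x).2 b
    have h : ∀ z (a : A.obj z), (LinearEquiv.ofBijective (app f z) (hf z)).symm (app f z a) = a :=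
      fun z a => (LinearEquiv.ofBijective (app f z) (hf z)).symm_apply_apply a
    simp only [LinearMap.comp_apply, LinearEquiv.coe_coe, h]
    rw [← app_naturality, h]⟩ : LRep.Hom B A)
  hom_inv_id := by
    ext x a
    exact (LinearEquiv.ofBijective (app f x) (hf x)).symm_apply_apply a
  inv_hom_id := by
    ext x b
    exact (LinearEquiv.ofBijective (app f x) (hf x)).apply_symm_apply b

/-- The component of an isomorphism of representations. -/
def isoApp {A B : LRep K C} (e : A ≅ B) (x : C) : A.obj x ≃ₗ[Kᵐᵒᵖ] B.obj x where
  __ := app e.hom x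
  invFun := app e.inv x
  left_inv a := by
    change app e.inv x (app e.hom x a) = a
    rw [← comp_app, e.hom_inv_id, id_app]
  right_inv b := by
    change app e.hom x (app e.inv x b) = b
    rw [← comp_app, e.inv_hom_id, id_app]

@[simp] theorem isoApp_apply {A B : LRep K C} (e : A ≅ B) (x : C) (a : A.obj x) :
    isoApp e x a = app e.hom x a := rfl

@[simp] theorem isoApp_symm_apply {A B : LRep K C} (e : A ≅ B) (x : C) (b : B.obj x) :
    (isoApp e x).symm b = app e.inv x b := rfl

/-- The direct sum of two representations. -/
def sum (A B : LRep K C) : LRep K C where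
  obj x := A.obj x × B.obj x
  finite_support := (A.finite_support.union B.finite_support).subset fun x hx => by
    by_contra h
    simp only [Set.mem_union, Set.mem_ofPred_eq, not_or, not_nontrivial_iff_subsingleton] at h hx
    have := h.1
    have := h.2
    exact not_nontrivial (A.obj x × B.obj x) hx
  map α := (A.map α).prodMap (B.map α)
  map_id x := by rw [A.map_id, B.map_id]; rfl
  map_comp α β := by rw [A.map_comp, B.map_comp]; rfl
  map_add α β := by rw [A.map_add, B.map_add]; rfl
  map_smul c α a := by
    ext
    · exact A.map_smul c α a.1
    · exact B.map_smul c α a.2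

/-- The zero representation: all spaces are zero. -/
def IsZero (A : LRep K C) : Prop := ∀ x, Subsingleton (A.obj x)

/-- Direct-sum-indecomposable representations. -/
def Indecomposable (A : LRep K C) : Prop :=
  ¬ A.IsZero ∧ ∀ X Y : LRep K C, Nonempty (A ≅ X.sum Y) → X.IsZero ∨ Y.IsZero

/-- The direct sum of a finite family of representations. -/
def pi {ι : Type} [Fintype ι] (A : ι → LRep K C) : LRep K C where
  obj x := ∀ i, (A i).obj x
  finite_support := (Set.finite_iUnion fun i => (A i).finite_support).subset fun x hx => by
    by_contra h
    simp only [Set.mem_iUnion, Set.mem_ofPred_eq, not_exists,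
      not_nontrivial_iff_subsingleton] at h hx
    exact not_nontrivial (∀ i, (A i).obj x) hx
  map α := LinearMap.pi fun i => (A i).map α ∘ₗ LinearMap.proj i
  map_id x := by ext a i; simp
  map_comp α β := by ext a i; simp
  map_add α β := by
    ext a i
    exact LinearMap.congr_fun ((A i).map_add α β) (a i)
  map_smul c α a := by
    ext i
    exact (A i).map_smul c α (a i)

@[simp] theorem pi_map_apply {ι : Type} [Fintype ι] (A : ι → LRep K C) {x y : C} (α : x ⟶ y)
    (a : (pi A).obj x) (i : ι) : (pi A).map α a i = (A i).map α (a i) := rfl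

@[simp] theorem sum_map_apply (A B : LRep K C) {x y : C} (α : x ⟶ y) (a : (A.sum B).obj x) :
    (A.sum B).map α a = (A.map α a.1, B.map α a.2) := rfl

end LRep

end LRep

section Adjoint

variable {K : Type k} [DivisionRing K] [StarRing K] {C : Type u} [Category.{v} C] [Preadditive C]
  [Linear (Subring.center K) C] [Involution C] [LinearInvolution K C]

open Involution

theorem ob_injective : Function.Injective (ob : C → C) := fun x y h => by
  rw [← ob_ob x, h, ob_ob]

/-- The adjoint representation `A°`, with `A°_x = (A_{x*})*` and `A°_α = (A_{α*})*`. -/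
def LRep.adj (A : LRep K C) : LRep K C where
  obj x := Dual K (A.obj (ob x))
  finite_support := (A.finite_support.preimage ob_injective.injOn).subset fun x hx => by
    by_contra h
    simp only [Set.mem_preimage, Set.mem_ofPred_eq, not_nontrivial_iff_subsingleton] at h hx
    have := Dual.subsingleton (K := K) (V := A.obj (ob x))
    exact not_nontrivial _ hx
  map α := dualMap (A.map (mor α))
  map_id x := by
    ext φ a
    rw [dualMap_apply, mor_id, A.map_id_apply]; rfl
  map_comp α β := by
    ext φ a
    simp [mor_comp]
  map_add α β := by
    ext φ a
    rw [dualMap_apply, LinearInvolution.mor_add K, A.map_add, LinearMap.add_apply]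
    exact LinearMap.map_add _ _ _
  map_smul c α φ := by
    ext a
    rw [dualMap_apply, LinearInvolution.mor_smul, A.map_smul, Dual.apply_smul, Dual.smul_apply',
      dualMap_apply]
    change star (star (c : K)) * _ = _
    rw [star_star]
    exact (Subring.mem_center_iff.1 c.2 _).symm

/-- The elements of `A°_x` as semilinear forms on `A_{x*}`. -/
abbrev LRep.form (A : LRep K C) {x : C} (φ : A.adj.obj x) : Dual K (A.obj (ob x)) := φ

@[simp] theorem LRep.adj_map_apply (A : LRep K C) {x y : C} (α : x ⟶ y) (φ : A.adj.obj x)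
    (a : A.obj (ob y)) : A.form (A.adj.map α φ) a =
      A.form φ (A.map (mor α) a) := rfl

/-- The adjoint morphism `f° : B° ⟶ A°` of `f : A ⟶ B`, with `f°_x = (f_{x*})*`. -/
def LRep.adjHom {A B : LRep K C} (f : A ⟶ B) : B.adj ⟶ A.adj :=
  (⟨fun x => dualMap (LRep.app f (ob x)), fun α => by
    refine LinearMap.ext fun φ => LinearMap.ext fun a => ?_
    change B.form φ (B.map (mor α) (LRep.app f _ a)) =
      B.form φ (LRep.app f _ (A.map (mor α) a))
    rw [LRep.app_naturality]⟩ : LRep.Hom B.adj A.adj)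

variable (K C) in
/-- Selfadjoint representations: a representation `A` together with an identification of `A` with
`A°`. The identification consists of the actions `act x a b` of the elements `a` of `A_x` on the
elements `b` of `A_{x*}`, which make `A_x` into the space of semilinear forms on `A_{x*}`; it is
compatible with the identification of a space with its second adjoint, that is, the action of
`A_{x*}` on `A_{x**} = A_x` is the conjugate of the action of `A_x` on `A_{x*}`. -/
structure SelfRep where
  rep : LRep K C
  iso : rep ≅ rep.adj
  symm : ∀ (x : C) (a : rep.obj x) (b : rep.obj (ob x)),
    rep.form (LRep.app iso.hom x a) b =
      star (rep.form (LRep.app iso.hom (ob x) b) (rep.map (eqToHom (ob_ob x).symm) a))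

namespace SelfRep

open LRep

/-- The action of `a ∈ M_x` on `b ∈ M_{x*}`. -/
def act (M : SelfRep K C) (x : C) : M.rep.obj x →ₗ[Kᵐᵒᵖ] Dual K (M.rep.obj (ob x)) :=
  LRep.app M.iso.hom x

theorem act_symm (M : SelfRep K C) (x : C) (a : M.rep.obj x) (b : M.rep.obj (ob x)) :
    M.act x a b = star (M.act (ob x) b (M.rep.map (eqToHom (ob_ob x).symm) a)) := M.symm x a b

theorem act_bijective (M : SelfRep K C) (x : C) : Function.Bijective (M.act x) :=
  (isoApp M.iso x).bijective

theorem act_map (M : SelfRep K C) {x y : C} (α : x ⟶ y) (a : M.rep.obj x)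
    (b : M.rep.obj (ob y)) : M.act y (M.rep.map α a) b = M.act x a (M.rep.map (mor α) b) :=
  congrArg (fun φ : Dual K (M.rep.obj (ob y)) => φ b) (LRep.app_naturality M.iso.hom α a)

/-- A selfadjoint representation from a system of actions. -/
noncomputable def mk' (A : LRep K C) (p : ∀ x, A.obj x →ₗ[Kᵐᵒᵖ] Dual K (A.obj (ob x)))
    (hp : ∀ x, Function.Bijective (p x))
    (hmap : ∀ {x y : C} (α : x ⟶ y) (a : A.obj x) (b : A.obj (ob y)),
      p y (A.map α a) b = p x a (A.map (mor α) b))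
    (hsymm : ∀ (x : C) (a : A.obj x) (b : A.obj (ob x)),
      p x a b = star (p (ob x) b (A.map (eqToHom (ob_ob x).symm) a))) : SelfRep K C where
  rep := A
  iso := isoOfBijective (A := A) (B := A.adj)
    (⟨p, fun α =>
      LinearMap.ext fun a => LinearMap.ext fun b => hmap α a b⟩ : LRep.Hom A A.adj) hp
  symm := hsymm

/-- For selfadjoint representations `M` and `N`, the adjoint `f° : N = N° ⟶ M° = M` of a morphism
`f : M ⟶ N`. -/
def adjoint {M N : SelfRep K C} (f : M.rep ⟶ N.rep) : N.rep ⟶ M.rep :=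
  N.iso.hom ≫ adjHom f ≫ M.iso.inv

theorem act_adjoint {M N : SelfRep K C} (f : M.rep ⟶ N.rep) (x : C) (b : N.rep.obj x)
    (a : M.rep.obj (ob x)) :
    M.act x (app (adjoint f) x b) a = N.act x b (app f (ob x) a) := by
  have h : adjoint f ≫ M.iso.hom = N.iso.hom ≫ adjHom f := by simp [adjoint]
  exact congrArg (fun g : N.rep ⟶ M.rep.adj => M.rep.form (app g x b) a) h

theorem act_adjoint' {M N : SelfRep K C} (f : M.rep ⟶ N.rep) (x : C) (a : M.rep.obj x)
    (b : N.rep.obj (ob x)) :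
    N.act x (app f x a) b = M.act x a (app (adjoint f) (ob x) b) := by
  rw [act_symm, ← app_naturality, ← act_adjoint, ← act_symm]

theorem eq_adjoint {M N : SelfRep K C} {f : M.rep ⟶ N.rep} {g : N.rep ⟶ M.rep}
    (h : ∀ x b a, M.act x (app g x b) a = N.act x b (app f (ob x) a)) : g = adjoint f := by
  ext x b
  apply (M.act_bijective x).1
  ext a
  rw [h, act_adjoint]

theorem adjoint_adjoint {M N : SelfRep K C} (f : M.rep ⟶ N.rep) : adjoint (adjoint f) = f :=
  (eq_adjoint fun x a b => act_adjoint' f x a b).symm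

theorem adjoint_comp {M N L : SelfRep K C} (f : M.rep ⟶ N.rep) (g : N.rep ⟶ L.rep) :
    adjoint (M := M) (N := L) (f ≫ g) = adjoint g ≫ adjoint f :=
  (eq_adjoint fun x b a => by simp only [comp_app, act_adjoint]).symm

theorem adjoint_add {M N : SelfRep K C} (f g : M.rep ⟶ N.rep) :
    adjoint (f + g) = adjoint f + adjoint g :=
  (eq_adjoint fun x b a => by
    simp only [add_app, _root_.map_add, LinearMap.add_apply, act_adjoint]).symm

/-- A congruence is an isomorphism `f` of selfadjoint representations with `f° = f⁻¹`. -/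
def Congruent (M N : SelfRep K C) : Prop := ∃ f : M.rep ≅ N.rep, adjoint f.hom = f.inv

/-- The orthogonal sum of a finite family of selfadjoint representations: the direct sum with
`(φ₁ + ⋯ + φ_r)(a₁ + ⋯ + a_r) = φ₁(a₁) + ⋯ + φ_r(a_r)`. -/
noncomputable def orthSum {ι : Type} [Fintype ι] (M : ι → SelfRep K C) : SelfRep K C :=
  mk' (LRep.pi fun i => (M i).rep)
    (fun x =>
      { toFun := fun a =>
          { toFun := fun b => ∑ i, (M i).act x (a i) (b i)
            map_add' := fun b b' => by
              simp only [← Finset.sum_add_distrib]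
              exact Finset.sum_congr rfl fun i _ => ((M i).act x (a i)).map_add (b i) (b' i)
            map_smul' := fun c b => by
              rw [smul_eq_mul, Finset.mul_sum]
              exact Finset.sum_congr rfl fun i _ => ((M i).act x (a i)).map_smulₛₗ c (b i) }
        map_add' := fun a a' => by
          ext b
          change ∑ i, (M i).act x (a i + a' i) (b i) =
            ∑ i, (M i).act x (a i) (b i) + ∑ i, (M i).act x (a' i) (b i)
          simp only [_root_.map_add, LinearMap.add_apply, Finset.sum_add_distrib]
        map_smul' := fun c a => by
          ext b
          change ∑ i, (M i).act x (c • a i) (b i) = c • ∑ i, (M i).act x (a i) (b i)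
          simp only [_root_.map_smul, LinearMap.smul_apply, Finset.smul_sum] })
    (fun x => by
      classical
      constructor
      · intro a a' h
        funext i
        apply ((M i).act_bijective x).1
        ext b
        have := congrArg (fun φ : Dual K (∀ i, (M i).rep.obj (ob x)) => φ (Pi.single i b)) h
        change ∑ j, (M j).act x (a j) (Pi.single (M := fun i => (M i).rep.obj (ob x)) i b j) =
          ∑ j, (M j).act x (a' j) (Pi.single (M := fun i => (M i).rep.obj (ob x)) i b j) at this
        rw [Finset.sum_eq_single i, Finset.sum_eq_single i] at this
        · simpa using this
        all_goals intros; simp_all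
      · intro Φ
        change Dual K (∀ i, (M i).rep.obj (ob x)) at Φ
        choose a ha using fun i => ((M i).act_bijective x).2
          (Φ.comp (LinearMap.single Kᵐᵒᵖ (fun i => (M i).rep.obj (ob x)) i))
        refine ⟨a, ?_⟩
        ext b
        change ∑ i, (M i).act x (a i) (b i) = Φ b
        simp only [ha]
        change ∑ i, Φ (Pi.single i (b i)) = Φ b
        rw [← map_sum]
        congr 1
        exact Finset.univ_sum_single b)
    (fun α a b => Finset.sum_congr rfl fun i _ => (M i).act_map α (a i) (b i))
    (fun x a b => by
      change ∑ i, (M i).act x (a i) (b i) = star (∑ i, _)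
      rw [star_sum]
      exact Finset.sum_congr rfl fun i _ => (M i).act_symm x (a i) (b i))

end SelfRep

theorem LRep.map_eqToHom_mor_mor (A : LRep K C) {x y : C} (α : x ⟶ y) (a : A.obj x) :
    A.map (mor (mor α)) (A.map (eqToHom (ob_ob x).symm) a) =
      A.map (eqToHom (ob_ob y).symm) (A.map α a) := by
  rw [mor_mor, ← map_comp_apply, ← map_comp_apply]
  simp

theorem LRep.map_eqToHom_bijective (A : LRep K C) {x y : C} (h : x = y) :
    Function.Bijective (A.map (eqToHom h)) := by
  subst h
  simp only [eqToHom_refl, A.map_id]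
  exact Function.bijective_id

theorem LRep.dual_map_eqToHom (A : LRep K C) {x y : C} (h : x = y) (h' : ob y = ob x)
    (φ : A.adj.obj x) (a : A.obj (ob y)) :
    A.form (A.adj.map (eqToHom h) φ) a =
      A.form φ (A.map (eqToHom h') a) := by
  subst h
  simp

/-- The selfadjoint representation `A⁺` on `A ⊕ A°`: an element `(a, φ)` of `A_x ⊕ (A_{x*})*` acts
on an element `(b, ψ)` of `A_{x*} ⊕ (A_{x**})*` as `φ(b) + star (ψ(a))`, where `A_x = A_{x**}`. -/
noncomputable def LRep.plus (A : LRep K C) : SelfRep K C :=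
  SelfRep.mk' (A.sum A.adj)
    (fun x => (hyper (V := A.obj (ob (ob x))) (W := A.obj (ob x))).comp
      ((A.map (eqToHom (ob_ob x).symm)).prodMap LinearMap.id))
    (fun x => hyper_bijective.comp
      (Function.Bijective.prodMap (A.map_eqToHom_bijective (ob_ob x).symm) Function.bijective_id))
    (fun {x y} α a b => by
      change A.form a.2 (A.map (mor α) b.1) +
          star (A.form b.2 (A.map _ (A.map α a.1))) =
        A.form a.2 (A.map (mor α) b.1) +
          star (A.form b.2 (A.map (mor (mor α)) (A.map _ a.1)))
      rw [A.map_eqToHom_mor_mor])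
    (fun x a b => by
      change A.form a.2 b.1 + star (A.form b.2 (A.map _ a.1)) =
        star (A.form b.2 (A.map _ a.1) + star (A.form (A.adj.map _ a.2) (A.map _ b.1)))
      rw [A.dual_map_eqToHom _ (ob_ob (ob x)), star_add, star_star, ← map_comp_apply]
      simp [add_comm])

variable (C) in
/-- A set `S₀` of objects that contains exactly one object of each pair `x, x*`. -/
structure HalfObjects where
  carrier : Set C
  xor_mem : ∀ x : C, Xor (x ∈ carrier) (ob x ∈ carrier)

theorem HalfObjects.ob_mem_iff (S : HalfObjects C) (x : C) :
    ob x ∈ S.carrier ↔ x ∉ S.carrier := by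
  have := S.xor_mem x
  unfold Xor at this
  tauto

/-- The selfadjoint automorphisms `f = f°` of a selfadjoint representation. -/
structure SelfAut (M : SelfRep K C) where
  iso : M.rep ≅ M.rep
  selfadjoint : SelfRep.adjoint iso.hom = iso.hom

namespace SelfAut

open LRep SelfRep

variable {M : SelfRep K C}

theorem act_hom (f : SelfAut M) (x : C) (a : M.rep.obj x) (b : M.rep.obj (ob x)) :
    M.act x (app f.iso.hom x a) b = M.act x a (app f.iso.hom (ob x) b) := by
  conv_lhs => rw [← f.selfadjoint]
  exact act_adjoint _ _ _ _

theorem hom_inv_app (f : SelfAut M) (x : C) (a : M.rep.obj x) :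
    app f.iso.inv x (app f.iso.hom x a) = a := (isoApp f.iso x).symm_apply_apply a

theorem inv_hom_app (f : SelfAut M) (x : C) (a : M.rep.obj x) :
    app f.iso.hom x (app f.iso.inv x a) = a := (isoApp f.iso x).apply_symm_apply a

theorem act_inv (f : SelfAut M) (x : C) (a : M.rep.obj x) (b : M.rep.obj (ob x)) :
    M.act x (app f.iso.inv x a) b = M.act x a (app f.iso.inv (ob x) b) := by
  conv_lhs => rw [← f.inv_hom_app (ob x) b]
  rw [← act_hom, inv_hom_app]

open Classical in
/-- The maps `f̃_x = f_x` for `x ∈ S₀` and `f̃_x = 1` otherwise. -/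
noncomputable def tilde (S : HalfObjects C) (f : SelfAut M) (x : C) :
    M.rep.obj x ≃ₗ[Kᵐᵒᵖ] M.rep.obj x :=
  if x ∈ S.carrier then isoApp f.iso x else LinearEquiv.refl _ _

theorem tilde_of_mem {S : HalfObjects C} (f : SelfAut M) {x : C} (hx : x ∈ S.carrier) :
    f.tilde S x = isoApp f.iso x := if_pos hx

theorem tilde_of_notMem {S : HalfObjects C} (f : SelfAut M) {x : C} (hx : x ∉ S.carrier) :
    f.tilde S x = LinearEquiv.refl _ _ := if_neg hx

theorem tilde_eqToHom (S : HalfObjects C) (f : SelfAut M) {x y : C} (h : x = y)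
    (a : M.rep.obj x) : (f.tilde S y).symm (M.rep.map (eqToHom h) (f.tilde S x a)) =
      M.rep.map (eqToHom h) a := by
  subst h
  simp

/-- The representation underlying `M^f`: the same spaces, and the maps `f̃_y⁻¹ M_α f̃_x` for
`α : x ⟶ y`. -/
noncomputable def twistRep (S : HalfObjects C) (f : SelfAut M) : LRep K C where
  obj := M.rep.obj
  finite_support := M.rep.finite_support
  map {x y} α := (f.tilde S y).symm ∘ₗ M.rep.map α ∘ₗ f.tilde S x
  map_id x := by ext a; simp
  map_comp α β := by ext a; simp
  map_add α β := by ext a; simp [M.rep.map_add]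
  map_smul c α a := by simp [M.rep.map_smul]

theorem act_twist (S : HalfObjects C) (f : SelfAut M) {x y : C} (α : x ⟶ y) (a : M.rep.obj x)
    (b : M.rep.obj (ob y)) :
    M.act y ((f.tilde S y).symm (M.rep.map α (f.tilde S x a))) b =
      M.act x a ((f.tilde S (ob x)).symm (M.rep.map (mor α) (f.tilde S (ob y) b))) := by
  by_cases hx : x ∈ S.carrier <;> by_cases hy : y ∈ S.carrier
  · have hx' := mt (S.ob_mem_iff x).1 (not_not.2 hx)
    have hy' := mt (S.ob_mem_iff y).1 (not_not.2 hy)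
    simp [tilde_of_mem f hx, tilde_of_mem f hy, tilde_of_notMem f hx', tilde_of_notMem f hy',
      app_naturality, hom_inv_app, act_map]
  · have hx' := mt (S.ob_mem_iff x).1 (not_not.2 hx)
    have hy' := (S.ob_mem_iff y).2 hy
    simp [tilde_of_mem f hx, tilde_of_notMem f hy, tilde_of_notMem f hx', tilde_of_mem f hy',
      ← app_naturality, act_map, act_hom]
  · have hx' := (S.ob_mem_iff x).2 hx
    have hy' := mt (S.ob_mem_iff y).1 (not_not.2 hy)
    simp [tilde_of_notMem f hx, tilde_of_mem f hy, tilde_of_mem f hx', tilde_of_notMem f hy',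
      app_naturality, act_map, act_inv]
  · have hx' := (S.ob_mem_iff x).2 hx
    have hy' := (S.ob_mem_iff y).2 hy
    simp [tilde_of_notMem f hx, tilde_of_notMem f hy, tilde_of_mem f hx', tilde_of_mem f hy',
      app_naturality, hom_inv_app, act_map]

theorem act_symm_twist (S : HalfObjects C) (f : SelfAut M) (x : C) (a : M.rep.obj x)
    (b : M.rep.obj (ob x)) : M.act x a b = star (M.act (ob x) b
      ((f.tilde S _).symm (M.rep.map (eqToHom (ob_ob x).symm) (f.tilde S x a)))) := by
  rw [tilde_eqToHom, ← act_symm]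

/-- The selfadjoint representation `M^f`, for `f = f°` an automorphism of `M = M°`: the maps
`M_α`, `α : x ⟶ y`, are replaced by `f̃_y⁻¹ M_α f̃_x`, the identification of the spaces of `M` with
those of `M°` is kept. -/
noncomputable def twist (S : HalfObjects C) (f : SelfAut M) : SelfRep K C :=
  SelfRep.mk' (f.twistRep S) M.act M.act_bijective (f.act_twist S) (f.act_symm_twist S)

end SelfAut

section Quotient

variable {R : Type*} [Ring R] [StarRing R]

theorem star_mem_jacobson {r : R} (hr : r ∈ Ring.jacobson R) : star r ∈ Ring.jacobson R := by
  have left : ∀ s ∈ Ring.jacobson R, ∃ t, t * (s + 1) = 1 := by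
    intro s hs
    rw [← Ideal.jacobson_bot] at hs
    obtain ⟨t, ht⟩ := Ideal.exists_mul_add_sub_mem_of_mem_jacobson s hs
    exact ⟨t, sub_eq_zero.1 ht⟩
  have right : ∀ s ∈ Ring.jacobson R, ∃ t, (s + 1) * t = 1 := by
    intro s hs
    obtain ⟨t, ht⟩ := left s hs
    obtain ⟨t', ht'⟩ := left (-(t * s)) (neg_mem ((Ring.jacobson R).mul_mem_left t hs))
    have h1 : -(t * s) + 1 = t := by rw [← ht]; noncomm_ring
    rw [h1] at ht'
    refine ⟨t, ?_⟩
    rwa [← left_inv_eq_right_inv ht' ht]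
  rw [← Ideal.jacobson_bot, Ideal.mem_jacobson_iff]
  intro y
  obtain ⟨t, ht⟩ := right _ ((Ring.jacobson R).mul_mem_right (star y) hr)
  refine ⟨star t, ?_⟩
  have h := congrArg star ht
  simp only [star_mul, star_add, star_one, star_star] at h
  rw [Submodule.mem_bot, ← h]
  noncomm_ring

variable (R) in
/-- The involution of `R / rad R`, as a homomorphism to the opposite ring. -/
def starQuotientHom : (R ⧸ Ring.jacobson R) →+* (R ⧸ Ring.jacobson R)ᵐᵒᵖ :=
  Ideal.Quotient.lift (Ring.jacobson R)
    ((Ideal.Quotient.mk (Ring.jacobson R)).op.comp (starRingEquiv (R := R)).toRingHom)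
    fun _ hr => congrArg MulOpposite.op
      (Ideal.Quotient.eq_zero_iff_mem.2 (star_mem_jacobson hr))

theorem starQuotientHom_mk (r : R) :
    starQuotientHom R (Ideal.Quotient.mk _ r) =
      MulOpposite.op (Ideal.Quotient.mk (Ring.jacobson R) (star r)) := rfl

end Quotient

namespace SelfRep

/-- The endomorphism ring of a selfadjoint representation has the involution `f ↦ f°`. -/
instance starRingEnd (M : SelfRep K C) : StarRing (End M.rep) where
  star f := adjoint (M := M) (N := M) f
  star_involutive f := adjoint_adjoint (M := M) (N := M) f
  star_mul f g := adjoint_comp (M := M) (N := M) (L := M) g f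
  star_add f g := adjoint_add (M := M) (N := M) f g

/-- The ring `T(M) = End(M) / rad End(M)`. -/
def T (M : SelfRep K C) : Type (max u k) := End M.rep ⧸ Ring.jacobson (End M.rep)

instance (M : SelfRep K C) : Ring M.T :=
  inferInstanceAs (Ring (End M.rep ⧸ Ring.jacobson (End M.rep)))

/-- The class in `T(M)` of an endomorphism of `M`. -/
def toT (M : SelfRep K C) : End M.rep →+* M.T := Ideal.Quotient.mk (Ring.jacobson (End M.rep))

/-- The involution `(f + R)° = f° + R` of `T(M)`. -/
instance (M : SelfRep K C) : StarRing M.T where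
  star a := (starQuotientHom (End M.rep) a).unop
  star_involutive a := by
    obtain ⟨f, rfl⟩ := Ideal.Quotient.mk_surjective a
    change Ideal.Quotient.mk _ (star (star f)) = _
    rw [star_star]
  star_mul a b := congrArg MulOpposite.unop ((starQuotientHom (End M.rep)).map_mul a b)
  star_add a b := congrArg MulOpposite.unop ((starQuotientHom (End M.rep)).map_add a b)

theorem star_toT (M : SelfRep K C) (f : End M.rep) : star (M.toT f) = M.toT (star f) := rfl

/-- The elements `0 ≠ a = a°` of `T(M)`. -/
abbrev HermUnit (M : SelfRep K C) : Type (max u k) := {a : M.T // a ≠ 0 ∧ star a = a}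

end SelfRep

/-- The class in `T(M)` of a selfadjoint automorphism of `M`. -/
def SelfAut.toT {M : SelfRep K C} (f : SelfAut M) : M.T := M.toT f.iso.hom

/-- Hermitian forms `x₁° a₁ x₁ + ⋯ + x_r° a_r x_r`, `0 ≠ a_i = a_i°`, `r ≥ 1`, over `T(M)`. -/
structure HermForm (M : SelfRep K C) where
  rank : ℕ
  rank_pos : 0 < rank
  coeff : Fin rank → M.HermUnit

/-- The matrix `diag(a₁, …, a_r)` of a Hermitian form. -/
def HermForm.matrix {M : SelfRep K C} (φ : HermForm M) :
    Matrix (Fin φ.rank) (Fin φ.rank) M.T :=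
  Matrix.diagonal fun i => (φ.coeff i).1

/-- Hermitian forms are equivalent if an invertible linear change of variables `x = c y` takes one
to the other. -/
def HermForm.Equivalent {M : SelfRep K C} (φ ψ : HermForm M) : Prop :=
  ∃ (c : Matrix (Fin φ.rank) (Fin ψ.rank) M.T) (d : Matrix (Fin ψ.rank) (Fin φ.rank) M.T),
    c * d = 1 ∧ d * c = 1 ∧ c.conjTranspose * φ.matrix * c = ψ.matrix

/-- The selfadjoint representation `M^φ = M^{a₁} ⊥ ⋯ ⊥ M^{a_r}`, where `M^a = M^{f_a}` for a given
choice of selfadjoint automorphisms `f_a`. -/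
noncomputable def HermForm.toSelfRep (S : HalfObjects C) {M : SelfRep K C}
    (F : M.HermUnit → SelfAut M) (φ : HermForm M) : SelfRep K C :=
  SelfRep.orthSum fun i => (F (φ.coeff i)).twist S

/-- A representation isomorphic to a selfadjoint one. -/
def LRep.IsoToSelfadjoint (A : LRep K C) : Prop := ∃ M : SelfRep K C, Nonempty (A ≅ M.rep)

/-- `ind` is a complete system of nonisomorphic indecomposable representations; `ind₀` consists of
one selfadjoint representation isomorphic to `A` for each `A ∈ ind` that is isomorphic to a
selfadjoint representation; `ind₁` consists of all `A ∈ ind` that are isomorphic to `A°` but not to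
a selfadjoint representation, together with one representation from each pair `{A, B} ⊆ ind` such
that `A` is not isomorphic to `A°` but is isomorphic to `B°`. -/
structure IsIndSystem (ind : Set (LRep K C)) (ind₀ : Set (SelfRep K C))
    (ind₁ : Set (LRep K C)) : Prop where
  indecomposable : ∀ A ∈ ind, A.Indecomposable
  eq_of_iso : ∀ A ∈ ind, ∀ B ∈ ind, Nonempty (A ≅ B) → A = B
  complete : ∀ A : LRep K C, A.Indecomposable → ∃ B ∈ ind, Nonempty (A ≅ B)
  ind₀_iso : ∀ B ∈ ind₀, ∃ A ∈ ind, Nonempty (A ≅ B.rep)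
  ind₀_unique : ∀ A ∈ ind, A.IsoToSelfadjoint → ∃! B, B ∈ ind₀ ∧ Nonempty (A ≅ B.rep)
  ind₁_subset : ind₁ ⊆ ind
  ind₁_not : ∀ A ∈ ind₁, ¬ A.IsoToSelfadjoint
  ind₁_self : ∀ A ∈ ind, Nonempty (A ≅ A.adj) → ¬ A.IsoToSelfadjoint → A ∈ ind₁
  ind₁_pair : ∀ A ∈ ind, ∀ B ∈ ind, ¬ Nonempty (A ≅ A.adj) → Nonempty (A ≅ B.adj) →
    Xor (A ∈ ind₁) (B ∈ ind₁)

/-- The data of an orthogonal sum `A₁⁺ ⊥ ⋯ ⊥ A_m⁺ ⊥ B₁^{φ₁} ⊥ ⋯ ⊥ B_n^{φ_n}` with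
`A_i ∈ ind₁`, `B_j ∈ ind₀`, and `B_j ≠ B_{j'}` for `j ≠ j'`. -/
structure SumData (ind₀ : Set (SelfRep K C)) (ind₁ : Set (LRep K C)) where
  m : ℕ
  n : ℕ
  A : Fin m → ind₁
  B : Fin n → ind₀
  B_injective : Function.Injective B
  φ : ∀ j, HermForm (B j).1

namespace SumData

variable {ind₀ : Set (SelfRep K C)} {ind₁ : Set (LRep K C)}

/-- The orthogonal sum `A₁⁺ ⊥ ⋯ ⊥ A_m⁺ ⊥ B₁^{φ₁} ⊥ ⋯ ⊥ B_n^{φ_n}`. -/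
noncomputable def toSelfRep (S : HalfObjects C) (F : ∀ B : ind₀, B.1.HermUnit → SelfAut B.1)
    (D : SumData ind₀ ind₁) : SelfRep K C :=
  SelfRep.orthSum (Sum.elim (fun i : Fin D.m => (D.A i).1.plus)
    (fun j : Fin D.n => (D.φ j).toSelfRep S (F (D.B j))))

/-- Two sums agree up to permutation of summands and replacement of the forms `φ_j` by equivalent
Hermitian forms over `T(B_j)`. -/
def Equivalent (D D' : SumData ind₀ ind₁) : Prop :=
  (∃ σ : Fin D.m ≃ Fin D'.m, ∀ i, D.A i = D'.A (σ i)) ∧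
  ∃ τ : Fin D.n ≃ Fin D'.n, ∀ j, ∃ h : D.B j = D'.B (τ j),
    HermForm.Equivalent (h ▸ D.φ j : HermForm (D'.B (τ j)).1) (D'.φ (τ j))

end SumData

end Adjoint

end CatInv

open CatInv

/-! Take all morphisms of the underlying representations as morphisms between selfadjoint ones. With
`f ↦ f°` this is a preadditive category with an involution that fixes objects (`Dagger`).
Congruences are its unitary morphisms, and orthogonal summands of `M` are morphisms `w` into `M`
with `w ≫ w° = 1`. The classification becomes linear algebra modulo the radical.

Two facts make this work. By Fitting's lemma the endomorphism rings of indecomposables are local,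
and radical endomorphisms of any representation are nilpotent (`isNilpotent_of_isRad`). Since 2 is
invertible, `1 + n` with `n = n°` nilpotent has a selfadjoint square root (`exists_sqrt_one_add`).
Hence a morphism `W` with `W ≫ W°` equal to 1 modulo the radical can be corrected to an isometry, so
equations need only be solved in `T(B)`.

Existence: let `X` be an indecomposable direct summand of `M`. Either a certain endomorphism of `X`
that factors through the restricted form `X ⟶ X°` is invertible, and then the form is nondegenerate
on `X`, which splits off orthogonally; or that endomorphism is radical, and then `X⁺` embeds
isometrically after correction. If moreover `X` is isomorphic to a selfadjoint `B`, then `B` embeds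
isometrically in `X⁺`. So an indecomposable selfadjoint summand or a hyperbolic one with `X` not
selfadjoint always splits off (`SelfRep.exists_isometry`). A selfadjoint representation isomorphic
to `B` is congruent to some `B^a` (`exists_unitary_twist`), because the canonical isomorphism `t :
B^f ⟶ B` satisfies `t° ≫ t = f`. Induction on total dimension finishes the argument.

Uniqueness: an isomorphism between two sums induces, for each indecomposable `B`, an invertible
matrix over the residue skew field of `End B` (`IsIsotypic.matrix_mul`). Its size gives the
multiplicities of the `A_i⁺` and the set of `B_j`. If the isomorphism is unitary, the matrix for
`B_j` carries one Hermitian form to the other (`IsFrame.equivalent`). Conversely, an equivalence of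
forms lifts to a morphism that is unitary modulo the radical, and this can be corrected
(`IsFrame.exists_unitary`). -/

namespace CatInv

universe k v u

/-! ### The radical of a preadditive category -/

section Radical

variable {𝒜 : Type*} [Category 𝒜] [Preadditive 𝒜]

/-- The radical of a preadditive category. -/
def IsRad {X Y : 𝒜} (f : X ⟶ Y) : Prop := ∀ g : Y ⟶ X, IsIso (𝟙 X - f ≫ g)

/-- Jacobson's identity: if `v` inverts `1 - fg`, then `1 + g v f` inverts `1 - gf`, as the
geometric series suggests. It makes the radical a two-sided ideal although its definition is
one-sided. -/
theorem isIso_one_sub_swap {X Y : 𝒜} (f : X ⟶ Y) (g : Y ⟶ X) (h : IsIso (𝟙 X - f ≫ g)) :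
    IsIso (𝟙 Y - g ≫ f) := by
  have h1 := IsIso.hom_inv_id (𝟙 X - f ≫ g)
  have h2 := IsIso.inv_hom_id (𝟙 X - f ≫ g)
  set v := inv (𝟙 X - f ≫ g)
  have h1' : f ≫ g ≫ v = v - 𝟙 X := by
    rw [← h1]; simp
  have h2' : v ≫ f ≫ g = v - 𝟙 X := by
    rw [← h2]; simp
  refine ⟨𝟙 Y + g ≫ v ≫ f, ?_, ?_⟩
  · have : g ≫ (f ≫ g ≫ v) ≫ f = g ≫ v ≫ f - g ≫ f := by rw [h1']; simp
    simp only [Preadditive.sub_comp, Preadditive.comp_add, Category.id_comp, Category.comp_id,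
      Category.assoc] at this ⊢
    rw [this]; abel
  · have : g ≫ (v ≫ f ≫ g) ≫ f = g ≫ v ≫ f - g ≫ f := by rw [h2']; simp
    simp only [Preadditive.comp_sub, Preadditive.add_comp, Category.id_comp, Category.comp_id,
      Category.assoc] at this ⊢
    rw [this]; abel

namespace IsRad

variable {X Y Z : 𝒜}

theorem zero : IsRad (0 : X ⟶ Y) := fun g => by
  simp only [Limits.zero_comp, sub_zero]; infer_instance

theorem add {f f' : X ⟶ Y} (hf : IsRad f) (hf' : IsRad f') : IsRad (f + f') := fun g => by
  have := hf g
  -- With `u` the inverse of `1 - fg`, one has `1 - (f + f')g = (1 - f' g u)(1 - fg)`.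
  have := hf' (g ≫ inv (𝟙 X - f ≫ g))
  have e : 𝟙 X - (f + f') ≫ g =
      (𝟙 X - f' ≫ g ≫ inv (𝟙 X - f ≫ g)) ≫ (𝟙 X - f ≫ g) := by
    rw [Preadditive.sub_comp, Category.assoc, Category.assoc, IsIso.inv_hom_id]
    simp only [Preadditive.add_comp, Category.id_comp, Category.comp_id]
    abel
  rw [e]; infer_instance

theorem comp_right {f : X ⟶ Y} (hf : IsRad f) (h : Y ⟶ Z) : IsRad (f ≫ h) := fun g => by
  rw [Category.assoc]; exact hf _

theorem comp_left {f : Y ⟶ Z} (h : X ⟶ Y) (hf : IsRad f) : IsRad (h ≫ f) := fun g => by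
  rw [Category.assoc]
  exact isIso_one_sub_swap _ _ (by rw [Category.assoc]; exact hf _)

theorem sum {ι : Type*} {s : Finset ι} {f : ι → (X ⟶ Y)} (h : ∀ i ∈ s, IsRad (f i)) :
    IsRad (∑ i ∈ s, f i) := by
  classical
  induction s using Finset.induction_on with
  | empty => simpa using zero
  | insert a s ha ih =>
    rw [Finset.sum_insert ha]
    exact (h a (by simp)).add (ih fun i hi => h i (by simp [hi]))

end IsRad

end Radical

/-! ### Selfadjoint square roots of unipotent elements -/

section Sqrt

variable {R : Type*} [Ring R] [StarRing R]

theorem star_units_inv_eq {s : Rˣ} (hs : star (s : R) = s) :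
    star ((s⁻¹ : Rˣ) : R) = ((s⁻¹ : Rˣ) : R) := by
  refine Units.eq_inv_of_mul_eq_one_right ?_
  conv_lhs => rw [← hs, ← star_mul]
  simp

/-- Newton's iteration with `b = 1/2`. For `t = 1 + n/2` one has `t² = (1 + n) + n²/4`, so `1 + n =
t² (1 + n')` with `n' = -t⁻² n²/4`, whose nilpotency exponent is half as large. The root of `1 + n'`
commutes with whatever commutes with `n`, in particular with `t`; carrying this through the
induction makes the product of roots a root and keeps it selfadjoint. -/
theorem exists_sqrt_aux {b : R} (hb : 2 * b = 1) (hc : ∀ z : R, Commute b z) (k : ℕ) :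
    ∀ n : R, n ^ 2 ^ k = 0 → ∃ s : R, s * s = 1 + n ∧ (∀ z, Commute n z → Commute s z) ∧
      (star n = n → star s = s) := by
  have hsb : star b = b := by
    have h := congrArg star hb
    rw [star_mul, star_one, star_ofNat] at h
    calc star b = star b * (2 * b) := by rw [hb, mul_one]
      _ = (star b * 2) * b := by rw [mul_assoc]
      _ = b := by rw [h, one_mul]
  induction k with
  | zero =>
    intro n hn
    have : n = 0 := by simpa using hn
    subst this
    exact ⟨1, by simp, fun z _ => Commute.one_left z, fun _ => star_one R⟩
  | succ k ih =>
    intro n hn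
    have hnil : IsNilpotent (b * n) := by
      refine ⟨2 ^ (k + 1), ?_⟩
      rw [(hc n).mul_pow, hn, mul_zero]
    obtain ⟨t, ht⟩ := hnil.isUnit_one_add
    have htc : ∀ z, Commute n z → Commute (t : R) z := fun z hz => by
      rw [ht]; exact (Commute.one_left z).add_left ((hc z).mul_left hz)
    have htic : ∀ z, Commute n z → Commute ((t⁻¹ : Rˣ) : R) z := fun z hz =>
      (htc z hz).units_inv_left
    have hnt : Commute n (t : R) := (htc n (Commute.refl n)).symm
    have hnti : Commute n ((t⁻¹ : Rˣ) : R) := (htic n (Commute.refl n)).symm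
    set n' : R := -(b * b * (((t⁻¹ : Rˣ) : R) * ((t⁻¹ : Rˣ) : R)) * n ^ 2) with hn'
    have hn'c : ∀ z, Commute n z → Commute n' z := fun z hz =>
      (((((hc z).mul_left (hc z)).mul_left ((htic z hz).mul_left (htic z hz))).mul_left
        (hz.pow_left 2))).neg_left
    have hpow : n' ^ 2 ^ k = 0 := by
      rw [hn', neg_pow, Commute.mul_pow, ← pow_mul, ← pow_succ', hn]
      · simp
      · exact (((hc _).mul_left (hc _)).mul_left
          (((hnti.pow_left 2).symm).mul_left ((hnti.pow_left 2).symm)))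
    obtain ⟨s, hs, hsc, hss⟩ := ih n' hpow
    have hst : Commute s (t : R) := hsc _ (hn'c _ hnt)
    refine ⟨t * s, ?_, fun z hz => (htc z hz).mul_left (hsc z (hn'c z hz)), fun hsn => ?_⟩
    · have e1 : (t : R) * s * (t * s) = t * t * (s * s) := by
        rw [mul_assoc, ← mul_assoc s, hst.eq]; simp only [mul_assoc]
      rw [e1, hs, mul_add, mul_one]
      have e2 : (t : R) * t * n' = -(b * b * n ^ 2) := by
        rw [hn', mul_neg]
        congr 1
        have hbb : Commute (b * b) ((t : R) * t) := (hc _).mul_left (hc _)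
        rw [← mul_assoc, ← mul_assoc, ← hbb.eq, mul_assoc (b * b)]
        congr 1
        rw [mul_assoc (t : R), ← mul_assoc (t : R) ((t⁻¹ : Rˣ) : R)]
        simp
      rw [e2, ht]
      have e3 : b * n * (b * n) = b * b * n ^ 2 := by
        rw [mul_assoc, ← mul_assoc n, ← (hc n).eq, pow_two]; simp only [mul_assoc]
      have e4 : b * n + b * n = n := by
        rw [← two_mul, ← mul_assoc, hb, one_mul]
      calc (1 + b * n) * (1 + b * n) + -(b * b * n ^ 2)
          = 1 + (b * n + b * n) + (b * n * (b * n) + -(b * b * n ^ 2)) := by noncomm_ring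
        _ = 1 + n := by rw [e3, e4]; simp
    · have hstar : star (t : R) = t := by
        rw [ht, star_add, star_one, star_mul, hsn, hsb, (hc n).eq]
      have hstari := star_units_inv_eq hstar
      have hn's : star n' = n' := by
        have h1 : Commute (b * b) (((t⁻¹ : Rˣ) : R) * ((t⁻¹ : Rˣ) : R)) := (hc _).mul_left (hc _)
        have h2 : Commute (n ^ 2)
            (b * b * (((t⁻¹ : Rˣ) : R) * ((t⁻¹ : Rˣ) : R))) :=
          ((((hc _).mul_left (hc _)).mul_left
            (((hnti.pow_left 2).symm).mul_left ((hnti.pow_left 2).symm)))).symm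
        rw [hn', star_neg, star_mul, star_mul, star_mul, star_mul, star_pow, hsn, hsb, hstari,
          ← h1.eq, h2.eq]
      rw [star_mul, hss hn's, hstar, hst.eq]

/-- Square roots of unipotent selfadjoint elements. -/
theorem exists_sqrt_one_add (h2 : IsUnit (2 : R)) {n : R} (hn : IsNilpotent n)
    (hs : star n = n) : ∃ s : Rˣ, (s : R) * s = 1 + n ∧ star (s : R) = s := by
  obtain ⟨u, hu⟩ := h2
  have hb : (2 : R) * ((u⁻¹ : Rˣ) : R) = 1 := by rw [← hu]; simp
  have hc : ∀ z : R, Commute ((u⁻¹ : Rˣ) : R) z := fun z =>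
    Commute.units_inv_left (by rw [hu]; exact Nat.cast_commute 2 z)
  obtain ⟨k, hk⟩ := hn
  -- The iteration halves the exponent, so the exponent is enlarged to a power of two.
  have hk' : n ^ 2 ^ k = 0 := pow_eq_zero_of_le (Nat.lt_two_pow_self).le hk
  obtain ⟨s, h1, h3, h4⟩ := exists_sqrt_aux hb hc k n hk'
  have hu1 : IsUnit (s * s) := by rw [h1]; exact (IsNilpotent.isUnit_one_add ⟨k, hk⟩)
  have hu2 : IsUnit s := by
    obtain ⟨v, hv⟩ := hu1
    refine ⟨⟨s, s * ((v⁻¹ : Rˣ) : R), ?_, ?_⟩, rfl⟩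
    · rw [← mul_assoc, ← hv]; simp
    · have hcs : Commute s (v : R) := by rw [hv]; exact (Commute.refl s).mul_right (Commute.refl s)
      rw [hcs.units_inv_right.eq, mul_assoc, ← hv]; simp
  obtain ⟨s, rfl⟩ := hu2
  exact ⟨s, h1, h4 hs⟩

end Sqrt

/-! ### Categories with involution: unitary morphisms and orthogonal decompositions -/

section Dagger

/-- A preadditive category with an additive involution that is the identity on objects. -/
class Dagger (𝒟 : Type*) [Category 𝒟] [Preadditive 𝒟] where
  dag : ∀ {X Y : 𝒟}, (X ⟶ Y) → (Y ⟶ X)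
  dag_dag : ∀ {X Y : 𝒟} (f : X ⟶ Y), dag (dag f) = f
  dag_comp : ∀ {X Y Z : 𝒟} (f : X ⟶ Y) (g : Y ⟶ Z), dag (f ≫ g) = dag g ≫ dag f
  dag_add : ∀ {X Y : 𝒟} (f g : X ⟶ Y), dag (f + g) = dag f + dag g

open CatInv.Dagger (dag)

attribute [simp] Dagger.dag_dag Dagger.dag_comp Dagger.dag_add

variable {𝒟 : Type*} [Category 𝒟] [Preadditive 𝒟] [Dagger 𝒟]

/-- The involution as a homomorphism of groups. -/
def dagHom (X Y : 𝒟) : (X ⟶ Y) →+ (Y ⟶ X) := AddMonoidHom.mk' dag Dagger.dag_add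

@[simp] theorem dag_zero {X Y : 𝒟} : dag (0 : X ⟶ Y) = 0 := map_zero (dagHom X Y)

@[simp] theorem dag_sub {X Y : 𝒟} (f g : X ⟶ Y) : dag (f - g) = dag f - dag g :=
  map_sub (dagHom X Y) f g

theorem dag_sum {X Y : 𝒟} {ι : Type*} (s : Finset ι) (f : ι → (X ⟶ Y)) :
    dag (∑ i ∈ s, f i) = ∑ i ∈ s, dag (f i) := map_sum (dagHom X Y) f s

@[simp] theorem dag_id (X : 𝒟) : dag (𝟙 X) = 𝟙 X := by
  have h := Dagger.dag_comp (dag (𝟙 X)) (𝟙 X)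
  rw [Category.comp_id, Dagger.dag_dag, Category.comp_id] at h
  exact h.symm

instance (X : 𝒟) : StarRing (End X) where
  star f := dag f
  star_involutive f := Dagger.dag_dag f
  star_mul f g := Dagger.dag_comp g f
  star_add f g := Dagger.dag_add f g

/-- Unitary morphisms. -/
structure IsUnitary {M N : 𝒟} (f : M ⟶ N) : Prop where
  comp_dag : f ≫ dag f = 𝟙 M
  dag_comp : dag f ≫ f = 𝟙 N

namespace IsUnitary

variable {M N L : 𝒟}

theorem refl (M : 𝒟) : IsUnitary (𝟙 M) := ⟨by simp, by simp⟩

theorem symm {f : M ⟶ N} (hf : IsUnitary f) : IsUnitary (dag f) :=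
  ⟨by simpa using hf.2, by simpa using hf.1⟩

theorem comp {f : M ⟶ N} {g : N ⟶ L} (hf : IsUnitary f) (hg : IsUnitary g) :
    IsUnitary (f ≫ g) := by
  constructor
  · rw [Dagger.dag_comp, Category.assoc, ← Category.assoc g, hg.1, Category.id_comp, hf.1]
  · rw [Dagger.dag_comp, Category.assoc, ← Category.assoc (dag f), hf.2, Category.id_comp, hg.2]

theorem of_isIso {f : M ⟶ N} [IsIso f] (h : f ≫ dag f = 𝟙 M) : IsUnitary f := by
  refine ⟨h, ?_⟩
  have : dag f = inv f := by rw [← cancel_epi f, h, IsIso.hom_inv_id]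
  rw [this, IsIso.inv_hom_id]

end IsUnitary

/-- A morphism that is isometric up to a nilpotent error can be corrected. -/
theorem exists_isometry {M N : 𝒟} (h2 : IsUnit (2 : End M)) (W : M ⟶ N)
    (hW : IsNilpotent (End.of (W ≫ dag W - 𝟙 M))) :
    ∃ s : M ≅ M, (s.hom ≫ W) ≫ dag (s.hom ≫ W) = 𝟙 M := by
  -- If `s² = W W°` with `s = s°`, then `s⁻¹ W` is an isometry: `s⁻¹ (W W°) s⁻¹ = 1`.
  obtain ⟨s, hs, hss⟩ := exists_sqrt_one_add h2 hW
    (show dag (W ≫ dag W - 𝟙 M) = W ≫ dag W - 𝟙 M by simp)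
  have h1 : (s : End M) * s = End.of (W ≫ dag W) := hs.trans (add_sub_cancel (𝟙 M) (W ≫ dag W))
  have hsi : dag ((s⁻¹ : (End M)ˣ) : End M) = ((s⁻¹ : (End M)ˣ) : End M) := star_units_inv_eq hss
  refine ⟨⟨((s⁻¹ : (End M)ˣ) : End M), (s : End M), s.mul_inv, s.inv_mul⟩, ?_⟩
  change (((s⁻¹ : (End M)ˣ) : End M) ≫ W) ≫ dag (((s⁻¹ : (End M)ˣ) : End M) ≫ W) = 𝟙 M
  rw [Dagger.dag_comp, hsi, Category.assoc, ← Category.assoc W]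
  change ((s⁻¹ : (End M)ˣ) : End M) * End.of (W ≫ dag W) * ((s⁻¹ : (End M)ˣ) : End M) = 1
  rw [← h1, ← mul_assoc, Units.inv_mul, one_mul, Units.mul_inv]

theorem exists_unitary {M N : 𝒟} (h2 : IsUnit (2 : End M)) (W : M ⟶ N) [IsIso W]
    (hW : IsNilpotent (End.of (W ≫ dag W - 𝟙 M))) : ∃ f : M ⟶ N, IsUnitary f := by
  obtain ⟨s, hs⟩ := exists_isometry h2 W hW
  exact ⟨s.hom ≫ W, IsUnitary.of_isIso hs⟩

/-- The morphisms `w i` present `M` as an orthogonal sum of the `N i`. -/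
structure IsOrthDecomp {ι : Type*} [Fintype ι] {M : 𝒟} {N : ι → 𝒟} (w : ∀ i, N i ⟶ M) :
    Prop where
  comp_dag : ∀ i, w i ≫ dag (w i) = 𝟙 (N i)
  comp_dag_ne : ∀ i j, i ≠ j → w i ≫ dag (w j) = 0
  sum_dag : ∑ i, dag (w i) ≫ w i = 𝟙 M

namespace IsOrthDecomp

variable {ι κ : Type*} [Fintype ι] [Fintype κ] {M M' : 𝒟} {N : ι → 𝒟} {w : ∀ i, N i ⟶ M}

theorem reindex (hw : IsOrthDecomp w) (e : κ ≃ ι) : IsOrthDecomp fun k => w (e k) where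
  comp_dag _ := hw.1 _
  comp_dag_ne _ _ h := hw.2 _ _ (e.injective.ne h)
  sum_dag := (e.sum_comp fun i => dag (w i) ≫ w i).trans hw.3

theorem unitary_comp (hw : IsOrthDecomp w) {L : ι → 𝒟} {g : ∀ i, L i ⟶ N i}
    (hg : ∀ i, IsUnitary (g i)) : IsOrthDecomp fun i => g i ≫ w i where
  comp_dag i := by
    rw [Dagger.dag_comp, Category.assoc, ← Category.assoc (w _), hw.1, Category.id_comp,
      (hg i).1]
  comp_dag_ne i j h := by
    rw [Dagger.dag_comp, Category.assoc, ← Category.assoc (w _), hw.2 i j h]; simp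
  sum_dag := by
    rw [← hw.3]
    refine Finset.sum_congr rfl fun i _ => ?_
    rw [Dagger.dag_comp, Category.assoc, ← Category.assoc (dag (g i)), (hg i).2, Category.id_comp]

theorem exists_unitary {w' : ∀ i, N i ⟶ M'} (hw : IsOrthDecomp w) (hw' : IsOrthDecomp w') :
    ∃ f : M ⟶ M', IsUnitary f := by
  classical
  have key : ∀ {M M' : 𝒟} {w : ∀ i, N i ⟶ M} {w' : ∀ i, N i ⟶ M'}, IsOrthDecomp w →
      IsOrthDecomp w' →
      (∑ i, dag (w i) ≫ w' i) ≫ (∑ i, dag (w' i) ≫ w i) = 𝟙 M := by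
    intro M M' w w' hw hw'
    rw [← hw.3, Preadditive.sum_comp]
    refine Finset.sum_congr rfl fun i _ => ?_
    rw [Category.assoc, Preadditive.comp_sum, Finset.sum_eq_single i]
    · rw [← Category.assoc (w' i), hw'.1, Category.id_comp]
    · intro j _ hj
      rw [← Category.assoc, hw'.2 i j hj.symm, Limits.zero_comp]
    · simp
  have hd : dag (∑ i, dag (w i) ≫ w' i) = ∑ i, dag (w' i) ≫ w i := by simp [dag_sum]
  exact ⟨∑ i, dag (w i) ≫ w' i, by rw [hd]; exact key hw hw', by rw [hd]; exact key hw' hw⟩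

/-- Adding an orthogonal summand. -/
theorem option {N : Option ι → 𝒟} {w : ∀ o, N o ⟶ M} {u : M' ⟶ M}
    {v : ∀ i, N (some i) ⟶ M'} (hv : IsOrthDecomp v) (h0 : w none ≫ dag (w none) = 𝟙 _)
    (hu : u ≫ dag u = 𝟙 _) (hsum : dag (w none) ≫ w none + dag u ≫ u = 𝟙 M)
    (hw : ∀ i, w (some i) = v i ≫ u) : IsOrthDecomp w := by
  -- Orthogonality is automatic. Sandwiching the sum identity between `w` and `u°` produces `w u° +
  -- w u° = w u°`.
  have h1 : w none ≫ dag u = 0 := by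
    have h := congrArg (fun z => w none ≫ z ≫ dag u) hsum
    simp only [Preadditive.add_comp, Preadditive.comp_add, Category.id_comp, Category.assoc,
      hu, Category.comp_id] at h
    rw [← Category.assoc, h0, Category.id_comp] at h
    simpa using h
  have h2 : u ≫ dag (w none) = 0 := by
    have := congrArg dag h1
    simpa using this
  refine ⟨?_, ?_, ?_⟩
  · rintro (_ | i)
    · exact h0
    · rw [hw, Dagger.dag_comp, Category.assoc, ← Category.assoc u, hu, Category.id_comp, hv.1]
  · rintro (_ | i) (_ | j) h
    · exact absurd rfl h
    · rw [hw, Dagger.dag_comp, ← Category.assoc, h1, Limits.zero_comp]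
    · rw [hw, Category.assoc, h2, Limits.comp_zero]
    · rw [hw, hw, Dagger.dag_comp, Category.assoc, ← Category.assoc u, hu, Category.id_comp,
        hv.2 i j (fun h' => h (by rw [h']))]
  · rw [Fintype.sum_option, ← hsum]
    congr 1
    simp only [hw, Dagger.dag_comp, Category.assoc]
    simp only [← Category.assoc (dag (v _)), ← Preadditive.comp_sum, ← Preadditive.sum_comp,
      hv.3, Category.id_comp]

end IsOrthDecomp

end Dagger

/-! ### Direct sums and idempotents of representations -/

namespace LRep

variable {K : Type k} [DivisionRing K] {C : Type u} [Category.{v} C] [Preadditive C]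
  [Linear (Subring.center K) C]

@[simp] theorem zero_app {A B : LRep K C} (x : C) (a : A.obj x) : app (0 : A ⟶ B) x a = 0 := rfl

@[simp] theorem sub_app {A B : LRep K C} (f g : A ⟶ B) (x : C) (a : A.obj x) :
    app (f - g) x a = app f x a - app g x a := rfl

/-- The morphism with given components. -/
def mkHom {A B : LRep K C} (f : ∀ x, A.obj x →ₗ[Kᵐᵒᵖ] B.obj x)
    (h : ∀ {x y : C} (α : x ⟶ y) (a : A.obj x), f y (A.map α a) = B.map α (f x a)) : A ⟶ B :=
  (⟨f, fun α => LinearMap.ext (h α)⟩ : LRep.Hom A B)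

@[simp] theorem mkHom_app {A B : LRep K C} (f : ∀ x, A.obj x →ₗ[Kᵐᵒᵖ] B.obj x)
    (h : ∀ {x y : C} (α : x ⟶ y) (a : A.obj x), f y (A.map α a) = B.map α (f x a)) (x : C) :
    app (mkHom f h) x = f x := rfl

section Sum

variable (A B : LRep K C)

/-- The first inclusion into a direct sum. -/
def inl : A ⟶ A.sum B := mkHom (fun _ => LinearMap.inl _ _ _) fun α _ =>
  Prod.ext rfl (map_zero (B.map α)).symm

/-- The second inclusion into a direct sum. -/
def inr : B ⟶ A.sum B := mkHom (fun _ => LinearMap.inr _ _ _) fun α _ =>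
  Prod.ext (map_zero (A.map α)).symm rfl

/-- The first projection of a direct sum. -/
def fst : A.sum B ⟶ A := mkHom (fun _ => LinearMap.fst _ _ _) fun _ _ => rfl

/-- The second projection of a direct sum. -/
def snd : A.sum B ⟶ B := mkHom (fun _ => LinearMap.snd _ _ _) fun _ _ => rfl

@[simp] theorem inl_fst : inl A B ≫ fst A B = 𝟙 A := rfl
@[simp] theorem inr_snd : inr A B ≫ snd A B = 𝟙 B := rfl
@[simp] theorem inl_snd : inl A B ≫ snd A B = 0 := rfl
@[simp] theorem inr_fst : inr A B ≫ fst A B = 0 := rfl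

theorem sum_total : fst A B ≫ inl A B + snd A B ≫ inr A B = 𝟙 (A.sum B) := by
  ext x a : 3
  exact Prod.ext (add_zero _) (zero_add _)

end Sum

/-- A representation is the direct sum of two complementary retracts. -/
theorem nonempty_iso_sum {A X Y : LRep K C} {i : X ⟶ A} {p : A ⟶ X} {j : Y ⟶ A} {q : A ⟶ Y}
    (hi : i ≫ p = 𝟙 X) (hj : j ≫ q = 𝟙 Y) (h : p ≫ i + q ≫ j = 𝟙 A) :
    Nonempty (A ≅ X.sum Y) := by
  -- Sandwiching `pi + qj = 1` between `i` and `q` gives `iq + iq = iq`.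
  have h1 : i ≫ q = 0 := by
    have h' := congrArg (fun z => i ≫ z ≫ q) h
    simp only [Preadditive.add_comp, Preadditive.comp_add, Category.id_comp, Category.assoc,
      hj, Category.comp_id] at h'
    rw [← Category.assoc, hi, Category.id_comp] at h'
    simpa using h'
  have h2 : j ≫ p = 0 := by
    have h' := congrArg (fun z => j ≫ z ≫ p) h
    simp only [Preadditive.add_comp, Preadditive.comp_add, Category.id_comp, Category.assoc,
      hi, Category.comp_id] at h'
    rw [← Category.assoc j q, hj, Category.id_comp] at h'
    simpa using h'
  refine ⟨⟨p ≫ inl X Y + q ≫ inr X Y, fst X Y ≫ i + snd X Y ≫ j, ?_, ?_⟩⟩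
  · rw [← h]
    simp only [Preadditive.add_comp, Preadditive.comp_add, Category.assoc]
    simp only [← Category.assoc (inl X Y), ← Category.assoc (inr X Y), inl_fst, inl_snd, inr_fst,
      inr_snd]
    simp
  · rw [← sum_total X Y]
    simp only [Preadditive.add_comp, Preadditive.comp_add, Category.assoc]
    simp only [← Category.assoc i, ← Category.assoc j, hi, hj, h1, h2]
    simp

theorem isZero_iff {A : LRep K C} : A.IsZero ↔ 𝟙 A = 0 := by
  constructor
  · intro h
    ext x a
    have := h x
    exact Subsingleton.elim _ _
  · intro h x
    refine ⟨fun a b => ?_⟩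
    have := fun a : A.obj x => congrArg (fun f => app f x a) h
    simp only [id_app, zero_app] at this
    rw [this a, this b]

section Image

variable {A : LRep K C} (e : A ⟶ A)

/-- The image of an endomorphism of a representation. -/
def image : LRep K C where
  obj x := LinearMap.range (app e x)
  finite_support := A.finite_support.subset fun x hx => by
    have : Nontrivial (LinearMap.range (app e x)) := hx
    exact (Submodule.subtype_injective (LinearMap.range (app e x))).nontrivial
  map {x y} α := (A.map α).restrict (p := LinearMap.range (app e x))
    (q := LinearMap.range (app e y)) (by
      rintro _ ⟨a, rfl⟩
      exact ⟨A.map α a, app_naturality e α a⟩)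
  map_id x := by ext a; simp
  map_comp α β := by ext a; simp
  map_add α β := by ext a; simp [A.map_add]
  map_smul c α a := by
    apply Subtype.ext
    exact A.map_smul c α a

/-- The inclusion of the image. -/
def imageι : image e ⟶ A := mkHom (fun x => (LinearMap.range (app e x)).subtype) fun _ _ => rfl

/-- The projection onto the image. -/
def imageπ : A ⟶ image e := mkHom (fun x => (app e x).rangeRestrict) fun α a =>
  Subtype.ext (app_naturality e α a)

theorem imageπ_ι : imageπ e ≫ imageι e = e := rfl

theorem imageι_π (he : e ≫ e = e) : imageι e ≫ imageπ e = 𝟙 (image e) := by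
  ext x a
  obtain ⟨_, a, rfl⟩ := a
  exact Subtype.ext (congrArg (fun f => app f x a) he)

end Image

theorem one_sub_idem {A : LRep K C} {e : A ⟶ A} (he : e ≫ e = e) :
    (𝟙 A - e) ≫ (𝟙 A - e) = 𝟙 A - e := by
  simp [Preadditive.sub_comp, Preadditive.comp_sub, he]

/-- Idempotents split: the images of `e` and `1 - e` are complementary direct summands, so one of
them vanishes. -/
theorem Indecomposable.idem {A : LRep K C} (hA : A.Indecomposable) {e : A ⟶ A}
    (he : e ≫ e = e) : e = 0 ∨ e = 𝟙 A := by
  have h := nonempty_iso_sum (imageι_π e he) (imageι_π _ (one_sub_idem he))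
    (by rw [imageπ_ι, imageπ_ι]; abel)
  rcases hA.2 _ _ h with h | h
  · left
    rw [← imageπ_ι e, ← Category.id_comp (imageι e), isZero_iff.1 h]
    simp
  · right
    have h' : 𝟙 A - e = 0 := by
      rw [← imageπ_ι (𝟙 A - e), ← Category.id_comp (imageι (𝟙 A - e)), isZero_iff.1 h]
      simp
    exact (sub_eq_zero.1 h').symm

theorem indecomposable_of_idem {A : LRep K C} (h0 : ¬ A.IsZero)
    (h : ∀ e : A ⟶ A, e ≫ e = e → e = 0 ∨ e = 𝟙 A) : A.Indecomposable := by
  refine ⟨h0, fun X Y ⟨s⟩ => ?_⟩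
  have hX : inl X Y ≫ s.inv ≫ s.hom ≫ fst X Y = 𝟙 X := by simp
  have hY : inr X Y ≫ s.inv ≫ s.hom ≫ snd X Y = 𝟙 Y := by simp
  rcases h (s.hom ≫ fst X Y ≫ inl X Y ≫ s.inv) (by
    simp only [Category.assoc, s.inv_hom_id_assoc]
    rw [← Category.assoc (inl X Y) (fst X Y), inl_fst, Category.id_comp]) with h | h
  · left
    rw [isZero_iff]
    have h' := congrArg (fun z => (inl X Y ≫ s.inv) ≫ z ≫ s.hom ≫ fst X Y) h
    simp only [Category.assoc, s.inv_hom_id_assoc, Limits.zero_comp, Limits.comp_zero] at h'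
    simpa only [← Category.assoc (inl X Y) (fst X Y), inl_fst, Category.id_comp] using h'
  · right
    rw [isZero_iff]
    have h' := congrArg (fun z => (inr X Y ≫ s.inv) ≫ z ≫ s.hom ≫ snd X Y) h
    simp only [Category.assoc, s.inv_hom_id_assoc, Category.id_comp] at h'
    rw [← Category.assoc (inr X Y) (fst X Y), inr_fst, inr_snd] at h'
    simpa using h'.symm

theorem Indecomposable.of_iso {A B : LRep K C} (hA : A.Indecomposable) (s : A ≅ B) :
    B.Indecomposable := by
  refine ⟨fun h => hA.1 ?_, fun X Y ⟨t⟩ => hA.2 X Y ⟨s ≪≫ t⟩⟩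
  rw [isZero_iff] at h ⊢
  rw [← s.hom_inv_id, ← Category.id_comp s.inv, h]
  simp

/-! ### Fitting's lemma and local endomorphism rings -/

section Fitting

variable {A : LRep K C}

theorem app_pow (f : End A) (n : ℕ) (x : C) :
    app (show A ⟶ A from f ^ n) x = (show Module.End Kᵐᵒᵖ (A.obj x) from app f x) ^ n := by
  induction n with
  | zero => rfl
  | succ n ih => rw [pow_succ, pow_succ, ← ih]; rfl

/-- Here `e` projects onto the range of `g` along its kernel. It is natural because morphisms
commute with the structure maps, which therefore preserve ranges and kernels. -/
theorem exists_idem_of_isCompl (g : A ⟶ A)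
    (hg : ∀ x, IsCompl (LinearMap.ker (app g x)) (LinearMap.range (app g x))) :
    ∃ e : A ⟶ A, e ≫ e = e ∧ ∃ s : A ≅ A, g = e ≫ s.hom := by
  let p : ∀ x, A.obj x →ₗ[Kᵐᵒᵖ] A.obj x := fun x =>
    (LinearMap.range (app g x)).projection _ (hg x).symm
  have hp : ∀ x a, p x a ∈ LinearMap.range (app g x) := fun x a =>
    Submodule.projection_apply_mem _ _
  have hpr : ∀ x a, a ∈ LinearMap.range (app g x) → p x a = a := fun x a ha =>
    Submodule.projection_apply_of_mem_left _ ha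
  have hpk : ∀ x a, app g x a = 0 → p x a = 0 := fun x a ha =>
    (Submodule.projection_apply_eq_zero_iff _).2 ha
  have hgp : ∀ x a, app g x (p x a) = app g x a := fun x a => by
    have h : p x (a - p x a) = 0 := by rw [map_sub, hpr x _ (hp x a), sub_self]
    have h' : app g x (a - p x a) = 0 := (Submodule.projection_apply_eq_zero_iff _).1 h
    rw [map_sub, sub_eq_zero] at h'
    exact h'.symm
  let e : A ⟶ A := mkHom p fun {x y} α a => by
    have h1 : p y (A.map α (p x a)) = A.map α (p x a) := by
      apply hpr
      obtain ⟨b, hb⟩ := hp x a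
      exact ⟨A.map α b, by rw [app_naturality, hb]⟩
    have h2 : p y (A.map α (a - p x a)) = 0 := by
      apply hpk
      rw [app_naturality, map_sub, hgp, sub_self, map_zero]
    rw [map_sub, map_sub, sub_eq_zero] at h2
    rw [h2, h1]
  -- On the range this automorphism is `g`, on the kernel it is the identity.
  refine ⟨e, ?_, isoOfBijective (g + (𝟙 A - e)) fun x => ?_, ?_⟩
  · ext x a
    exact hpr x _ (hp x a)
  · have inj : Function.Injective (app (g + (𝟙 A - e)) x) := by
      rw [← LinearMap.ker_eq_bot, LinearMap.ker_eq_bot']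
      intro a ha
      have ha' : app g x a + (a - p x a) = 0 := ha
      have h1 : app g x a = 0 := by
        have := congrArg (p x) ha'
        rw [_root_.map_add, map_sub, hpr x _ (hp x a), sub_self, add_zero, map_zero,
          hpr x _ ⟨a, rfl⟩] at this
        exact this
      rw [h1, zero_add, hpk x a h1, sub_zero] at ha'
      exact ha'
    exact ⟨inj, LinearMap.injective_iff_surjective.1 inj⟩
  · ext x a
    change app g x a = app g x (p x a) + (p x a - p x (p x a))
    rw [hgp, hpr x _ (hp x a), sub_self, add_zero]

/-- Fitting's lemma. -/
theorem exists_fitting (f : End A) : ∃ (n : ℕ) (e : A ⟶ A), 0 < n ∧ e ≫ e = e ∧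
    ∃ s : A ≅ A, f ^ n = e ≫ s.hom := by
  -- One exponent serves all objects at once because only finitely many spaces are nonzero.
  have h : ∀ᶠ n in Filter.atTop, ∀ x ∈ {x | Nontrivial (A.obj x)},
      IsCompl (LinearMap.ker ((show Module.End Kᵐᵒᵖ (A.obj x) from app f x) ^ n))
        (LinearMap.range ((show Module.End Kᵐᵒᵖ (A.obj x) from app f x) ^ n)) :=
    (Filter.eventually_all_finite A.finite_support).2 fun x _ =>
      LinearMap.eventually_isCompl_ker_pow_range_pow _
  obtain ⟨n, hn, hn0⟩ := (h.and (Filter.eventually_gt_atTop 0)).exists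
  suffices hc : ∀ x, IsCompl (LinearMap.ker (app (show A ⟶ A from f ^ n) x))
      (LinearMap.range (app (show A ⟶ A from f ^ n) x)) by
    obtain ⟨e, he⟩ := exists_idem_of_isCompl _ hc
    exact ⟨n, e, hn0, he⟩
  intro x
  rw [app_pow]
  by_cases hx : Nontrivial (A.obj x)
  · exact hn x hx
  · rw [not_nontrivial_iff_subsingleton] at hx
    have : Subsingleton (Submodule Kᵐᵒᵖ (A.obj x)) := inferInstance
    exact ⟨disjoint_iff.2 (Subsingleton.elim _ _), codisjoint_iff.2 (Subsingleton.elim _ _)⟩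

/-- Some power of `f` is `e ≫ s` with `e` idempotent and `s` invertible. Then `e` is radical, so `1
- e` is invertible, and `(1 - e)e = 0` forces `e = 0`. -/
theorem isNilpotent_of_isRad {f : A ⟶ A} (hf : IsRad f) : IsNilpotent (End.of f) := by
  obtain ⟨n, e, hn, he, s, hs⟩ := exists_fitting (End.of f)
  obtain ⟨n, rfl⟩ := Nat.exists_eq_succ_of_ne_zero hn.ne'
  refine ⟨n + 1, ?_⟩
  have h1 : IsRad (e ≫ s.hom) := by
    rw [← hs, pow_succ]
    exact hf.comp_right _
  have h2 : IsRad e := by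
    have := h1.comp_right s.inv
    rwa [Category.assoc, s.hom_inv_id, Category.comp_id] at this
  have h3 := h2 (𝟙 A)
  have h4 : e = 0 := by
    rw [← cancel_epi (𝟙 A - e ≫ 𝟙 A)]
    simp [Preadditive.sub_comp, he]
  rw [hs, h4, Limits.zero_comp]

theorem isIso_one_sub_of_isNilpotent {f : A ⟶ A} (hf : IsNilpotent (End.of f)) :
    IsIso (𝟙 A - f) :=
  (CategoryTheory.isUnit_iff_isIso _).1 hf.isUnit_one_sub

/-- The Fitting idempotent of `f` is 0 or 1. -/
theorem Indecomposable.isNilpotent_or_isIso (hA : A.Indecomposable) (f : A ⟶ A) :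
    IsNilpotent (End.of f) ∨ IsIso f := by
  obtain ⟨n, e, hn, he, s, hs⟩ := exists_fitting (End.of f)
  rcases hA.idem he with h | h
  · left
    refine ⟨n, ?_⟩
    rw [hs, h, Limits.zero_comp]
  · right
    have h1 : IsUnit (End.of f ^ n) := by
      rw [CategoryTheory.isUnit_iff_isIso, hs, h, Category.id_comp]
      infer_instance
    exact (CategoryTheory.isUnit_iff_isIso _).1 ((isUnit_pow_iff hn.ne').1 h1)

/-- The endomorphism `g (fg)⁻¹ f` of `Y` is idempotent, hence 0 or 1. It is not 0, since that would
force `f = 0`; so `g (fg)⁻¹` is a two-sided inverse of `f`. -/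
theorem Indecomposable.isIso_of_comp {X Y : LRep K C} (hX : X.Indecomposable)
    (hY : Y.Indecomposable) (f : X ⟶ Y) (g : Y ⟶ X) [IsIso (f ≫ g)] : IsIso f := by
  have h1 : f ≫ g ≫ inv (f ≫ g) = 𝟙 X := by
    rw [← Category.assoc, IsIso.hom_inv_id]
  rcases hY.idem (e := g ≫ inv (f ≫ g) ≫ f) (by
    simp only [Category.assoc]
    rw [← Category.assoc f, IsIso.hom_inv_id_assoc]) with h | h
  · exfalso
    apply hX.1
    have h2 : f = 0 := by
      rw [← Category.id_comp f, ← h1]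
      simpa using congrArg (fun z => f ≫ z) h
    rw [isZero_iff, ← h1, ← Category.assoc]
    simp only [h2, Limits.zero_comp]
  · exact ⟨g ≫ inv (f ≫ g), h1, by simpa using h⟩

/-- If `f ≫ g` were invertible, `f` would be too; so `f ≫ g` is nilpotent and `1 - fg` is
invertible. -/
theorem Indecomposable.isRad {X Y : LRep K C} (hX : X.Indecomposable)
    (hY : Y.Indecomposable) {f : X ⟶ Y} (hf : ¬ IsIso f) : IsRad f := fun g => by
  rcases hX.isNilpotent_or_isIso (f ≫ g) with h | h
  · exact isIso_one_sub_of_isNilpotent h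
  · exact absurd (hX.isIso_of_comp hY f g) hf

theorem Indecomposable.not_isIso_of_isRad {X Y : LRep K C} (hX : X.Indecomposable)
    {f : X ⟶ Y} (hf : IsRad f) : ¬ IsIso f := fun h => by
  have h1 := hf (inv f)
  rw [IsIso.hom_inv_id, sub_self] at h1
  apply hX.1
  rw [isZero_iff, ← cancel_epi (0 : X ⟶ X)]
  simp

/-- Links the categorical radical with the ring-theoretic one used to define `T(B)`. A proper ideal
contains no unit, and the non-isomorphisms are radical; conversely, radical elements are nilpotent
together with their multiples. -/
theorem Indecomposable.mem_jacobson_iff (hA : A.Indecomposable) (f : End A) :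
    f ∈ Ring.jacobson (End A) ↔ IsRad (show A ⟶ A from f) := by
  have hnt : Nontrivial (End A) := ⟨⟨1, 0, fun h => hA.1 (isZero_iff.2 h)⟩⟩
  constructor
  · intro h
    refine hA.isRad hA fun hi => ?_
    have hu : IsUnit f := (CategoryTheory.isUnit_iff_isIso _).2 hi
    have := Ideal.eq_top_of_isUnit_mem _ h hu
    rw [← Ideal.jacobson_bot, Ideal.jacobson_eq_top_iff] at this
    exact bot_ne_top this
  · intro h
    rw [← Ideal.jacobson_bot, Ideal.mem_jacobson_iff]
    intro y
    have h1 : IsRad (show A ⟶ A from y * f) := h.comp_right _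
    obtain ⟨v, hv⟩ := (isNilpotent_of_isRad h1).isUnit_one_add
    refine ⟨(v⁻¹ : (End A)ˣ), ?_⟩
    have h2 : ((v⁻¹ : (End A)ˣ) : End A) * (1 + y * f) = 1 := by
      have := v.inv_mul
      rwa [hv] at this
    rw [Submodule.mem_bot, ← h2]
    noncomm_ring

end Fitting

/-! ### Total dimension -/

section Dimension

/-- The total dimension of a representation. -/
noncomputable def dim (A : LRep K C) : ℕ :=
  ∑ x ∈ A.finite_support.toFinset, Module.finrank Kᵐᵒᵖ (A.obj x)

/-- Makes the inductions on total dimension terminate: a retract of equal dimension at every object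
has a surjective inclusion, so it is everything. -/
theorem dim_lt {A X : LRep K C} {i : X ⟶ A} {p : A ⟶ X} (h : i ≫ p = 𝟙 X)
    (h' : p ≫ i ≠ 𝟙 A) : X.dim < A.dim := by
  have hinj : ∀ x, Function.Injective (app i x) := fun x =>
    Function.LeftInverse.injective (g := app p x) fun a => congrArg (fun f => app f x a) h
  have hle : ∀ x, Module.finrank Kᵐᵒᵖ (X.obj x) ≤ Module.finrank Kᵐᵒᵖ (A.obj x) := fun x =>
    LinearMap.finrank_le_finrank_of_injective (hinj x)
  have hsub : X.finite_support.toFinset ⊆ A.finite_support.toFinset := fun x hx => by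
    rw [Set.Finite.mem_toFinset] at hx ⊢
    have : Nontrivial (X.obj x) := hx
    exact (hinj x).nontrivial
  have h1 : X.dim = ∑ x ∈ A.finite_support.toFinset, Module.finrank Kᵐᵒᵖ (X.obj x) := by
    refine Finset.sum_subset hsub fun x _ hx => ?_
    rw [Set.Finite.mem_toFinset, Set.mem_ofPred_eq, not_nontrivial_iff_subsingleton] at hx
    exact Module.finrank_zero_of_subsingleton
  rw [h1]
  refine lt_of_le_of_ne (Finset.sum_le_sum fun x _ => hle x) fun heq => h' ?_
  have heq' := (Finset.sum_eq_sum_iff_of_le fun x _ => hle x).1 heq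
  have hsurj : ∀ x, Function.Surjective (app i x) := fun x => by
    by_cases hx : Nontrivial (A.obj x)
    · exact (LinearMap.injective_iff_surjective_of_finrank_eq_finrank
        (heq' x (by rwa [Set.Finite.mem_toFinset]))).1 (hinj x)
    · rw [not_nontrivial_iff_subsingleton] at hx
      exact fun a => ⟨0, Subsingleton.elim _ _⟩
  ext x a
  obtain ⟨b, rfl⟩ := hsurj x a
  exact congrArg (app i x) (congrArg (fun f => app f x b) h)

theorem exists_indecomposable_retract (A : LRep K C) (hA : ¬ A.IsZero) :
    ∃ X : LRep K C, X.Indecomposable ∧ ∃ (i : X ⟶ A) (p : A ⟶ X), i ≫ p = 𝟙 X := by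
  induction hn : A.dim using Nat.strong_induction_on generalizing A with
  | _ n ih =>
    by_cases h : A.Indecomposable
    · exact ⟨A, h, 𝟙 A, 𝟙 A, Category.comp_id _⟩
    · simp only [Indecomposable, not_and, not_forall, not_or] at h
      obtain ⟨X, Y, ⟨s⟩, hX, hY⟩ := h hA
      have h1 : (inl X Y ≫ s.inv) ≫ s.hom ≫ fst X Y = 𝟙 X := by simp
      have h2 : X.dim < A.dim := dim_lt h1 fun h2 => hY (by
        rw [isZero_iff]
        have h' := congrArg (fun z => (inr X Y ≫ s.inv) ≫ z ≫ s.hom ≫ snd X Y) h2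
        simp only [Category.assoc, s.inv_hom_id_assoc, Category.id_comp] at h'
        rw [← Category.assoc (inr X Y) (fst X Y), inr_fst, inr_snd] at h'
        simpa using h'.symm)
      obtain ⟨Z, hZ, i, p, hip⟩ := ih _ (hn ▸ h2) X hX rfl
      refine ⟨Z, hZ, i ≫ inl X Y ≫ s.inv, s.hom ≫ fst X Y ≫ p, ?_⟩
      simp only [Category.assoc, s.inv_hom_id_assoc]
      rw [← Category.assoc (inl X Y), inl_fst, Category.id_comp, hip]

end Dimension

/-! ### Multiplicities of indecomposable summands -/

section Isotypic

/-- The morphisms `i k` and `p k` split off from `A` all direct summands isomorphic to `B`. -/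
structure IsIsotypic {κ : Type*} [Fintype κ] {B A : LRep K C} (i : κ → (B ⟶ A))
    (p : κ → (A ⟶ B)) : Prop where
  comp_self : ∀ k, i k ≫ p k = 𝟙 B
  comp_ne : ∀ k l, k ≠ l → i k ≫ p l = 0
  rest : ∀ (f : B ⟶ A) (g : A ⟶ B), IsRad (f ≫ (𝟙 A - ∑ k, p k ≫ i k) ≫ g)

/-- The residue ring of the endomorphism ring of a representation. -/
def Residue (B : LRep K C) : Type (max u k) := End B ⧸ Ring.jacobson (End B)

instance (B : LRep K C) : Ring B.Residue :=
  inferInstanceAs (Ring (End B ⧸ Ring.jacobson (End B)))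

/-- The residue class of an endomorphism. -/
def toResidue (B : LRep K C) : End B →+* B.Residue := Ideal.Quotient.mk (Ring.jacobson (End B))

theorem toResidue_comp {B : LRep K C} (f g : B ⟶ B) :
    B.toResidue (f ≫ g) = B.toResidue g * B.toResidue f := B.toResidue.map_mul g f

theorem toResidue_sum {B : LRep K C} {ι : Type*} (s : Finset ι) (f : ι → (B ⟶ B)) :
    B.toResidue (∑ i ∈ s, f i) = ∑ i ∈ s, B.toResidue (f i) := map_sum B.toResidue f s

theorem toResidue_sub {B : LRep K C} (f g : B ⟶ B) :
    B.toResidue (f - g) = B.toResidue f - B.toResidue g := map_sub B.toResidue f g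

theorem toResidue_id (B : LRep K C) : B.toResidue (𝟙 B) = 1 := map_one B.toResidue

theorem toResidue_zero (B : LRep K C) : B.toResidue (0 : B ⟶ B) = 0 := map_zero B.toResidue

theorem Indecomposable.toResidue_eq_zero_iff {B : LRep K C} (hB : B.Indecomposable) (f : B ⟶ B) :
    B.toResidue f = 0 ↔ IsRad f :=
  Ideal.Quotient.eq_zero_iff_mem.trans (hB.mem_jacobson_iff f)

theorem Indecomposable.nontrivial_residue {B : LRep K C} (hB : B.Indecomposable) :
    Nontrivial B.Residue := by
  refine ⟨⟨B.toResidue (𝟙 B), 0, fun h => ?_⟩⟩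
  exact hB.not_isIso_of_isRad ((hB.toResidue_eq_zero_iff _).1 h) inferInstance

theorem Indecomposable.isUnit_residue {B : LRep K C} (hB : B.Indecomposable) (a : B.Residue)
    (ha : a ≠ 0) : IsUnit a := by
  obtain ⟨f, rfl⟩ := Ideal.Quotient.mk_surjective a
  have hf : IsIso (show B ⟶ B from f) := by
    by_contra h
    exact ha ((hB.toResidue_eq_zero_iff _).2 (hB.isRad hB h))
  exact ((CategoryTheory.isUnit_iff_isIso _).2 hf).map B.toResidue

/-- The part of `A'` outside the split copies of `B` contributes only radical endomorphisms of `B`,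
so in the residue ring one may insert `∑ p' i'` for the identity of `A'`. Since multiplication in
`End` reverses composition, the row index is the target and the column index the source. -/
theorem IsIsotypic.matrix_mul {κ κ' : Type*} [Fintype κ] [Fintype κ'] [DecidableEq κ]
    {B A A' : LRep K C}
    (hB : B.Indecomposable) {i : κ → (B ⟶ A)} {p : κ → (A ⟶ B)} {i' : κ' → (B ⟶ A')}
    {p' : κ' → (A' ⟶ B)} (h : IsIsotypic i p) (h' : IsIsotypic i' p') (W : A ≅ A') :
    (Matrix.of fun k k' => B.toResidue (i' k' ≫ W.inv ≫ p k)) *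
      (Matrix.of fun k' k => B.toResidue (i k ≫ W.hom ≫ p' k')) = 1 := by
  ext k l
  rw [Matrix.mul_apply]
  have h1 : ∀ k', Matrix.of (fun k k' => B.toResidue (i' k' ≫ W.inv ≫ p k)) k k' *
      Matrix.of (fun k' k => B.toResidue (i k ≫ W.hom ≫ p' k')) k' l =
      B.toResidue (i l ≫ W.hom ≫ (p' k' ≫ i' k') ≫ W.inv ≫ p k) := fun k' => by
    simp only [Matrix.of_apply]
    rw [← toResidue_comp]
    simp
  have h2 : ∑ k', B.toResidue (i l ≫ W.hom ≫ (p' k' ≫ i' k') ≫ W.inv ≫ p k) =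
      B.toResidue (i l ≫ W.hom ≫ (∑ k', p' k' ≫ i' k') ≫ W.inv ≫ p k) := by
    rw [← toResidue_sum]
    simp only [Preadditive.sum_comp, Preadditive.comp_sum]
  simp only [h1]
  rw [h2]
  have h3 := (hB.toResidue_eq_zero_iff _).2 (h'.rest (i l ≫ W.hom) (W.inv ≫ p k))
  have h4 : (i l ≫ W.hom ≫ (∑ k', p' k' ≫ i' k') ≫ W.inv ≫ p k) =
      i l ≫ p k - (i l ≫ W.hom) ≫ (𝟙 A' - ∑ k', p' k' ≫ i' k') ≫ W.inv ≫ p k := by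
    simp [Preadditive.sub_comp, Preadditive.comp_sub]
  rw [h4, toResidue_sub, h3, sub_zero]
  by_cases hkl : k = l
  · subst hkl
    rw [h.comp_self, Matrix.one_apply_eq, toResidue_id]
  · rw [h.comp_ne _ _ (Ne.symm hkl), Matrix.one_apply_ne hkl, toResidue_zero]

/-- The uniqueness half of Krull–Schmidt: a rectangular matrix that is invertible over a skew field
is square. -/
theorem IsIsotypic.card_eq {κ κ' : Type*} [Fintype κ] [Fintype κ'] {B A A' : LRep K C}
    (hB : B.Indecomposable) {i : κ → (B ⟶ A)} {p : κ → (A ⟶ B)} {i' : κ' → (B ⟶ A')}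
    {p' : κ' → (A' ⟶ B)} (h : IsIsotypic i p) (h' : IsIsotypic i' p') (W : A ≅ A') :
    Fintype.card κ = Fintype.card κ' := by
  classical
  have := hB.nontrivial_residue
  let _ : DivisionRing B.Residue := DivisionRing.ofIsUnitOrEqZero fun a =>
    (em (a = 0)).elim Or.inr fun ha => Or.inl (hB.isUnit_residue a ha)
  exact Matrix.square_of_invertible _ _ (h.matrix_mul hB h' W) (h'.matrix_mul hB h W.symm)

/-- The morphisms `i l` and `p l` present `A` as a direct sum of the `Y l`. -/
structure IsDecomp {ι : Type*} [Fintype ι] {A : LRep K C} {Y : ι → LRep K C}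
    (i : ∀ l, Y l ⟶ A) (p : ∀ l, A ⟶ Y l) : Prop where
  comp_self : ∀ l, i l ≫ p l = 𝟙 (Y l)
  comp_ne : ∀ l m, l ≠ m → i l ≫ p m = 0
  total : ∑ l, p l ≫ i l = 𝟙 A

/-- The complement is a sum of indecomposables not isomorphic to `B`. Every morphism from `B` to one
of these is a non-isomorphism, hence radical. -/
theorem IsDecomp.isIsotypic {ι κ : Type*} [Fintype ι] [Fintype κ] {A B : LRep K C}
    {Y : ι → LRep K C} {i : ∀ l, Y l ⟶ A} {p : ∀ l, A ⟶ Y l} (h : IsDecomp i p)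
    (hB : B.Indecomposable) (hY : ∀ l, (Y l).Indecomposable) (j : κ → ι)
    (hj : Function.Injective j) (θ : ∀ k, Y (j k) ≅ B)
    (hne : ∀ l, l ∉ Set.range j → IsEmpty (Y l ≅ B)) :
    IsIsotypic (fun k => (θ k).inv ≫ i (j k)) (fun k => p (j k) ≫ (θ k).hom) where
  comp_self k := by
    rw [Category.assoc, ← Category.assoc (i _), h.comp_self]; simp
  comp_ne k l hkl := by
    rw [Category.assoc, ← Category.assoc (i _), h.comp_ne _ _ (hj.ne hkl)]; simp
  rest f g := by
    classical
    have h1 : ∑ k, (p (j k) ≫ (θ k).hom) ≫ (θ k).inv ≫ i (j k) =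
        ∑ l ∈ Finset.univ.map ⟨j, hj⟩, p l ≫ i l := by
      rw [Finset.sum_map]
      simp
    rw [h1, ← h.total, ← Finset.sum_sdiff (Finset.subset_univ (Finset.univ.map ⟨j, hj⟩)),
      add_sub_cancel_right, Preadditive.sum_comp, Preadditive.comp_sum]
    refine IsRad.sum fun l hl => ?_
    have hl' : l ∉ Set.range j := by simpa using hl
    have : IsRad (f ≫ p l) := hB.isRad (hY l) fun hi => (hne l hl').false (asIso (f ≫ p l)).symm
    simpa using this.comp_right (i l ≫ g)

end Isotypic
end LRep

/-! ### The category with involution of selfadjoint representations -/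

section Adjoint

variable {K : Type k} [DivisionRing K] [StarRing K] {C : Type u} [Category.{v} C] [Preadditive C]
  [Linear (Subring.center K) C] [Involution C] [LinearInvolution K C]

open Involution LRep

theorem LRep.sum_app {A B : LRep K C} {ι : Type*} (s : Finset ι) (f : ι → (A ⟶ B)) (x : C)
    (a : A.obj x) : app (∑ i ∈ s, f i) x a = ∑ i ∈ s, app (f i) x a :=
  map_sum (AddMonoidHom.mk' (fun f : A ⟶ B => app f x a) fun f g => add_app f g x a) f s

/-- Selfadjoint representations with all morphisms of the underlying representations. -/
instance : Category (SelfRep K C) where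
  Hom M N := M.rep ⟶ N.rep
  id M := 𝟙 M.rep
  comp f g := CategoryStruct.comp (obj := LRep K C) f g
  id_comp f := Category.id_comp (obj := LRep K C) f
  comp_id f := Category.comp_id (obj := LRep K C) f
  assoc f g h := Category.assoc (obj := LRep K C) f g h

instance : Preadditive (SelfRep K C) where
  homGroup M N := inferInstanceAs (AddCommGroup (M.rep ⟶ N.rep))
  add_comp _ _ _ f f' g := Preadditive.add_comp (C := LRep K C) _ _ _ f f' g
  comp_add _ _ _ f g g' := Preadditive.comp_add (C := LRep K C) _ _ _ f g g'

instance : Dagger (SelfRep K C) where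
  dag f := SelfRep.adjoint f
  dag_dag f := SelfRep.adjoint_adjoint f
  dag_comp {M N L} f g := SelfRep.adjoint_comp (M := M) (N := N) (L := L) f g
  dag_add {M N} f g := SelfRep.adjoint_add (M := M) (N := N) f g

open CatInv.Dagger (dag)

namespace SelfRep

/-- A morphism of selfadjoint representations as a morphism of the underlying representations. -/
abbrev toRep {M N : SelfRep K C} (f : M ⟶ N) : M.rep ⟶ N.rep := f

/-- A morphism of the underlying representations as a morphism of selfadjoint representations. -/
abbrev ofRep {M N : SelfRep K C} (f : M.rep ⟶ N.rep) : M ⟶ N := f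

/-- The isomorphism of the underlying representations. -/
def repIso {M N : SelfRep K C} (f : M ≅ N) : M.rep ≅ N.rep := ⟨f.hom, f.inv, f.3, f.4⟩

theorem isIso_rep {M N : SelfRep K C} {f : M ⟶ N} (h : IsIso f) :
    IsIso (toRep f) :=
  (repIso (asIso f)).isIso_hom

theorem isIso_of_rep {M N : SelfRep K C} {f : M ⟶ N}
    (h : IsIso (toRep f)) : IsIso f := by
  obtain ⟨g, h1, h2⟩ := h
  exact ⟨g, h1, h2⟩

theorem congruent_iff {M N : SelfRep K C} : M.Congruent N ↔ ∃ f : M ⟶ N, IsUnitary f := by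
  constructor
  · rintro ⟨f, hf⟩
    refine ⟨f.hom, ?_, ?_⟩
    · change f.hom ≫ adjoint f.hom = 𝟙 M.rep
      rw [hf, f.hom_inv_id]
    · change adjoint f.hom ≫ f.hom = 𝟙 N.rep
      rw [hf, f.inv_hom_id]
  · rintro ⟨f, hf⟩
    exact ⟨⟨toRep f, toRep (dag f), hf.1, hf.2⟩, rfl⟩

theorem isRad_rep {M N : SelfRep K C} {f : M ⟶ N} :
    IsRad (toRep f) ↔ IsRad f :=
  ⟨fun h g => isIso_of_rep (h g), fun h g => isIso_rep (h g)⟩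

theorem isNilpotent_of_isRad {M : SelfRep K C} {f : M ⟶ M} (hf : IsRad f) :
    IsNilpotent (End.of f) := by
  obtain ⟨n, hn⟩ := LRep.isNilpotent_of_isRad (isRad_rep.2 hf)
  refine ⟨n, Eq.trans ?_ hn⟩
  clear hn
  induction n with
  | zero => rfl
  | succ n ih =>
    exact (pow_succ (End.of f) n).trans ((congrArg (· * End.of f) ih).trans
      (pow_succ (End.of (toRep f)) n).symm)

end SelfRep

theorem LRep.isIso_two (hK : ringChar K ≠ 2) (A : LRep K C) : IsIso (𝟙 A + 𝟙 A) := by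
  have h2 : (2 : Kᵐᵒᵖ) ≠ 0 := fun h => Ring.two_ne_zero hK (congrArg MulOpposite.unop h)
  refine (isoOfBijective (𝟙 A + 𝟙 A) fun x => ?_).isIso_hom
  have inj : Function.Injective (app (𝟙 A + 𝟙 A) x) := by
    rw [← LinearMap.ker_eq_bot, LinearMap.ker_eq_bot']
    intro a ha
    have ha' : (2 : Kᵐᵒᵖ) • a = 0 := by rw [two_smul]; exact ha
    exact (smul_eq_zero.1 ha').resolve_left h2
  exact ⟨inj, LinearMap.injective_iff_surjective.1 inj⟩

theorem SelfRep.isUnit_two (hK : ringChar K ≠ 2) (M : SelfRep K C) : IsUnit (2 : End M) := by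
  rw [← one_add_one_eq_two]
  exact (CategoryTheory.isUnit_iff_isIso _).2 (isIso_of_rep (LRep.isIso_two hK M.rep))

namespace SelfRep

section OrthSum

variable {ι : Type} [Fintype ι] [DecidableEq ι] (M : ι → SelfRep K C)

theorem orthSum_act (x : C) (a : (orthSum M).rep.obj x) (b : (orthSum M).rep.obj (ob x)) :
    (orthSum M).act x a b = ∑ i, (M i).act x (a i) (b i) := rfl

/-- The inclusion of a summand of an orthogonal sum. -/
def orthι (i : ι) : M i ⟶ orthSum M :=
  mkHom (A := (M i).rep) (B := LRep.pi fun i => (M i).rep)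
    (fun x => LinearMap.single Kᵐᵒᵖ (fun i => (M i).rep.obj x) i) fun {x y} α a => by
      refine funext fun j => ?_
      exact (Pi.apply_single (fun i => (M i).rep.map α) (fun i => map_zero _) i a j).symm

/-- The projection to a summand of an orthogonal sum. -/
def orthπ (i : ι) : orthSum M ⟶ M i :=
  mkHom (A := LRep.pi fun i => (M i).rep) (B := (M i).rep)
    (fun x => LinearMap.proj (R := Kᵐᵒᵖ) (φ := fun i => (M i).rep.obj x) i) fun _ _ => rfl

theorem dag_orthι (i : ι) : dag (orthι M i) = orthπ M i := by
  refine (eq_adjoint (M := M i) (N := orthSum M) fun x b a => ?_).symm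
  rw [orthSum_act, Finset.sum_eq_single i]
  · congr 1
    exact (Pi.single_eq_same (M := fun i => (M i).rep.obj (ob x)) i a).symm
  · intro j _ hj
    exact (congrArg ((M j).act x (b j))
      (Pi.single_eq_of_ne (M := fun i => (M i).rep.obj (ob x)) hj a)).trans (map_zero _)
  · simp

theorem isOrthDecomp_orthι : IsOrthDecomp (orthι M) where
  comp_dag i := by
    rw [dag_orthι]
    refine LRep.hom_ext (A := (M i).rep) (B := (M i).rep) fun x a => ?_
    exact Pi.single_eq_same (M := fun i => (M i).rep.obj x) i a
  comp_dag_ne i j h := by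
    rw [dag_orthι]
    refine LRep.hom_ext (A := (M i).rep) (B := (M j).rep) fun x a => ?_
    exact Pi.single_eq_of_ne (M := fun i => (M i).rep.obj x) (Ne.symm h) a
  sum_dag := by
    simp only [dag_orthι]
    refine LRep.hom_ext (A := (orthSum M).rep) (B := (orthSum M).rep) fun x a => ?_
    change app (∑ i, toRep (orthπ M i) ≫ toRep (orthι M i)) x a = a
    rw [LRep.sum_app]
    exact Finset.univ_sum_single (M := fun i => (M i).rep.obj x) a

end OrthSum

section Image

variable (M : SelfRep K C) (e : M ⟶ M)

theorem act_idem {e : M ⟶ M} (hs : dag e = e) (x : C) (a : M.rep.obj x) (b : M.rep.obj (ob x)) :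
    M.act x (app e x a) b = M.act x a (app e (ob x) b) := by
  conv_lhs => rw [← hs]
  exact act_adjoint (M := M) (N := M) e x a b

/-- The selfadjoint representation on the image of a selfadjoint idempotent. -/
noncomputable def imageSelf (he : e ≫ e = e) (hs : dag e = e) : SelfRep K C :=
  mk' (LRep.image (A := M.rep) e)
    (fun x => (LinearMap.mk
      ⟨fun φ : Dual K (M.rep.obj (ob x)) =>
        (φ.comp (LinearMap.range (app (A := M.rep) e (ob x))).subtype :
          Dual K (LinearMap.range (app (A := M.rep) e (ob x)))), fun _ _ => rfl⟩
      (fun _ _ => rfl)) ∘ₗ M.act x ∘ₗ (LinearMap.range (app (A := M.rep) e x)).subtype)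
    (fun x => by
      have hee : ∀ x a, app (A := M.rep) e x (app e x a) = app e x a := fun x a =>
        congrArg (fun f => app (A := M.rep) f x a) he
      constructor
      · rintro ⟨_, a, rfl⟩ ⟨_, a', rfl⟩ h
        apply Subtype.ext
        apply (M.act_bijective x).1
        ext b
        have h' := congrArg (fun φ : Dual K (LinearMap.range (app (A := M.rep) e (ob x))) =>
          φ ⟨app e (ob x) b, b, rfl⟩) h
        change M.act x (app e x a) (app e (ob x) b) = M.act x (app e x a') (app e (ob x) b) at h'
        rwa [← M.act_idem hs, ← M.act_idem hs, hee, hee] at h'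
      · intro φ
        change Dual K (LinearMap.range (app (A := M.rep) e (ob x))) at φ
        obtain ⟨a, ha⟩ := (M.act_bijective x).2
          (φ.comp (app (A := M.rep) e (ob x)).rangeRestrict)
        refine ⟨⟨app e x a, a, rfl⟩, LinearMap.ext ?_⟩
        rintro ⟨_, b, rfl⟩
        change M.act x (app e x a) (app e (ob x) b) = _
        rw [M.act_idem hs, hee, ha]
        exact congrArg φ (Subtype.ext (hee _ b)))
    (fun α a b => M.act_map α a.1 b.1)
    (fun x a b => M.act_symm x a.1 b.1)

/-- Selfadjoint idempotents split orthogonally: the form restricted to the image is nondegenerate,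
and the adjoint of the inclusion is the projection. -/
theorem exists_image (he : e ≫ e = e) (hs : dag e = e) :
    ∃ (N : SelfRep K C) (w : N ⟶ M), w ≫ dag w = 𝟙 N ∧ dag w ≫ w = e := by
  let w : imageSelf M e he hs ⟶ M := LRep.imageι (A := M.rep) e
  have h : dag w = LRep.imageπ (A := M.rep) e := by
    refine (eq_adjoint (M := imageSelf M e he hs) (N := M) fun x b a => ?_).symm
    obtain ⟨_, a, rfl⟩ := a
    change M.act x (app e x b) (app e (ob x) a) = M.act x b (app e (ob x) a)
    rw [M.act_idem hs]
    exact congrArg (M.act x b) (congrArg (fun f => app (A := M.rep) f (ob x) a) he)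
  refine ⟨_, w, ?_, ?_⟩
  · rw [h]; exact LRep.imageι_π (A := M.rep) e he
  · rw [h]; exact LRep.imageπ_ι (A := M.rep) e

/-- The restriction of the form to a subrepresentation on which it is nondegenerate. -/
theorem exists_restrict {X : LRep K C} (i : X ⟶ M.rep)
    (hi : ∀ x (a : X.obj x), (∀ b, M.act x (app i x a) (app i (ob x) b) = 0) → a = 0) :
    ∃ (N : SelfRep K C) (w : N ⟶ M), N.rep = X ∧ w ≫ dag w = 𝟙 N := by
  let act : ∀ x, X.obj x →ₗ[Kᵐᵒᵖ] Dual K (X.obj (ob x)) := fun x =>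
    dualMap (app i (ob x)) ∘ₗ M.act x ∘ₗ app i x
  have hinj : ∀ x, Function.Injective (act x) := fun x => by
    rw [← LinearMap.ker_eq_bot, LinearMap.ker_eq_bot']
    intro a ha
    exact hi x a fun b => congrArg (fun φ : Dual K (X.obj (ob x)) => φ b) ha
  -- Injectivity bounds the dimension at `x` by the dimension at `x*`. Using this at `x*` as well
  -- gives equality, so nondegeneracy on one side yields bijections.
  have hle : ∀ x, Module.finrank Kᵐᵒᵖ (X.obj x) ≤ Module.finrank Kᵐᵒᵖ (X.obj (ob x)) := fun x => by
    rw [← Dual.finrank_eq (K := K) (V := X.obj (ob x))]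
    exact LinearMap.finrank_le_finrank_of_injective (hinj x)
  have hbij : ∀ x, Function.Bijective (act x) := fun x => by
    refine ⟨hinj x, (LinearMap.injective_iff_surjective_of_finrank_eq_finrank ?_).1 (hinj x)⟩
    rw [Dual.finrank_eq]
    have := hle (ob x)
    rw [ob_ob] at this
    exact le_antisymm (hle x) this
  let N : SelfRep K C := mk' X act hbij
    (fun {x y} α a b => by
      change M.act y (app i y (X.map α a)) (app i (ob y) b) =
        M.act x (app i x a) (app i (ob x) (X.map (mor α) b))
      rw [app_naturality, app_naturality, act_map])
    (fun x a b => by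
      change M.act x (app i x a) (app i (ob x) b) =
        star (M.act (ob x) (app i (ob x) b) (app i _ (X.map _ a)))
      rw [app_naturality, act_symm])
  let w : N ⟶ M := i
  refine ⟨N, w, rfl, ?_⟩
  refine LRep.hom_ext (A := X) (B := X) fun x a => ?_
  apply (N.act_bijective x).1
  refine LinearMap.ext fun b => ?_
  exact act_adjoint (M := N) (N := M) i x (app i x a) b

end Image

end SelfRep

/-! ### The two halves of a hyperbolic representation -/

section Plus

variable (A : LRep K C)

/-- The projection of `A⁺` onto `A`. -/
noncomputable def plusIdem : A.plus ⟶ A.plus :=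
  SelfRep.ofRep (M := A.plus) (N := A.plus) (fst A A.adj ≫ inl A A.adj)

/-- The involution exchanges the projections onto `A` and `A°`, because the form of `A⁺` pairs each
half only with the other. -/
theorem dag_plusIdem : dag (plusIdem A) =
    SelfRep.ofRep (M := A.plus) (N := A.plus) (snd A A.adj ≫ inr A A.adj) := by
  refine (SelfRep.eq_adjoint (M := A.plus) (N := A.plus) fun x b a => ?_).symm
  change A.form b.2 a.1 + star (A.form a.2 (A.map (eqToHom (ob_ob x).symm) 0)) =
    A.form b.2 a.1 +
      star ((0 : Dual K (A.obj (ob (ob x)))) (A.map (eqToHom (ob_ob x).symm) b.1))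
  simp

theorem plusIdem_add_dag : plusIdem A + dag (plusIdem A) = 𝟙 A.plus := by
  rw [dag_plusIdem]
  exact sum_total A A.adj

end Plus

/-! ### Twists by selfadjoint automorphisms -/

section Twist

variable {M : SelfRep K C}

/-- The canonical isomorphism from the underlying representation of `M^f` to that of `M`. -/
noncomputable def SelfAut.twistHom (S : HalfObjects C) (f : SelfAut M) : f.twist S ⟶ M :=
  mkHom (A := f.twistRep S) (B := M.rep) (fun x => (f.tilde S x : M.rep.obj x →ₗ[Kᵐᵒᵖ] M.rep.obj x))
    fun {_ y} _ _ =>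
    (f.tilde S y).apply_symm_apply _

theorem SelfAut.isIso_twistHom (S : HalfObjects C) (f : SelfAut M) : IsIso (f.twistHom S) :=
  SelfRep.isIso_of_rep (isoOfBijective (SelfRep.toRep (f.twistHom S))
    fun x => (f.tilde S x).bijective).isIso_hom

/-- Exactly one of `x`, `x*` lies in `S₀`. At each `x`, therefore, exactly one of the isomorphism
and its adjoint acts as `f` and the other as the identity. This equation is the only property of
`B^f` needed later, and the choice of `S₀` no longer appears in it. -/
theorem SelfAut.dag_twistHom_comp (S : HalfObjects C) (f : SelfAut M) :
    dag (f.twistHom S) ≫ f.twistHom S = SelfRep.ofRep (M := M) (N := M) f.iso.hom := by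
  have key : ∀ x b (a : M.rep.obj (ob x)),
      M.act x (app (SelfRep.toRep (dag (f.twistHom S))) x b) a =
        M.act x b (f.tilde S (ob x) a) := fun x b a =>
    SelfRep.act_adjoint (M := f.twist S) (N := M) (f.twistHom S) x b a
  refine LRep.hom_ext (A := M.rep) (B := M.rep) fun x b => ?_
  change f.tilde S x (app (SelfRep.toRep (dag (f.twistHom S))) x b) = _
  by_cases hx : x ∈ S.carrier
  · have hx' := mt (S.ob_mem_iff x).1 (not_not.2 hx)
    have h : app (SelfRep.toRep (dag (f.twistHom S))) x b = b := by
      apply (M.act_bijective x).1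
      refine LinearMap.ext fun a => ?_
      rw [key, f.tilde_of_notMem hx']
      rfl
    rw [h, f.tilde_of_mem hx]
    rfl
  · have hx' := (S.ob_mem_iff x).2 hx
    have h : app (SelfRep.toRep (dag (f.twistHom S))) x b =
        app f.iso.hom x b := by
      apply (M.act_bijective x).1
      refine LinearMap.ext fun a => ?_
      rw [key, f.tilde_of_mem hx', f.act_hom]
      rfl
    rw [h, f.tilde_of_notMem hx]
    rfl

end Twist

end Adjoint

/-! ### Lagrangian idempotents -/

open CatInv.Dagger (dag)

section Dagger

variable {𝒟 : Type*} [Category 𝒟] [Preadditive 𝒟] [Dagger 𝒟]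

/-- An idempotent `e` with `e + dag e = 1`. -/
structure IsLagrangian {P : 𝒟} (e : P ⟶ P) : Prop where
  idem : e ≫ e = e
  total : e + dag e = 𝟙 P

namespace IsLagrangian

variable {P Q M : 𝒟} {e : P ⟶ P}

theorem comp_dag (he : IsLagrangian e) : e ≫ dag e = 0 := by
  have h := congrArg (fun z => e ≫ z) he.total
  simpa [he.idem] using h

theorem dag_comp (he : IsLagrangian e) : dag e ≫ e = 0 := by
  have h := congrArg (fun z => z ≫ e) he.total
  simpa [he.idem] using h

theorem symm (he : IsLagrangian e) : IsLagrangian (dag e) :=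
  ⟨by rw [← Dagger.dag_comp, he.idem], by rw [Dagger.dag_dag, add_comm, he.total]⟩

theorem comp_dag_eq_zero (he : IsLagrangian e) {f : M ⟶ P} (hf : f ≫ e = f) :
    f ≫ dag f = 0 := by
  rw [← hf, Dagger.dag_comp, Category.assoc, ← Category.assoc e, he.comp_dag]; simp

theorem dag_comp_eq_zero (he : IsLagrangian e) {f : P ⟶ M} (hf : e ≫ f = f) :
    dag f ≫ f = 0 := by
  rw [← hf, Dagger.dag_comp, Category.assoc, ← Category.assoc (dag e), he.dag_comp]; simp

/-- Isomorphic Lagrangians give unitary morphisms. -/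
theorem isUnitary {e' : Q ⟶ Q} (he : IsLagrangian e) (he' : IsLagrangian e') {f : P ⟶ Q}
    {g : Q ⟶ P} (h1 : f ≫ g = e) (h2 : g ≫ f = e') (h3 : e ≫ f = f) (h4 : e' ≫ g = g) :
    IsUnitary (f + dag g) := by
  have h5 : f ≫ e' = f := by rw [← h2, ← Category.assoc, h1, h3]
  have h6 : g ≫ e = g := by rw [← h1, ← Category.assoc, h2, h4]
  constructor
  · simp only [Dagger.dag_add, Dagger.dag_dag, Preadditive.add_comp, Preadditive.comp_add]
    rw [he'.comp_dag_eq_zero h5, he'.dag_comp_eq_zero h4, h1, ← Dagger.dag_comp, h1, ← he.total]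
    abel
  · simp only [Dagger.dag_add, Dagger.dag_dag, Preadditive.add_comp, Preadditive.comp_add]
    rw [he.dag_comp_eq_zero h3, he.comp_dag_eq_zero h6, h2, ← Dagger.dag_comp, h2, ← he'.total]
    abel

/-- A retraction of `M` onto a Lagrangian of `P` gives an isometry of `P` into `M`, provided that
the form on the Lagrangian is sufficiently degenerate. -/
theorem exists_isometry (he : IsLagrangian e) (h2 : IsUnit (2 : End P)) {f : P ⟶ M} {g : M ⟶ P}
    (h1 : f ≫ g = e) (h3 : e ≫ f = f) (h4 : g ≫ e = g)
    (hn : IsNilpotent (End.of (f ≫ dag f ≫ dag g ≫ g))) :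
    ∃ w : P ⟶ M, w ≫ dag w = 𝟙 P := by
  have hf := he.dag_comp_eq_zero h3
  have hg := he.comp_dag_eq_zero h4
  -- For `W = f + g°` the error `W W° - 1` is `a + b`. Both terms square to zero since the
  -- Lagrangian is isotropic, so `(a + b)² = ab + ba`, and the products `ab` and `ba` annihilate
  -- each other. Thus nilpotency of `ba`, which is the hypothesis, suffices.
  let a : End P := f ≫ dag f
  let b : End P := dag g ≫ g
  have haa : a * a = 0 := by
    change (f ≫ dag f) ≫ f ≫ dag f = 0
    rw [Category.assoc, ← Category.assoc (dag f), hf]; simp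
  have hbb : b * b = 0 := by
    change (dag g ≫ g) ≫ dag g ≫ g = 0
    rw [Category.assoc, ← Category.assoc g, hg]; simp
  have hba : IsNilpotent (b * a) := by
    have : b * a = End.of (f ≫ dag f ≫ dag g ≫ g) := by
      change (f ≫ dag f) ≫ dag g ≫ g = f ≫ dag f ≫ dag g ≫ g
      rw [Category.assoc]
    rwa [this]
  have hab : IsNilpotent (a * b) := by
    obtain ⟨n, hn⟩ := hba
    refine ⟨n + 1, ?_⟩
    rw [pow_succ, ← mul_assoc, mul_pow_mul, hn]
    simp
  have hsum : IsNilpotent (a * b + b * a) := by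
    refine Commute.isNilpotent_add ?_ hab hba
    change a * b * (b * a) = b * a * (a * b)
    rw [mul_assoc, ← mul_assoc b b, hbb, mul_assoc b a, ← mul_assoc a a, haa]
    simp
  have hnil : IsNilpotent (a + b) := by
    have h : (a + b) ^ 2 = a * b + b * a := by
      rw [pow_two, add_mul, mul_add, mul_add, haa, hbb]; abel
    rw [← h] at hsum
    exact (IsNilpotent.pow_iff_pos two_ne_zero).1 hsum
  have hu : (f + dag g) ≫ dag (f + dag g) - 𝟙 P = f ≫ dag f + dag g ≫ g := by
    simp only [Dagger.dag_add, Dagger.dag_dag, Preadditive.add_comp, Preadditive.comp_add]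
    rw [h1, ← Dagger.dag_comp, h1, ← he.total]
    abel
  obtain ⟨s, hs⟩ := CatInv.exists_isometry h2 (f + dag g) (by rw [hu]; exact hnil)
  exact ⟨_, hs⟩

end IsLagrangian

end Dagger

/-! ### Hyperbolic representations and the splitting dichotomy -/

section Adjoint

variable {K : Type k} [DivisionRing K] [StarRing K] {C : Type u} [Category.{v} C] [Preadditive C]
  [Linear (Subring.center K) C] [Involution C] [LinearInvolution K C]

open Involution LRep SelfRep

theorem isLagrangian_plusIdem (A : LRep K C) : IsLagrangian (plusIdem A) where
  idem := by
    change (fst A A.adj ≫ inl A A.adj) ≫ fst A A.adj ≫ inl A A.adj = fst A A.adj ≫ inl A A.adj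
    rfl
  total := plusIdem_add_dag A

theorem exists_unitary_plus {A B : LRep K C} (s : A ≅ B) :
    ∃ f : A.plus ⟶ B.plus, IsUnitary f := by
  let f : A.plus ⟶ B.plus :=
    ofRep (M := A.plus) (N := B.plus) (fst A A.adj ≫ s.hom ≫ inl B B.adj)
  let g : B.plus ⟶ A.plus :=
    ofRep (M := B.plus) (N := A.plus) (fst B B.adj ≫ s.inv ≫ inl A A.adj)
  refine ⟨_, (isLagrangian_plusIdem A).isUnitary (isLagrangian_plusIdem B) (f := f) (g := g)
    ?_ ?_ rfl rfl⟩
  · change fst A A.adj ≫ (s.hom ≫ s.inv) ≫ inl A A.adj = fst A A.adj ≫ inl A A.adj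
    simp
  · change fst B B.adj ≫ (s.inv ≫ s.hom) ≫ inl B B.adj = fst B B.adj ≫ inl B B.adj
    simp

/-- `B°` is the opposite Lagrangian of `B⁺`, so `A⁺` depends only on the pair formed by `A` and its
adjoint. -/
theorem exists_unitary_plus_of_iso_adj {A B : LRep K C} (s : A ≅ B.adj) :
    ∃ f : A.plus ⟶ B.plus, IsUnitary f := by
  let f : A.plus ⟶ B.plus :=
    ofRep (M := A.plus) (N := B.plus) (fst A A.adj ≫ s.hom ≫ inr B B.adj)
  let g : B.plus ⟶ A.plus :=
    ofRep (M := B.plus) (N := A.plus) (snd B B.adj ≫ s.inv ≫ inl A A.adj)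
  refine ⟨_, (isLagrangian_plusIdem A).isUnitary (isLagrangian_plusIdem B).symm (f := f) (g := g)
    ?_ ?_ rfl ?_⟩
  · change fst A A.adj ≫ (s.hom ≫ s.inv) ≫ inl A A.adj = fst A A.adj ≫ inl A A.adj
    simp
  · rw [dag_plusIdem]
    change snd B B.adj ≫ (s.inv ≫ s.hom) ≫ inr B B.adj = snd B B.adj ≫ inr B B.adj
    simp
  · rw [dag_plusIdem]
    rfl

/-- Passing to adjoints is symmetric. -/
theorem nonempty_iso_adj {A B : LRep K C} (s : A.adj ≅ B) : Nonempty (A ≅ B.adj) := by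
  -- The given isomorphism becomes a morphism between hyperbolic representations that goes from `A°`
  -- to `B`. Its adjoint there goes from `B°` to `A`. This replaces the identification of `A°°` with
  -- `A`.
  let f : A.plus ⟶ B.plus :=
    ofRep (M := A.plus) (N := B.plus) (snd A A.adj ≫ s.hom ≫ inl B B.adj)
  let g : B.plus ⟶ A.plus :=
    ofRep (M := B.plus) (N := A.plus) (fst B B.adj ≫ s.inv ≫ inr A A.adj)
  have h1 : f ≫ g = dag (plusIdem A) := by
    rw [dag_plusIdem]
    change snd A A.adj ≫ (s.hom ≫ s.inv) ≫ inr A A.adj = snd A A.adj ≫ inr A A.adj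
    simp
  have h2 : g ≫ f = plusIdem B := by
    change fst B B.adj ≫ (s.inv ≫ s.hom) ≫ inl B B.adj = fst B B.adj ≫ inl B B.adj
    simp
  have h3 : f ≫ plusIdem B = f := rfl
  have h4 : g ≫ dag (plusIdem A) = g := by rw [dag_plusIdem]; rfl
  have h5 : dag g ≫ dag (plusIdem B) ≫ dag f = plusIdem A := by
    rw [← Dagger.dag_comp, ← Dagger.dag_comp, h3, h1, Dagger.dag_dag]
  have h6 : dag f ≫ plusIdem A ≫ dag g = dag (plusIdem B) := by
    rw [← Dagger.dag_dag (plusIdem A), ← Dagger.dag_comp, ← Dagger.dag_comp, h4, h2]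
  rw [dag_plusIdem] at h5 h6
  refine ⟨⟨inl A A.adj ≫ toRep (dag g) ≫ snd B B.adj, inr B B.adj ≫ toRep (dag f) ≫ fst A A.adj,
    ?_, ?_⟩⟩
  · exact congrArg (fun z : A.plus.rep ⟶ A.plus.rep => inl A A.adj ≫ z ≫ fst A A.adj) h5
  · exact congrArg (fun z : B.plus.rep ⟶ B.plus.rep => inr B B.adj ≫ z ≫ snd B B.adj) h6

/-- Extended by zero to `A⁺`, an idempotent of `A°` has an adjoint concentrated on `A`, where
idempotents are trivial. -/
theorem LRep.Indecomposable.adj {A : LRep K C} (hA : A.Indecomposable) :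
    A.adj.Indecomposable := by
  refine indecomposable_of_idem (fun h0 => hA.1 ?_) fun q hq => ?_
  · have h : dag (plusIdem A) = 0 := by
      rw [dag_plusIdem]
      change snd A A.adj ≫ 𝟙 A.adj ≫ inr A A.adj = 0
      rw [isZero_iff.1 h0]
      simp
    have h' : plusIdem A = 0 := by
      have := congrArg dag h
      simpa using this
    rw [isZero_iff]
    exact congrArg (fun z : A.plus.rep ⟶ A.plus.rep => inl A A.adj ≫ z ≫ fst A A.adj) h'
  · let Q : A.plus ⟶ A.plus :=
      ofRep (M := A.plus) (N := A.plus) (snd A A.adj ≫ q ≫ inr A A.adj)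
    have hQ : Q ≫ Q = Q := by
      change snd A A.adj ≫ (q ≫ q) ≫ inr A A.adj = snd A A.adj ≫ q ≫ inr A A.adj
      rw [hq]
    have hQe : Q ≫ dag (plusIdem A) = Q := by rw [dag_plusIdem]; rfl
    have heQ : dag (plusIdem A) ≫ Q = Q := by rw [dag_plusIdem]; rfl
    have h1 : plusIdem A ≫ dag Q = dag Q := by
      have := congrArg dag hQe
      simpa using this
    have h2 : dag Q ≫ plusIdem A = dag Q := by
      have := congrArg dag heQ
      simpa using this
    have h3 : (dag Q ≫ plusIdem A) ≫ dag Q = dag Q := by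
      rw [h2, ← Dagger.dag_comp, hQ]
    have back : plusIdem A ≫ dag Q ≫ plusIdem A = dag Q := by rw [h2, h1]
    have hr : (inl A A.adj ≫ toRep (dag Q) ≫ fst A A.adj) ≫
        (inl A A.adj ≫ toRep (dag Q) ≫ fst A A.adj) =
        inl A A.adj ≫ toRep (dag Q) ≫ fst A A.adj :=
      congrArg (fun z : A.plus.rep ⟶ A.plus.rep => inl A A.adj ≫ z ≫ fst A A.adj) h3
    have fwd : ∀ r : A ⟶ A, inl A A.adj ≫ toRep (dag Q) ≫ fst A A.adj = r →
        dag Q = ofRep (M := A.plus) (N := A.plus) (fst A A.adj ≫ r ≫ inl A A.adj) := by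
      rintro r rfl
      exact back.symm
    rcases hA.idem hr with h | h
    · left
      have h4 : Q = 0 := by
        have h5 : dag Q = 0 := (fwd _ h).trans rfl
        have := congrArg dag h5
        simpa using this
      exact congrArg (fun z : A.plus.rep ⟶ A.plus.rep => inr A A.adj ≫ z ≫ snd A A.adj) h4
    · right
      have h4 : Q = dag (plusIdem A) := by
        have h5 : dag Q = plusIdem A := (fwd _ h).trans rfl
        rw [← h5, Dagger.dag_dag]
      rw [dag_plusIdem] at h4
      exact congrArg (fun z : A.plus.rep ⟶ A.plus.rep => inr A A.adj ≫ z ≫ snd A A.adj) h4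

/-- Division by two. -/
theorem SelfRep.exists_half (hK : ringChar K ≠ 2) (M : SelfRep K C) :
    ∃ h : M ⟶ M, h + h = 𝟙 M ∧ dag h = h ∧ ∀ f : M ⟶ M, f ≫ h = h ≫ f := by
  obtain ⟨t, ht⟩ := M.isUnit_two hK
  have hc : ∀ z : End M, Commute ((t⁻¹ : (End M)ˣ) : End M) z := fun z =>
    Commute.units_inv_left (by rw [ht]; exact Nat.cast_commute 2 z)
  refine ⟨((t⁻¹ : (End M)ˣ) : End M), ?_, star_units_inv_eq (by rw [ht]; exact star_ofNat 2),
    fun f => (hc f).eq⟩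
  have h1 : ((t⁻¹ : (End M)ˣ) : End M) * 2 = 1 := by rw [← ht]; simp
  rw [mul_two] at h1
  exact h1

/-- Isometric images split off. -/
theorem SelfRep.exists_complement {M N : SelfRep K C} (w : N ⟶ M) (hw : w ≫ dag w = 𝟙 N) :
    ∃ (M' : SelfRep K C) (v : M' ⟶ M), v ≫ dag v = 𝟙 M' ∧ dag w ≫ w + dag v ≫ v = 𝟙 M := by
  have hee : (dag w ≫ w) ≫ dag w ≫ w = dag w ≫ w := by
    rw [Category.assoc, ← Category.assoc w, hw, Category.id_comp]
  obtain ⟨M', v, h1, h2⟩ := exists_image M (𝟙 M - dag w ≫ w)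
    (by simp only [Preadditive.sub_comp, Preadditive.comp_sub, hee]; simp) (by simp)
  exact ⟨M', v, h1, by rw [h2]; abel⟩

/-- Every nonzero selfadjoint representation has an orthogonal summand that is either
indecomposable or hyperbolic. -/
theorem SelfRep.exists_isometry (hK : ringChar K ≠ 2) (M : SelfRep K C) (hM : ¬ M.rep.IsZero) :
    (∃ (N : SelfRep K C) (w : N ⟶ M), N.rep.Indecomposable ∧ w ≫ dag w = 𝟙 N) ∨
    (∃ (X : LRep K C) (w : X.plus ⟶ M), X.Indecomposable ∧ ¬ X.IsoToSelfadjoint ∧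
      w ≫ dag w = 𝟙 X.plus) := by
  obtain ⟨X, hX, i, p, hip⟩ := exists_indecomposable_retract M.rep hM
  let f : X.plus ⟶ M := ofRep (M := X.plus) (N := M) (fst X X.adj ≫ i)
  let g : M ⟶ X.plus := ofRep (M := M) (N := X.plus) (p ≫ inl X X.adj)
  have h1 : f ≫ g = plusIdem X := by
    change fst X X.adj ≫ (i ≫ p) ≫ inl X X.adj = fst X X.adj ≫ inl X X.adj
    rw [hip, Category.id_comp]
  -- This endomorphism of `X` is the restricted form `X ⟶ X°` followed by the map `X° ⟶ M ⟶ X`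
  -- obtained from `p`. If it is invertible, the form is nondegenerate on `X`. If not, it is
  -- radical, and it supplies the nilpotency needed to embed `X⁺`.
  by_cases hz : IsIso (i ≫ toRep (dag f ≫ dag g) ≫ p)
  · left
    obtain ⟨N, w, hN, hw⟩ := M.exists_restrict i fun x a ha => by
      have h0 : app (toRep (dag f)) x (app i x a) = 0 := by
        apply (X.plus.act_bijective x).1
        rw [map_zero]
        refine LinearMap.ext fun q => ?_
        exact (act_adjoint (M := X.plus) (N := M) f x (app i x a) q).trans (ha q.1)
      have hz' : app (i ≫ toRep (dag f ≫ dag g) ≫ p) x a = 0 := by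
        change app p x (app (toRep (dag g)) x (app (toRep (dag f)) x (app i x a))) = 0
        rw [h0, map_zero, map_zero]
      have := congrArg (app (inv (i ≫ toRep (dag f ≫ dag g) ≫ p)) x) hz'
      rwa [← comp_app, IsIso.hom_inv_id, map_zero] at this
    exact ⟨N, w, hN ▸ hX, hw⟩
  · have hrad := hX.isRad hX hz
    have hn : IsNilpotent (End.of (f ≫ dag f ≫ dag g ≫ g)) :=
      SelfRep.isNilpotent_of_isRad (isRad_rep.1
        ((hrad.comp_right (inl X X.adj)).comp_left (fst X X.adj)))
    obtain ⟨w, hw⟩ := (isLagrangian_plusIdem X).exists_isometry (X.plus.isUnit_two hK)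
      h1 rfl rfl hn
    by_cases hs : X.IsoToSelfadjoint
    · left
      obtain ⟨B, ⟨s⟩⟩ := hs
      obtain ⟨h, hh, hd, -⟩ := B.exists_half hK
      let j : B ⟶ X.plus := ofRep (M := B) (N := X.plus) (s.inv ≫ inl X X.adj)
      let q : X.plus ⟶ B := ofRep (M := X.plus) (N := B) (fst X X.adj ≫ s.hom)
      have hjq : j ≫ q = 𝟙 B := by
        change s.inv ≫ s.hom = 𝟙 B.rep
        simp
      have hj : j ≫ dag j = 0 := (isLagrangian_plusIdem X).comp_dag_eq_zero rfl
      have hq : dag q ≫ q = 0 := (isLagrangian_plusIdem X).dag_comp_eq_zero rfl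
      -- With `h = 1/2`, the squares of `j` and of `q°` vanish as they lie in opposite Lagrangians,
      -- and the two cross terms each contribute `1/2`.
      have hv : (j + h ≫ dag q) ≫ dag (j + h ≫ dag q) = 𝟙 B := by
        simp only [Dagger.dag_add, Dagger.dag_dag, Dagger.dag_comp, Preadditive.add_comp,
          Preadditive.comp_add, Category.assoc, hd]
        rw [hj, ← Category.assoc j q, hjq, ← Dagger.dag_comp, hjq, ← Category.assoc (dag q) q, hq]
        simpa using hh
      refine ⟨B, (j + h ≫ dag q) ≫ w, hX.of_iso s, ?_⟩
      rw [Dagger.dag_comp, Category.assoc, ← Category.assoc w, hw, Category.id_comp, hv]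
    · right
      exact ⟨X, w, hX, hs, hw⟩

end Adjoint

/-! ### Residue classes and the representations `B^a` -/

open CatInv.Dagger (dag)

section Adjoint

variable {K : Type k} [DivisionRing K] [StarRing K] {C : Type u} [Category.{v} C] [Preadditive C]
  [Linear (Subring.center K) C] [Involution C] [LinearInvolution K C]

open Involution LRep SelfRep

namespace SelfRep

/-- The class in `T(B)` of an endomorphism of a selfadjoint representation. -/
def cls {B : SelfRep K C} (f : B ⟶ B) : B.T := B.toT (toRep f)

variable {B : SelfRep K C}

theorem cls_comp (f g : B ⟶ B) : cls (f ≫ g) = cls g * cls f := B.toT.map_mul _ _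

theorem cls_add (f g : B ⟶ B) : cls (f + g) = cls f + cls g := B.toT.map_add _ _

theorem cls_sub (f g : B ⟶ B) : cls (f - g) = cls f - cls g := B.toT.map_sub _ _

theorem cls_sum {ι : Type*} (s : Finset ι) (f : ι → (B ⟶ B)) :
    cls (∑ i ∈ s, f i) = ∑ i ∈ s, cls (f i) :=
  map_sum (AddMonoidHom.mk' (cls (B := B)) cls_add) f s

variable (B) in
theorem cls_id : cls (𝟙 B) = 1 := B.toT.map_one

variable (B) in
theorem cls_zero : cls (0 : B ⟶ B) = 0 := B.toT.map_zero

theorem cls_dag (f : B ⟶ B) : cls (dag f) = star (cls f) := rfl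

theorem exists_cls (a : B.T) : ∃ f : B ⟶ B, cls f = a := Ideal.Quotient.mk_surjective a

theorem cls_eq_zero_iff (hB : B.rep.Indecomposable) (f : B ⟶ B) : cls f = 0 ↔ IsRad f :=
  (hB.toResidue_eq_zero_iff _).trans isRad_rep

theorem isIso_of_cls (hB : B.rep.Indecomposable) {f : B ⟶ B} (hf : cls f ≠ 0) : IsIso f := by
  by_contra h
  exact hf ((cls_eq_zero_iff hB f).2 (isRad_rep.1 (hB.isRad hB fun h' => h (isIso_of_rep h'))))

theorem cls_ne_zero (hB : B.rep.Indecomposable) (f : B ⟶ B) [hf : IsIso f] : cls f ≠ 0 :=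
  fun h => hB.not_isIso_of_isRad (isRad_rep.2 ((cls_eq_zero_iff hB f).1 h)) (isIso_rep hf)

/-- Replace any lift `g` of `a` by the average of `g` and `g°`. It is selfadjoint, has the same
class because `a = a°`, and is invertible because its class is nonzero. -/
theorem exists_selfAut (hK : ringChar K ≠ 2) (hB : B.rep.Indecomposable) (a : B.HermUnit) :
    ∃ f : SelfAut B, f.toT = a.1 := by
  obtain ⟨g, hg⟩ := exists_cls a.1
  obtain ⟨h, hh, hd, hc⟩ := B.exists_half hK
  have h1 : cls (h ≫ (g + dag g)) = a.1 := by
    have : h ≫ (g + dag g) = g - h ≫ (g - dag g) := by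
      have h' : (h + h) ≫ g = g := by rw [hh, Category.id_comp]
      rw [Preadditive.add_comp] at h'
      rw [Preadditive.comp_add, Preadditive.comp_sub, ← sub_add, sub_eq_iff_eq_add.2 h'.symm]
    rw [this, cls_sub, cls_comp, cls_sub, cls_dag, hg, a.2.2, sub_self, zero_mul, sub_zero]
  have : IsIso (h ≫ (g + dag g)) := isIso_of_cls hB (by rw [h1]; exact a.2.1)
  refine ⟨⟨repIso (asIso (h ≫ (g + dag g))), ?_⟩, h1⟩
  change dag (h ≫ (g + dag g)) = h ≫ (g + dag g)
  rw [Dagger.dag_comp, hd, hc, Dagger.dag_add, Dagger.dag_dag, add_comm]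

/-- The morphism of selfadjoint representations given by a selfadjoint automorphism. -/
def _root_.CatInv.SelfAut.hom (f : SelfAut B) : B ⟶ B := f.iso.hom

theorem _root_.CatInv.SelfAut.cls_hom (f : SelfAut B) : cls f.hom = f.toT := rfl

instance (f : SelfAut B) (S : HalfObjects C) : IsIso (f.twistHom S) := f.isIso_twistHom S

theorem isIso_dag {M N : SelfRep K C} (f : M ⟶ N) [IsIso f] : IsIso (dag f) :=
  ⟨dag (inv f), by rw [← Dagger.dag_comp, IsIso.inv_hom_id, dag_id],
    by rw [← Dagger.dag_comp, IsIso.hom_inv_id, dag_id]⟩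

/-- A selfadjoint representation isomorphic to an indecomposable `B` is congruent to some `B^a`. -/
theorem exists_unitary_twist (hK : ringChar K ≠ 2) (hB : B.rep.Indecomposable)
    {N : SelfRep K C} (g : B ⟶ N) [IsIso g] (S : HalfObjects C) (F : B.HermUnit → SelfAut B)
    (hF : ∀ a, (F a).toT = a.1) :
    ∃ (a : B.HermUnit) (f : (F a).twist S ⟶ N), IsUnitary f := by
  have := isIso_dag g
  have hs : dag (inv (g ≫ dag g)) = inv (g ≫ dag g) := by
    rw [← cancel_mono (g ≫ dag g), IsIso.inv_hom_id]
    have : g ≫ dag g = dag (g ≫ dag g) := by simp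
    nth_rw 2 [this]
    rw [← Dagger.dag_comp, IsIso.hom_inv_id, dag_id]
  -- For the canonical `t : B^a ⟶ B`, the morphism `t g` is an isometry exactly when `g g°` is
  -- inverse to `t° t = f_a`. Hence `a` is the class of `(g g°)⁻¹`.
  let a : B.HermUnit := ⟨cls (inv (g ≫ dag g)), cls_ne_zero hB _, by rw [← cls_dag, hs]⟩
  refine ⟨a, ?_⟩
  have h1 : dag g ≫ inv (g ≫ dag g) ≫ g = 𝟙 N := by
    rw [IsIso.inv_comp, Category.assoc, IsIso.inv_hom_id, Category.comp_id, IsIso.hom_inv_id]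
  have h2 : IsRad ((F a).hom - inv (g ≫ dag g)) := by
    rw [← cls_eq_zero_iff hB, cls_sub, SelfAut.cls_hom, hF, sub_self]
  -- `W W° = g° f_a g` differs from `g° (g g°)⁻¹ g = 1` only by a radical term, since `f_a` and `(g
  -- g°)⁻¹` have the same class.
  let W : N ⟶ (F a).twist S := dag ((F a).twistHom S ≫ g)
  have hW : W ≫ dag W - 𝟙 N = dag g ≫ ((F a).hom - inv (g ≫ dag g)) ≫ g := by
    rw [Preadditive.sub_comp, Preadditive.comp_sub, h1]
    congr 1
    change dag ((F a).twistHom S ≫ g) ≫ dag (dag ((F a).twistHom S ≫ g)) = _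
    rw [Dagger.dag_dag, Dagger.dag_comp, Category.assoc,
      ← Category.assoc (dag ((F a).twistHom S)), (F a).dag_twistHom_comp S]
    rfl
  have : IsIso W := isIso_dag _
  obtain ⟨f, hf⟩ := exists_unitary (N.isUnit_two hK) W
    (SelfRep.isNilpotent_of_isRad (by rw [hW]; exact (h2.comp_right g).comp_left (dag g)))
  exact ⟨dag f, hf.symm⟩

end SelfRep

/-! ### Frames: Hermitian forms versus congruence -/

section Frame

variable {B : SelfRep K C} {F : B.HermUnit → SelfAut B}

/-- The morphisms `i s` and `p s` present an orthogonal summand of `M` as `B^φ`. -/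
structure IsFrame (F : B.HermUnit → SelfAut B) (φ : HermForm B) {M : SelfRep K C}
    (i : Fin φ.rank → (B ⟶ M)) (p : Fin φ.rank → (M ⟶ B)) : Prop where
  comp_self : ∀ s, i s ≫ p s = 𝟙 B
  comp_ne : ∀ s t, s ≠ t → i s ≫ p t = 0
  herm : ∀ s, dag (p s) ≫ p s = (F (φ.coeff s)).hom
  herm_ne : ∀ s t, s ≠ t → dag (p s) ≫ p t = 0
  selfadjoint : ∀ s, dag (p s ≫ i s) = p s ≫ i s

/-- Transports isometric copies of the various `B^a` to the single object `B` along `t : B^a ⟶ B`.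
The form then reappears in `p° p = t° t = f_a`. -/
theorem IsFrame.of_isometry (S : HalfObjects C) (φ : HermForm B) {M : SelfRep K C}
    {w : ∀ s, (F (φ.coeff s)).twist S ⟶ M} (h1 : ∀ s, w s ≫ dag (w s) = 𝟙 _)
    (h2 : ∀ s t, s ≠ t → w s ≫ dag (w t) = 0) :
    IsFrame F φ (fun s => inv ((F (φ.coeff s)).twistHom S) ≫ w s)
      (fun s => dag (w s) ≫ (F (φ.coeff s)).twistHom S) where
  comp_self s := by
    rw [Category.assoc, ← Category.assoc (w s), h1]; simp
  comp_ne s t h := by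
    rw [Category.assoc, ← Category.assoc (w s), h2 s t h]; simp
  herm s := by
    rw [Dagger.dag_comp, Dagger.dag_dag, Category.assoc, ← Category.assoc (w s), h1,
      Category.id_comp, SelfAut.dag_twistHom_comp]
    rfl
  herm_ne s t h := by
    rw [Dagger.dag_comp, Dagger.dag_dag, Category.assoc, ← Category.assoc (w s), h2 s t h]; simp
  selfadjoint s := by simp

variable {φ ψ : HermForm B} {M M' : SelfRep K C}
  {i : Fin φ.rank → (B ⟶ M)} {p : Fin φ.rank → (M ⟶ B)}
  {i' : Fin ψ.rank → (B ⟶ M')} {p' : Fin ψ.rank → (M' ⟶ B)}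

theorem IsFrame.cls_herm (hF : ∀ a, (F a).toT = a.1) (h : IsFrame F φ i p) (s t : Fin φ.rank) :
    cls (dag (p s) ≫ p t) = φ.matrix t s := by
  by_cases hst : s = t
  · subst hst
    rw [h.herm, SelfAut.cls_hom, hF, HermForm.matrix, Matrix.diagonal_apply_eq]
  · rw [h.herm_ne s t hst, cls_zero, HermForm.matrix, Matrix.diagonal_apply_ne _ (Ne.symm hst)]

/-- Frames of congruent representations give equivalent forms. -/
theorem IsFrame.equivalent (hF : ∀ a, (F a).toT = a.1) (hB : B.rep.Indecomposable)
    (h : IsFrame F φ i p)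
    (h' : IsFrame F ψ i' p')
    (hr : ∀ (f : B ⟶ M) (g : M ⟶ B), IsRad (f ≫ (𝟙 M - ∑ s, p s ≫ i s) ≫ g))
    (hr' : ∀ (f : B ⟶ M') (g : M' ⟶ B), IsRad (f ≫ (𝟙 M' - ∑ s, p' s ≫ i' s) ≫ g))
    {W : M ⟶ M'} (hW : IsUnitary W) : φ.Equivalent ψ := by
  have I : IsIsotypic (fun s => toRep (i s)) (fun s => toRep (p s)) :=
    ⟨h.comp_self, h.comp_ne, fun f g => isRad_rep.2 (hr f g)⟩
  have I' : IsIsotypic (fun s => toRep (i' s)) (fun s => toRep (p' s)) :=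
    ⟨h'.comp_self, h'.comp_ne, fun f g => isRad_rep.2 (hr' f g)⟩
  let V : M.rep ≅ M'.rep := ⟨toRep W, toRep (dag W), hW.1, hW.2⟩
  let c : Matrix (Fin ψ.rank) (Fin φ.rank) B.T := Matrix.of fun t s => cls (i s ≫ W ≫ p' t)
  let d : Matrix (Fin φ.rank) (Fin ψ.rank) B.T := Matrix.of fun s t => cls (i' t ≫ dag W ≫ p s)
  have h1 : d * c = 1 := I.matrix_mul hB I' V
  have h2 : c * d = 1 := I'.matrix_mul hB I V.symm
  -- The computation produces `c φ c* = ψ`, so the change of variables is the conjugate transpose of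
  -- `c`.
  refine ⟨c.conjTranspose, d.conjTranspose, ?_, ?_, ?_⟩
  · rw [← Matrix.conjTranspose_mul, h1, Matrix.conjTranspose_one]
  · rw [← Matrix.conjTranspose_mul, h2, Matrix.conjTranspose_one]
  · rw [Matrix.conjTranspose_conjTranspose]
    ext t t'
    rw [← h'.cls_herm hF t' t, HermForm.matrix, Matrix.mul_apply]
    simp only [Matrix.mul_diagonal, Matrix.conjTranspose_apply]
    have h3 : ∀ s, c t s * (φ.coeff s).1 * star (c t' s) =
        cls (dag (p' t') ≫ dag W ≫ (p s ≫ i s) ≫ W ≫ p' t) := fun s => by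
      change cls (i s ≫ W ≫ p' t) * (φ.coeff s).1 * star (cls (i s ≫ W ≫ p' t')) = _
      rw [← hF, ← SelfAut.cls_hom, ← cls_dag, ← cls_comp, ← cls_comp]
      -- The projection `e = p i` is a selfadjoint idempotent, so `e = e° e = i° (p° p) i`; this is
      -- where the coefficient enters.
      have hE : p s ≫ i s = dag (i s) ≫ (F (φ.coeff s)).hom ≫ i s := by
        rw [← h.herm, Category.assoc, ← Category.assoc, ← Dagger.dag_comp, h.selfadjoint,
          Category.assoc, ← Category.assoc (i s), h.comp_self, Category.id_comp]
      rw [hE]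
      simp
    rw [Finset.sum_congr rfl fun s _ => h3 s, ← cls_sum]
    have h4 : ∑ s, dag (p' t') ≫ dag W ≫ (p s ≫ i s) ≫ W ≫ p' t =
        dag (p' t') ≫ p' t - (dag (p' t') ≫ dag W) ≫ (𝟙 M - ∑ s, p s ≫ i s) ≫ W ≫ p' t := by
      simp only [Preadditive.sub_comp, Preadditive.comp_sub, Preadditive.sum_comp,
        Preadditive.comp_sum, Category.id_comp, Category.assoc]
      rw [← Category.assoc (dag W), hW.2, Category.id_comp]
      abel
    rw [h4, cls_sub, (cls_eq_zero_iff hB _).2 (hr _ _), sub_zero]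

theorem IsFrame.isRad_of_entries (hp : ∑ s, p s ≫ i s = 𝟙 M) {Z : M ⟶ M}
    (hZ : ∀ s t, IsRad (i s ≫ Z ≫ p t)) : IsRad Z := by
  have : Z = ∑ s, ∑ t, p s ≫ (i s ≫ Z ≫ p t) ≫ i t := by
    calc Z = 𝟙 M ≫ Z ≫ 𝟙 M := by simp
      _ = _ := by
        rw [← hp]
        simp only [Preadditive.sum_comp, Preadditive.comp_sum, Category.assoc]
        exact Finset.sum_comm
  rw [this]
  exact IsRad.sum fun s _ => IsRad.sum fun t _ => ((hZ s t).comp_right (i t)).comp_left (p s)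

/-- Here the entries are those of a sesquilinear form, since comparing `W° W` with 1 amounts to
comparing two Hermitian matrices. -/
theorem IsFrame.isRad_of_dag_entries (hp : ∑ s, p s ≫ i s = 𝟙 M) {Z : M ⟶ M}
    (hZ : ∀ s t, IsRad (dag (p s) ≫ Z ≫ p t)) : IsRad Z := by
  have : Z = ∑ s, ∑ t, dag (i s) ≫ (dag (p s) ≫ Z ≫ p t) ≫ i t := by
    calc Z = dag (𝟙 M) ≫ Z ≫ 𝟙 M := by simp
      _ = _ := by
        rw [← hp]
        simp only [dag_sum, Dagger.dag_comp, Preadditive.sum_comp, Preadditive.comp_sum,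
          Category.assoc]
        exact Finset.sum_comm
  rw [this]
  exact IsRad.sum fun s _ => IsRad.sum fun t _ => ((hZ s t).comp_right (i t)).comp_left _

/-- A matrix with respect to full frames. -/
theorem IsFrame.comp_hom (h : IsFrame F φ i p) (c : Fin ψ.rank → Fin φ.rank → (B ⟶ B))
    (s : Fin φ.rank) :
    i s ≫ (∑ s, ∑ t, p s ≫ c t s ≫ i' t) = ∑ t, c t s ≫ i' t := by
  rw [Preadditive.comp_sum, Finset.sum_eq_single s]
  · rw [Preadditive.comp_sum]
    refine Finset.sum_congr rfl fun t _ => ?_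
    rw [← Category.assoc, h.comp_self, Category.id_comp]
  · intro s' _ hs'
    rw [Preadditive.comp_sum]
    refine Finset.sum_eq_zero fun t _ => ?_
    rw [← Category.assoc, h.comp_ne _ _ (Ne.symm hs'), Limits.zero_comp]
  · simp

theorem IsFrame.hom_comp (h' : IsFrame F ψ i' p') (c : Fin ψ.rank → Fin φ.rank → (B ⟶ B))
    (t : Fin ψ.rank) :
    (∑ s, ∑ t, p s ≫ c t s ≫ i' t) ≫ p' t = ∑ s, p s ≫ c t s := by
  rw [Preadditive.sum_comp]
  refine Finset.sum_congr rfl fun s _ => ?_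
  rw [Preadditive.sum_comp, Finset.sum_eq_single t]
  · rw [Category.assoc, Category.assoc, h'.comp_self, Category.comp_id]
  · intro t' _ ht'
    rw [Category.assoc, Category.assoc, h'.comp_ne _ _ ht']
    simp
  · simp

/-- Lifting inverse matrices over `T(B)` gives morphisms `W`, `V` with `1 - W V` radical, so `W V`
is invertible. -/
theorem IsFrame.isIso_comp (hB : B.rep.Indecomposable) (h : IsFrame F φ i p)
    (h' : IsFrame F ψ i' p') (hp : ∑ s, p s ≫ i s = 𝟙 M)
    (c : Fin ψ.rank → Fin φ.rank → (B ⟶ B)) (d : Fin φ.rank → Fin ψ.rank → (B ⟶ B))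
    (hdc : (Matrix.of fun s t => cls (d s t)) * (Matrix.of fun t s => cls (c t s)) = 1) :
    IsIso ((∑ s, ∑ t, p s ≫ c t s ≫ i' t) ≫ (∑ t, ∑ s, p' t ≫ d s t ≫ i s)) := by
  set W := ∑ s, ∑ t, p s ≫ c t s ≫ i' t with hWdef
  set V := ∑ t, ∑ s, p' t ≫ d s t ≫ i s with hVdef
  have hrad : IsRad (𝟙 M - W ≫ V) := by
    refine IsFrame.isRad_of_entries hp fun s s' => ?_
    rw [← cls_eq_zero_iff hB]
    have e1 : i s ≫ (W ≫ V) ≫ p s' = ∑ t, c t s ≫ d s' t := by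
      rw [Category.assoc, hVdef, h.hom_comp (φ := ψ) (ψ := φ) d s', ← Category.assoc, hWdef,
        h.comp_hom c s, Preadditive.sum_comp]
      refine Finset.sum_congr rfl fun t _ => ?_
      rw [Preadditive.comp_sum, Finset.sum_eq_single t]
      · rw [Category.assoc, ← Category.assoc (i' t), h'.comp_self, Category.id_comp]
      · intro t' _ ht'
        rw [Category.assoc, ← Category.assoc (i' t), h'.comp_ne _ _ (Ne.symm ht')]
        simp
      · simp
    have e2 : cls (∑ t, c t s ≫ d s' t) = (1 : Matrix _ _ B.T) s' s := by
      rw [← hdc, cls_sum, Matrix.mul_apply]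
      exact Finset.sum_congr rfl fun t _ => cls_comp _ _
    have e3 : cls (i s ≫ p s') = (1 : Matrix _ _ B.T) s' s := by
      by_cases hs : s = s'
      · subst hs
        rw [h.comp_self, cls_id, Matrix.one_apply_eq]
      · rw [h.comp_ne _ _ hs, cls_zero, Matrix.one_apply_ne (Ne.symm hs)]
    rw [Preadditive.sub_comp, Preadditive.comp_sub, e1, cls_sub, e2, Category.id_comp, e3, sub_self]
  have := hrad (𝟙 M)
  rwa [Category.comp_id, sub_sub_cancel] at this

/-- Equivalent forms give congruent representations. -/
theorem IsFrame.exists_unitary (hF : ∀ a, (F a).toT = a.1) (hK : ringChar K ≠ 2)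
    (hB : B.rep.Indecomposable)
    (h : IsFrame F φ i p) (h' : IsFrame F ψ i' p') (hp : ∑ s, p s ≫ i s = 𝟙 M)
    (hp' : ∑ s, p' s ≫ i' s = 𝟙 M') (he : φ.Equivalent ψ) :
    ∃ f : M ⟶ M', IsUnitary f := by
  obtain ⟨c₀, d₀, hcd, hdc, heq⟩ := he
  choose c hc using fun t s => exists_cls (B := B) (c₀.conjTranspose t s)
  choose d hd using fun s t => exists_cls (B := B) (d₀.conjTranspose s t)
  have hc' : (Matrix.of fun t s => cls (c t s)) = c₀.conjTranspose := by
    ext t s; exact hc t s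
  have hd' : (Matrix.of fun s t => cls (d s t)) = d₀.conjTranspose := by
    ext s t; exact hd s t
  have i1 := h.isIso_comp hB h' hp c d
    (by rw [hc', hd', ← Matrix.conjTranspose_mul, hcd, Matrix.conjTranspose_one])
  have i2 := h'.isIso_comp hB h hp' d c
    (by rw [hc', hd', ← Matrix.conjTranspose_mul, hdc, Matrix.conjTranspose_one])
  set W := ∑ s, ∑ t, p s ≫ c t s ≫ i' t with hWdef
  set V := ∑ t, ∑ s, p' t ≫ d s t ≫ i s with hVdef
  -- Both composites of `W` and `V` are invertible, so `W` has a right and a left inverse, which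
  -- then agree.
  have hWiso : IsIso W := by
    have e1 : W ≫ V ≫ inv (W ≫ V) = 𝟙 M := by rw [← Category.assoc, IsIso.hom_inv_id]
    have e2 : (inv (V ≫ W) ≫ V) ≫ W = 𝟙 M' := by rw [Category.assoc, IsIso.inv_hom_id]
    have e3 : inv (V ≫ W) ≫ V = V ≫ inv (W ≫ V) := by
      calc inv (V ≫ W) ≫ V = (inv (V ≫ W) ≫ V) ≫ W ≫ V ≫ inv (W ≫ V) := by
            rw [e1, Category.comp_id]
        _ = ((inv (V ≫ W) ≫ V) ≫ W) ≫ V ≫ inv (W ≫ V) := by simp only [Category.assoc]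
        _ = V ≫ inv (W ≫ V) := by rw [e2, Category.id_comp]
    exact ⟨V ≫ inv (W ≫ V), e1, by rw [← e3, e2]⟩
  -- Modulo the radical the form entries of `W° W` are those of `c₀* φ c₀ = ψ`, which are also the
  -- form entries of the identity of `M'`.
  have hrad : IsRad (dag W ≫ dag (dag W) - 𝟙 M') := by
    refine IsFrame.isRad_of_dag_entries hp' fun t t' => ?_
    rw [← cls_eq_zero_iff hB, Dagger.dag_dag]
    have e1 : dag (p' t) ≫ (dag W ≫ W) ≫ p' t' =
        ∑ s, dag (c t s) ≫ (F (φ.coeff s)).hom ≫ c t' s := by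
      rw [Category.assoc, h'.hom_comp c t', ← Category.assoc, ← Dagger.dag_comp, h'.hom_comp c t,
        dag_sum, Preadditive.sum_comp]
      refine Finset.sum_congr rfl fun s _ => ?_
      rw [Preadditive.comp_sum, Finset.sum_eq_single s]
      · rw [Dagger.dag_comp, Category.assoc, ← Category.assoc (dag (p s)), h.herm]
      · intro s' _ hs'
        rw [Dagger.dag_comp, Category.assoc, ← Category.assoc (dag (p s)),
          h.herm_ne _ _ (Ne.symm hs')]
        simp
      · simp
    have e2 : cls (∑ s, dag (c t s) ≫ (F (φ.coeff s)).hom ≫ c t' s) = ψ.matrix t' t := by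
      rw [← heq, cls_sum, HermForm.matrix, Matrix.mul_apply]
      refine Finset.sum_congr rfl fun s _ => ?_
      rw [cls_comp, cls_comp, cls_dag, hc, hc, SelfAut.cls_hom, hF, Matrix.mul_diagonal,
        Matrix.conjTranspose_apply, Matrix.conjTranspose_apply, star_star]
    rw [Preadditive.sub_comp, Preadditive.comp_sub, e1, cls_sub, e2, Category.id_comp,
      h'.cls_herm hF, sub_self]
  have := isIso_dag W
  obtain ⟨f, hf⟩ := CatInv.exists_unitary (M'.isUnit_two hK) (dag W)
    (SelfRep.isNilpotent_of_isRad hrad)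
  exact ⟨dag f, hf.symm⟩

theorem HermForm.exists_isOrthDecomp (S : HalfObjects C) (F : B.HermUnit → SelfAut B)
    (φ : HermForm B) :
    ∃ w : ∀ s, (F (φ.coeff s)).twist S ⟶ φ.toSelfRep S F, IsOrthDecomp w :=
  ⟨_, isOrthDecomp_orthι fun s => (F (φ.coeff s)).twist S⟩

theorem HermForm.Equivalent.exists_unitary (hF : ∀ a, (F a).toT = a.1)
    (hK : ringChar K ≠ 2) (hB : B.rep.Indecomposable)
    (S : HalfObjects C) (he : φ.Equivalent ψ) :
    ∃ f : φ.toSelfRep S F ⟶ ψ.toSelfRep S F, IsUnitary f := by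
  have key : ∀ φ : HermForm B, ∃ (i : Fin φ.rank → (B ⟶ φ.toSelfRep S F))
      (p : Fin φ.rank → (φ.toSelfRep S F ⟶ B)), IsFrame F φ i p ∧
      ∑ s, p s ≫ i s = 𝟙 (φ.toSelfRep S F) := fun φ => by
    obtain ⟨w, hw⟩ := φ.exists_isOrthDecomp S F
    refine ⟨_, _, IsFrame.of_isometry S φ hw.comp_dag hw.comp_dag_ne, ?_⟩
    refine Eq.trans (Finset.sum_congr rfl fun s _ => ?_) hw.sum_dag
    rw [Category.assoc, IsIso.hom_inv_id_assoc]
  obtain ⟨i, p, h, hp⟩ := key φ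
  obtain ⟨i', p', h', hp'⟩ := key ψ
  exact h.exists_unitary hF hK hB h' hp hp' he

end Frame

end Adjoint

/-! ### Existence of the decomposition -/

open CatInv.Dagger (dag)

/-- Decomposes the second kind of summands further. The family `N'` is tied to the pieces by an
equation, so that it may be given by any expression that agrees with them case by case. -/
theorem IsOrthDecomp.exists_sumSigma {𝒟 : Type*} [Category 𝒟] [Preadditive 𝒟] [Dagger 𝒟]
    {ι κ : Type*} [Fintype ι] [Fintype κ] {M : 𝒟} {N : ι ⊕ κ → 𝒟} {w : ∀ l, N l ⟶ M}
    (hw : IsOrthDecomp w) {τ : κ → Type*} [∀ j, Fintype (τ j)] {L : ∀ j, τ j → 𝒟}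
    {v : ∀ j t, L j t ⟶ N (.inr j)} (hv : ∀ j, IsOrthDecomp (v j)) {N' : ι ⊕ (Σ j, τ j) → 𝒟}
    (hN' : N' = Sum.elim (fun i => N (.inl i)) (fun p => L p.1 p.2)) :
    ∃ w' : ∀ l, N' l ⟶ M, IsOrthDecomp w' := by
  subst hN'
  refine ⟨fun l => match l with
    | .inl i => w (.inl i)
    | .inr p => v p.1 p.2 ≫ w (.inr p.1), ?_, ?_, ?_⟩
  · rintro (i | p)
    · exact hw.comp_dag _
    · change (v p.1 p.2 ≫ w (.inr p.1)) ≫ dag (v p.1 p.2 ≫ w (.inr p.1)) = 𝟙 _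
      rw [Dagger.dag_comp, Category.assoc, ← Category.assoc (w _), hw.comp_dag, Category.id_comp]
      exact (hv p.1).comp_dag _
  · rintro (i | ⟨j, t⟩) (i' | ⟨j', t'⟩) h
    · exact hw.comp_dag_ne _ _ (by simpa using h)
    · change w (.inl i) ≫ dag (v j' t' ≫ w (.inr j')) = 0
      rw [Dagger.dag_comp, ← Category.assoc, hw.comp_dag_ne _ _ (by simp), Limits.zero_comp]
    · change (v j t ≫ w (.inr j)) ≫ dag (w (.inl i')) = 0
      rw [Category.assoc, hw.comp_dag_ne _ _ (by simp), Limits.comp_zero]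
    · change (v j t ≫ w (.inr j)) ≫ dag (v j' t' ≫ w (.inr j')) = 0
      rw [Dagger.dag_comp, Category.assoc, ← Category.assoc (w _)]
      by_cases hj : j = j'
      · subst hj
        rw [hw.comp_dag, Category.id_comp]
        exact (hv j).comp_dag_ne t t' (fun h' => h (by rw [h']))
      · rw [hw.comp_dag_ne _ _ (by simpa using hj)]; simp
  · rw [Fintype.sum_sum_type, ← hw.sum_dag, Fintype.sum_sum_type, Fintype.sum_sigma]
    congr 1
    refine Finset.sum_congr rfl fun j _ => ?_
    change ∑ t, dag (v j t ≫ w (.inr j)) ≫ v j t ≫ w (.inr j) = dag (w (.inr j)) ≫ w (.inr j)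
    simp only [Dagger.dag_comp, Category.assoc]
    simp only [← Category.assoc (dag (v _ _)), ← Preadditive.comp_sum, ← Preadditive.sum_comp,
      (hv j).sum_dag, Category.id_comp]

section Adjoint

variable {K : Type k} [DivisionRing K] [StarRing K] {C : Type u} [Category.{v} C] [Preadditive C]
  [Linear (Subring.center K) C] [Involution C] [LinearInvolution K C]

open Involution LRep SelfRep

variable {ind : Set (LRep K C)} {ind₀ : Set (SelfRep K C)} {ind₁ : Set (LRep K C)}

variable (ind₀ ind₁) in
/-- Labels of the summands `A⁺`, `A ∈ ind₁`, and `B^a`, `B ∈ ind₀`. -/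
abbrev Summand : Type _ := ind₁ ⊕ (Σ B : ind₀, B.1.HermUnit)

/-- The selfadjoint representation with a given label. -/
noncomputable def Summand.toSelfRep (S : HalfObjects C)
    (F : ∀ B : ind₀, B.1.HermUnit → SelfAut B.1) : Summand ind₀ ind₁ → SelfRep K C
  | .inl A => A.1.plus
  | .inr b => (F b.1 b.2).twist S

namespace SumData

/-- The index set of the summands `A_i⁺` and `B_j^a`, with `a` a coefficient of `φ_j`. -/
abbrev Index (D : SumData ind₀ ind₁) : Type := Fin D.m ⊕ (Σ j : Fin D.n, Fin (D.φ j).rank)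

/-- The labels of the summands. -/
def summand (D : SumData ind₀ ind₁) : D.Index → Summand ind₀ ind₁
  | .inl t => .inl (D.A t)
  | .inr p => .inr ⟨D.B p.1, (D.φ p.1).coeff p.2⟩

variable (S : HalfObjects C) (F : ∀ B : ind₀, B.1.HermUnit → SelfAut B.1)

theorem exists_isOrthDecomp_index (D : SumData ind₀ ind₁) :
    ∃ w : ∀ l, Summand.toSelfRep S F (D.summand l) ⟶ D.toSelfRep S F, IsOrthDecomp w := by
  choose v hv using fun j => (D.φ j).exists_isOrthDecomp S (F (D.B j))
  have hw : IsOrthDecomp (M := D.toSelfRep S F) (orthι _) := isOrthDecomp_orthι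
    (Sum.elim (fun i : Fin D.m => (D.A i).1.plus)
      (fun j : Fin D.n => (D.φ j).toSelfRep S (F (D.B j))))
  refine hw.exists_sumSigma (v := v) hv (funext ?_)
  rintro (t | p) <;> rfl

/-- Every finite family of summands can be grouped. -/
theorem exists_index_equiv {ι : Type} [Fintype ι] (Z : ι → Summand ind₀ ind₁) :
    ∃ (D : SumData ind₀ ind₁) (E : D.Index ≃ ι), ∀ l, D.summand l = Z (E l) := by
  classical
  let ι₁ := {i // ∃ A, Z i = .inl A}
  let ι₂ := {i // ∃ b, Z i = .inr b}
  choose A hA using fun i : ι₁ => i.2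
  choose b hb using fun i : ι₂ => i.2
  let R := Set.range fun i : ι₂ => (b i).1
  let κ : R → Type := fun r => {i : ι₂ // (b i).1 = r.1}
  let e₁ : Fin (Fintype.card ι₁) ≃ ι₁ := (Fintype.equivFin ι₁).symm
  let e₂ : Fin (Fintype.card R) ≃ R := (Fintype.equivFin R).symm
  let e₃ : ∀ r, Fin (Fintype.card (κ r)) ≃ κ r := fun r => (Fintype.equivFin (κ r)).symm
  have hpos : ∀ r, 0 < Fintype.card (κ r) := by
    rintro ⟨_, i, rfl⟩
    exact Fintype.card_pos_iff.2 ⟨⟨i, rfl⟩⟩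
  -- The coefficient attached to `s` lives over the representation of its own label, so it is
  -- transported along the equality with the label of the group.
  let coeff : ∀ r (s : κ r), r.1.1.HermUnit := fun r s => s.2 ▸ (b s.1).2
  have hcoeff : ∀ r (s : κ r), (⟨r.1, coeff r s⟩ : Σ B : ind₀, B.1.HermUnit) = b s.1 := by
    rintro ⟨r, hr⟩ ⟨i, hi⟩
    dsimp only at hi
    subst hi
    rfl
  let D : SumData ind₀ ind₁ :=
    { m := Fintype.card ι₁
      n := Fintype.card R
      A := fun t => A (e₁ t)
      B := fun j => (e₂ j).1
      B_injective := Subtype.val_injective.comp e₂.injective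
      φ := fun j => ⟨Fintype.card (κ (e₂ j)), hpos _, fun s => coeff _ (e₃ _ s)⟩ }
  let E : D.Index → ι := Sum.elim (fun t => (e₁ t).1) (fun p => (e₃ (e₂ p.1) p.2).1.1)
  have hE : ∀ l, D.summand l = Z (E l) := by
    rintro (t | p)
    · exact (hA (e₁ t)).symm
    · exact (congrArg Sum.inr (hcoeff _ _)).trans (hb (e₃ (e₂ p.1) p.2).1).symm
  have hbij : Function.Bijective E := by
    constructor
    · rintro (t | ⟨j, s⟩) (t' | ⟨j', s'⟩) h
      · exact congrArg Sum.inl (e₁.injective (Subtype.ext h))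
      · exfalso
        have h1 := (hE (.inl t)).trans ((congrArg Z h).trans (hE (.inr ⟨j', s'⟩)).symm)
        exact Sum.inl_ne_inr h1
      · exfalso
        have h1 := (hE (.inl t')).trans ((congrArg Z h.symm).trans (hE (.inr ⟨j, s⟩)).symm)
        exact Sum.inl_ne_inr h1
      · have h1 : (e₃ (e₂ j) s).1 = (e₃ (e₂ j') s').1 := Subtype.ext h
        have h2 : j = j' := by
          apply e₂.injective
          apply Subtype.ext
          rw [← (e₃ (e₂ j) s).2, ← (e₃ (e₂ j') s').2, h1]
        subst h2
        have h3 : s = s' := (e₃ (e₂ j)).injective (Subtype.ext h1)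
        rw [h3]
    · intro i
      rcases hZ : Z i with A' | b'
      · obtain ⟨t, ht⟩ := e₁.surjective ⟨i, A', hZ⟩
        exact ⟨.inl t, congrArg Subtype.val ht⟩
      · let i' : ι₂ := ⟨i, b', hZ⟩
        obtain ⟨j, hj⟩ := e₂.surjective ⟨(b i').1, i', rfl⟩
        obtain ⟨s, hs⟩ := (e₃ (e₂ j)).surjective ⟨i', by rw [hj]⟩
        exact ⟨.inr ⟨j, s⟩, congrArg (fun z => z.1.1) hs⟩
  exact ⟨D, Equiv.ofBijective E hbij, hE⟩

end SumData

variable (S : HalfObjects C)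
  {F : ∀ B : ind₀, B.1.HermUnit → SelfAut B.1}

theorem IsIndSystem.indecomposable₀ (hind : IsIndSystem ind ind₀ ind₁)
    {B : SelfRep K C} (hB : B ∈ ind₀) : B.rep.Indecomposable := by
  obtain ⟨A, hA, ⟨s⟩⟩ := hind.ind₀_iso B hB
  exact (hind.indecomposable A hA).of_iso s

theorem IsIndSystem.indecomposable₁ (hind : IsIndSystem ind ind₀ ind₁)
    {A : LRep K C} (hA : A ∈ ind₁) : A.Indecomposable :=
  hind.indecomposable A (hind.ind₁_subset hA)

/-- Either `X` or its adjoint is represented in `ind₁`, and both have the same hyperbolic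
representation up to congruence. -/
theorem IsIndSystem.exists_plus (hind : IsIndSystem ind ind₀ ind₁)
    {X : LRep K C} (hX : X.Indecomposable)
    (hs : ¬ X.IsoToSelfadjoint) : ∃ (A : ind₁) (f : A.1.plus ⟶ X.plus), IsUnitary f := by
  obtain ⟨A, hA, ⟨s⟩⟩ := hind.complete X hX
  have hsA : ¬ A.IsoToSelfadjoint := fun ⟨M, ⟨t⟩⟩ => hs ⟨M, ⟨s ≪≫ t⟩⟩
  by_cases h : Nonempty (A ≅ A.adj)
  · obtain ⟨f, hf⟩ := exists_unitary_plus s.symm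
    exact ⟨⟨A, hind.ind₁_self A hA h hsA⟩, f, hf⟩
  · obtain ⟨B, hB, ⟨t⟩⟩ := hind.complete A.adj (hind.indecomposable A hA).adj
    obtain ⟨t'⟩ := nonempty_iso_adj t
    rcases hind.ind₁_pair A hA B hB h ⟨t'⟩ with ⟨h1, -⟩ | ⟨h1, -⟩
    · obtain ⟨f, hf⟩ := exists_unitary_plus s.symm
      exact ⟨⟨A, h1⟩, f, hf⟩
    · obtain ⟨f, hf⟩ := exists_unitary_plus_of_iso_adj (s ≪≫ t')
      exact ⟨⟨B, h1⟩, dag f, hf.symm⟩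

/-- Normalizes the summand from the splitting dichotomy to one of the listed ones. It is nonzero, so
the dimension of the orthogonal complement drops. -/
theorem exists_summand (hK : ringChar K ≠ 2)
    (hind : IsIndSystem ind ind₀ ind₁) (hF : ∀ B a, (F B a).toT = a.1) (M : SelfRep K C)
    (hM : ¬ M.rep.IsZero) :
    ∃ (z : Summand ind₀ ind₁) (w : z.toSelfRep S F ⟶ M), w ≫ dag w = 𝟙 _ ∧
      ¬ (z.toSelfRep S F).rep.IsZero := by
  have comp : ∀ {N N' : SelfRep K C} {f : N' ⟶ N} {w : N ⟶ M}, IsUnitary f → w ≫ dag w = 𝟙 N →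
      (f ≫ w) ≫ dag (f ≫ w) = 𝟙 N' := by
    intro N N' f w hf hw
    rw [Dagger.dag_comp, Category.assoc, ← Category.assoc w, hw, Category.id_comp, hf.1]
  have hzero : ∀ {N N' : SelfRep K C} {f : N' ⟶ N}, IsUnitary f → ¬ N.rep.IsZero →
      ¬ N'.rep.IsZero := by
    intro N N' f hf hN h
    rw [isZero_iff] at h hN
    apply hN
    have h' : 𝟙 N' = 0 := h
    have : 𝟙 N = 0 := by
      rw [← hf.2, ← Category.id_comp f, h']; simp
    exact this
  rcases M.exists_isometry hK hM with ⟨N, w, hN, hw⟩ | ⟨X, w, hX, hs, hw⟩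
  · obtain ⟨A, hA, ⟨s⟩⟩ := hind.complete N.rep hN
    obtain ⟨B, ⟨hB, ⟨t⟩⟩, -⟩ := hind.ind₀_unique A hA ⟨N, ⟨s.symm⟩⟩
    have : IsIso (ofRep (M := B) (N := N) (t.inv ≫ s.inv)) :=
      isIso_of_rep (s ≪≫ t).symm.isIso_hom
    obtain ⟨a, f, hf⟩ := exists_unitary_twist hK (hind.indecomposable₀ hB)
      (ofRep (M := B) (N := N) (t.inv ≫ s.inv)) S (F ⟨B, hB⟩) (hF ⟨B, hB⟩)
    exact ⟨.inr ⟨⟨B, hB⟩, a⟩, f ≫ w, comp hf hw, hzero hf hN.1⟩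
  · obtain ⟨A, f, hf⟩ := hind.exists_plus hX hs
    refine ⟨.inl A, f ≫ w, comp hf hw, fun h => (hind.indecomposable₁ A.2).1 fun x => ?_⟩
    have h' : Subsingleton (A.1.obj x × A.1.adj.obj x) := h x
    exact (Prod.mk_left_injective (0 : A.1.adj.obj x)).subsingleton

theorem exists_isOrthDecomp (hK : ringChar K ≠ 2)
    (hind : IsIndSystem ind ind₀ ind₁) (hF : ∀ B a, (F B a).toT = a.1) (M : SelfRep K C) :
    ∃ (ι : Type) (_ : Fintype ι) (Z : ι → Summand ind₀ ind₁)
      (w : ∀ i, (Z i).toSelfRep S F ⟶ M), IsOrthDecomp w := by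
  induction hn : M.rep.dim using Nat.strong_induction_on generalizing M with
  | _ n ih =>
    by_cases hM : M.rep.IsZero
    · refine ⟨Empty, inferInstance, Empty.elim, fun i => i.elim, fun i => i.elim,
        fun i => i.elim, ?_⟩
      rw [Fintype.sum_empty]
      exact (isZero_iff.1 hM).symm
    · obtain ⟨z, w, hw, hz⟩ := exists_summand S hK hind hF M hM
      obtain ⟨M', v, hv, hsum⟩ := exists_complement w hw
      -- If the complement were all of `M`, then `w° w = 0`, hence `1 = (w w°)² = 0` on a nonzero
      -- summand.
      have hlt : M'.rep.dim < M.rep.dim := dim_lt (i := toRep v) (p := toRep (dag v)) hv fun h => by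
        apply hz
        rw [isZero_iff]
        have h' : dag v ≫ v = 𝟙 M := h
        rw [h', add_eq_right] at hsum
        have : 𝟙 (z.toSelfRep S F) = 0 :=
          calc 𝟙 (z.toSelfRep S F) = (w ≫ dag w) ≫ w ≫ dag w := by rw [hw, Category.comp_id]
            _ = w ≫ (dag w ≫ w) ≫ dag w := by simp only [Category.assoc]
            _ = 0 := by rw [hsum]; simp
        exact this
      obtain ⟨ι, _, Z, u, hu⟩ := ih _ (hn ▸ hlt) M' rfl
      refine ⟨Option ι, inferInstance, fun o => o.elim z Z,
        fun o => match o with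
          | none => w
          | some i => u i ≫ v, ?_⟩
      exact IsOrthDecomp.option (v := u) hu hw hv hsum fun i => rfl

theorem exists_sumData (hK : ringChar K ≠ 2)
    (hind : IsIndSystem ind ind₀ ind₁) (hF : ∀ B a, (F B a).toT = a.1) (M : SelfRep K C) :
    ∃ D : SumData ind₀ ind₁, M.Congruent (D.toSelfRep S F) := by
  obtain ⟨ι, _, Z, w, hw⟩ := exists_isOrthDecomp S hK hind hF M
  obtain ⟨D, E, hE⟩ := SumData.exists_index_equiv Z
  obtain ⟨u, hu⟩ := D.exists_isOrthDecomp_index S F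
  -- The source family is generalized because the labels agree only up to a propositional equality
  -- on which the type of `w'` depends.
  have h : ∀ N : D.Index → SelfRep K C, (N = fun l => (Z (E l)).toSelfRep S F) →
      ∃ w' : ∀ l, N l ⟶ M, IsOrthDecomp w' := by
    rintro _ rfl
    exact ⟨_, hw.reindex E⟩
  obtain ⟨w', hw'⟩ := h (fun l => Summand.toSelfRep S F (D.summand l)) (funext fun l => by rw [hE])
  exact ⟨D, congruent_iff.2 (hw'.exists_unitary hu)⟩

end Adjoint

/-! ### Uniqueness of the decomposition -/

open CatInv.Dagger (dag)

section Adjoint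

variable {K : Type k} [DivisionRing K] [StarRing K] {C : Type u} [Category.{v} C] [Preadditive C]
  [Linear (Subring.center K) C] [Involution C] [LinearInvolution K C]

open Involution LRep SelfRep

variable {ind : Set (LRep K C)} {ind₀ : Set (SelfRep K C)} {ind₁ : Set (LRep K C)}

namespace SumData

/-- The index set of the indecomposable direct summands. -/
abbrev PieceIndex (D : SumData ind₀ ind₁) : Type :=
  (Fin D.m ⊕ Fin D.m) ⊕ (Σ j : Fin D.n, Fin (D.φ j).rank)

/-- The indecomposable direct summands, up to isomorphism. -/
def piece (D : SumData ind₀ ind₁) : D.PieceIndex → LRep K C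
  | .inl (.inl t) => (D.A t).1
  | .inl (.inr t) => (D.A t).1.adj
  | .inr p => (D.B p.1).1.rep

variable {S : HalfObjects C} {F : ∀ B : ind₀, B.1.HermUnit → SelfAut B.1}
  {D : SumData ind₀ ind₁} {M : SelfRep K C}

/-- The inclusion of the hyperbolic summand `A_t⁺`. -/
def plusι (w : ∀ l, Summand.toSelfRep S F (D.summand l) ⟶ M) (t : Fin D.m) :
    (D.A t).1.plus ⟶ M := w (.inl t)

/-- The inclusion of the summand `B_j^a`. -/
def twistι (w : ∀ l, Summand.toSelfRep S F (D.summand l) ⟶ M)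
    (p : Σ j : Fin D.n, Fin (D.φ j).rank) :
    (F (D.B p.1) ((D.φ p.1).coeff p.2)).twist S ⟶ M := w (.inr p)

/-- The inclusions of the indecomposable summands. -/
noncomputable def pieceι (w : ∀ l, Summand.toSelfRep S F (D.summand l) ⟶ M) :
    ∀ l, D.piece l ⟶ M.rep
  | .inl (.inl t) => inl (D.A t).1 (D.A t).1.adj ≫ toRep (plusι w t)
  | .inl (.inr t) => inr (D.A t).1 (D.A t).1.adj ≫ toRep (plusι w t)
  | .inr p => toRep (inv ((F (D.B p.1) ((D.φ p.1).coeff p.2)).twistHom S) ≫ twistι w p)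

/-- The projections to the indecomposable summands. -/
noncomputable def pieceπ (w : ∀ l, Summand.toSelfRep S F (D.summand l) ⟶ M) :
    ∀ l, M.rep ⟶ D.piece l
  | .inl (.inl t) => toRep (dag (plusι w t)) ≫ fst (D.A t).1 (D.A t).1.adj
  | .inl (.inr t) => toRep (dag (plusι w t)) ≫ snd (D.A t).1 (D.A t).1.adj
  | .inr p => toRep (dag (twistι w p) ≫ (F (D.B p.1) ((D.φ p.1).coeff p.2)).twistHom S)

/-- Forgetting the forms: each `A_t⁺` breaks into `A_t` and `A_t°`, each `B_j^a` becomes a copy of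
`B_j`. Multiplicities can then be counted among plain representations. -/
theorem isDecomp {w : ∀ l, Summand.toSelfRep S F (D.summand l) ⟶ M} (hw : IsOrthDecomp w) :
    IsDecomp (pieceι w) (pieceπ w) := by
  have pp : ∀ t, plusι w t ≫ dag (plusι w t) = 𝟙 _ := fun t => hw.comp_dag (.inl t)
  have tt : ∀ p, twistι w p ≫ dag (twistι w p) = 𝟙 _ := fun p => hw.comp_dag (.inr p)
  have pp' : ∀ t t', t ≠ t' → plusι w t ≫ dag (plusι w t') = 0 := fun t t' h =>
    hw.comp_dag_ne (.inl t) (.inl t') (by simpa using h)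
  have tt' : ∀ p p', p ≠ p' → twistι w p ≫ dag (twistι w p') = 0 := fun p p' h =>
    hw.comp_dag_ne (.inr p) (.inr p') (by simpa using h)
  have pt : ∀ t p, plusι w t ≫ dag (twistι w p) = 0 := fun t p =>
    hw.comp_dag_ne (.inl t) (.inr p) (by simp)
  have tp : ∀ p t, twistι w p ≫ dag (plusι w t) = 0 := fun p t =>
    hw.comp_dag_ne (.inr p) (.inl t) (by simp)
  have hpp : ∀ (X Y : LRep K C) t t' (f : X ⟶ (D.A t).1.plus.rep) (g : (D.A t').1.plus.rep ⟶ Y),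
      t ≠ t' → (f ≫ toRep (plusι w t)) ≫ toRep (dag (plusι w t')) ≫ g = 0 := by
    intro X Y t t' f g h
    refine Eq.trans (congrArg (fun z : (D.A t).1.plus.rep ⟶ (D.A t').1.plus.rep => f ≫ z ≫ g)
      (pp' t t' h)) ?_
    exact (congrArg (f ≫ ·) Limits.zero_comp).trans Limits.comp_zero
  have hpp1 : ∀ (X Y : LRep K C) t (f : X ⟶ (D.A t).1.plus.rep) (g : (D.A t).1.plus.rep ⟶ Y),
      (f ≫ toRep (plusι w t)) ≫ toRep (dag (plusι w t)) ≫ g = f ≫ g := by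
    intro X Y t f g
    exact congrArg (fun z : (D.A t).1.plus.rep ⟶ (D.A t).1.plus.rep => f ≫ z ≫ g) (pp t)
  refine ⟨?_, ?_, ?_⟩
  · rintro ((t | t) | p)
    · exact hpp1 _ _ t _ _
    · exact hpp1 _ _ t _ _
    · change (inv ((F (D.B p.1) ((D.φ p.1).coeff p.2)).twistHom S) ≫ twistι w p) ≫
        dag (twistι w p) ≫ (F (D.B p.1) ((D.φ p.1).coeff p.2)).twistHom S = 𝟙 (D.B p.1).1
      rw [Category.assoc, ← Category.assoc (twistι w p), tt]
      simp
  · have hpt : ∀ (X : LRep K C) t p (f : X ⟶ (D.A t).1.plus.rep),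
        (f ≫ toRep (plusι w t)) ≫ pieceπ w (.inr p) = 0 := by
      intro X t p f
      refine Eq.trans (congrArg (fun z => f ≫ z ≫
        toRep ((F (D.B p.1) ((D.φ p.1).coeff p.2)).twistHom S)) (pt t p)) ?_
      exact (congrArg (f ≫ ·) Limits.zero_comp).trans Limits.comp_zero
    have htp : ∀ (Y : LRep K C) t p (g : (D.A t).1.plus.rep ⟶ Y),
        pieceι w (.inr p) ≫ toRep (dag (plusι w t)) ≫ g = 0 := by
      intro Y t p g
      refine Eq.trans (congrArg (fun z : (D.B p.1).1 ⟶ (D.A t).1.plus => toRep z ≫ g)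
        (show (inv ((F (D.B p.1) ((D.φ p.1).coeff p.2)).twistHom S) ≫ twistι w p) ≫
          dag (plusι w t) = 0 by rw [Category.assoc, tp, Limits.comp_zero])) ?_
      exact Limits.zero_comp
    rintro ((t | t) | p) ((t' | t') | p') h
    · exact hpp _ _ t t' _ _ (by simpa using h)
    · by_cases ht : t = t'
      · subst ht
        exact (hpp1 _ _ t _ _).trans (inl_snd _ _)
      · exact hpp _ _ t t' _ _ ht
    · exact hpt _ t p' _
    · by_cases ht : t = t'
      · subst ht
        exact (hpp1 _ _ t _ _).trans (inr_fst _ _)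
      · exact hpp _ _ t t' _ _ ht
    · exact hpp _ _ t t' _ _ (by simpa using h)
    · exact hpt _ t p' _
    · exact htp _ t' p _
    · exact htp _ t' p _
    · change (inv ((F (D.B p.1) ((D.φ p.1).coeff p.2)).twistHom S) ≫ twistι w p) ≫
        dag (twistι w p') ≫ (F (D.B p'.1) ((D.φ p'.1).coeff p'.2)).twistHom S = 0
      rw [Category.assoc, ← Category.assoc (twistι w p), tt' p p' (by simpa using h)]
      simp
  · rw [Fintype.sum_sum_type, Fintype.sum_sum_type]
    have hsum : ∑ t, dag (plusι w t) ≫ plusι w t + ∑ p, dag (twistι w p) ≫ twistι w p = 𝟙 M :=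
      (Fintype.sum_sum_type _).symm.trans hw.sum_dag
    refine Eq.trans ?_ hsum
    change _ = ∑ t, toRep (dag (plusι w t) ≫ plusι w t) +
      ∑ p, toRep (dag (twistι w p) ≫ twistι w p)
    rw [← Finset.sum_add_distrib]
    congr 1
    · refine Finset.sum_congr rfl fun t _ => ?_
      have h := congrArg (fun z : (D.A t).1.plus.rep ⟶ (D.A t).1.plus.rep =>
        toRep (dag (plusι w t)) ≫ z ≫ toRep (plusι w t)) (sum_total (D.A t).1 (D.A t).1.adj)
      refine Eq.trans ?_ h
      refine Eq.symm (Eq.trans (congrArg (toRep (dag (plusι w t)) ≫ ·)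
        (Preadditive.add_comp (C := LRep K C) _ _ _ _ _ _)) ?_)
      exact Preadditive.comp_add (C := LRep K C) _ _ _ _ _ _
    · refine Finset.sum_congr rfl fun p _ => ?_
      change (dag (twistι w p) ≫ (F (D.B p.1) ((D.φ p.1).coeff p.2)).twistHom S) ≫
        inv ((F (D.B p.1) ((D.φ p.1).coeff p.2)).twistHom S) ≫ twistι w p =
          dag (twistι w p) ≫ twistι w p
      rw [Category.assoc, IsIso.hom_inv_id_assoc]

end SumData

variable {S : HalfObjects C}
  {F : ∀ B : ind₀, B.1.HermUnit → SelfAut B.1}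

theorem IsIndSystem.eq_of_iso₁
    (hind : IsIndSystem ind ind₀ ind₁) {A B : ind₁} (s : A.1 ≅ B.1) : A = B :=
  Subtype.ext (hind.eq_of_iso _ (hind.ind₁_subset A.2) _ (hind.ind₁_subset B.2) ⟨s⟩)

theorem IsIndSystem.eq_of_iso₀
    (hind : IsIndSystem ind ind₀ ind₁) {B B' : ind₀} (s : B.1.rep ≅ B'.1.rep) : B = B' := by
  obtain ⟨A, hA, ⟨t⟩⟩ := hind.ind₀_iso B.1 B.2
  exact Subtype.ext ((hind.ind₀_unique A hA ⟨B.1, ⟨t⟩⟩).unique ⟨B.2, ⟨t⟩⟩ ⟨B'.2, ⟨t ≪≫ s⟩⟩)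

theorem IsIndSystem.not_iso₁₀
    (hind : IsIndSystem ind ind₀ ind₁) (A : ind₁) (B : SelfRep K C) : IsEmpty (A.1 ≅ B.rep) :=
  ⟨fun s => hind.ind₁_not A.1 A.2 ⟨B, ⟨s⟩⟩⟩

/-- `A° ≅ B` would give `A ≅ B° ≅ B`, so neither half of a hyperbolic summand contributes to a
multiplicity of some `B ∈ ind₀`. -/
theorem IsIndSystem.not_iso_adj
    (hind : IsIndSystem ind ind₀ ind₁) (A : ind₁) (B : SelfRep K C) : IsEmpty (A.1.adj ≅ B.rep) :=
  ⟨fun s => (nonempty_iso_adj s).elim fun t => (hind.not_iso₁₀ A B).false (t ≪≫ B.iso.symm)⟩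

namespace SumData

variable (D : SumData ind₀ ind₁) {M : SelfRep K C}

theorem indecomposable_piece
    (hind : IsIndSystem ind ind₀ ind₁) (l : D.PieceIndex) : (D.piece l).Indecomposable := by
  rcases l with (t | t) | p
  · exact hind.indecomposable₁ (D.A t).2
  · exact (hind.indecomposable₁ (D.A t).2).adj
  · exact hind.indecomposable₀ (D.B p.1).2

-- If `A ≅ A°`, both halves of each `A_t⁺` with `A_t = A` count, otherwise only one. No other piece
-- is isomorphic to `A`.
open Classical in
theorem exists_isIsotypic₁
    (hind : IsIndSystem ind ind₀ ind₁) {w : ∀ l, Summand.toSelfRep S F (D.summand l) ⟶ M}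
    (hw : IsOrthDecomp w) (A : ind₁) :
    ∃ (κ : Type) (_ : Fintype κ) (i : κ → (A.1 ⟶ M.rep)) (p : κ → (M.rep ⟶ A.1)),
      IsIsotypic i p ∧ Fintype.card κ =
        (if Nonempty (A.1 ≅ A.1.adj) then 2 else 1) * Fintype.card {t // D.A t = A} := by
  have hd := isDecomp hw
  have hA := hind.indecomposable₁ A.2
  have hY := D.indecomposable_piece hind
  by_cases h : Nonempty (A.1 ≅ A.1.adj)
  · obtain ⟨a⟩ := h
    let j : {t // D.A t = A} ⊕ {t // D.A t = A} → D.PieceIndex :=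
      fun x => .inl (Sum.map Subtype.val Subtype.val x)
    have hj : Function.Injective j :=
      Sum.inl_injective.comp (Subtype.val_injective.sumMap Subtype.val_injective)
    have θ : ∀ x, D.piece (j x) ≅ A.1 := by
      rintro (⟨t, ht⟩ | ⟨t, ht⟩)
      · exact eqToIso (congrArg Subtype.val ht)
      · exact eqToIso (congrArg (fun z : ind₁ => z.1.adj) ht) ≪≫ a.symm
    refine ⟨_, inferInstance, _, _, hd.isIsotypic hA hY j hj θ ?_, ?_⟩
    · rintro ((t | t) | p) hl
      · exact ⟨fun s => hl ⟨.inl ⟨t, hind.eq_of_iso₁ s⟩, rfl⟩⟩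
      · refine ⟨fun s => ?_⟩
        obtain ⟨s'⟩ := nonempty_iso_adj s
        exact hl ⟨.inr ⟨t, hind.eq_of_iso₁ (s' ≪≫ a.symm)⟩, rfl⟩
      · exact ⟨fun s => (hind.not_iso₁₀ A (D.B p.1).1).false s.symm⟩
    · rw [if_pos ⟨a⟩, Fintype.card_sum, two_mul]
  · let j : {t // D.A t = A} → D.PieceIndex := fun x => .inl (.inl x.1)
    have hj : Function.Injective j :=
      Sum.inl_injective.comp (Sum.inl_injective.comp Subtype.val_injective)
    have θ : ∀ x, D.piece (j x) ≅ A.1 := fun x => eqToIso (congrArg Subtype.val x.2)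
    refine ⟨_, inferInstance, _, _, hd.isIsotypic hA hY j hj θ ?_, ?_⟩
    · rintro ((t | t) | p) hl
      · exact ⟨fun s => hl ⟨⟨t, hind.eq_of_iso₁ s⟩, rfl⟩⟩
      · refine ⟨fun s => ?_⟩
        -- Here `A` would be isomorphic to the adjoint of another member of `ind₁`, but `ind₁`
        -- contains only one member of such a pair.
        rcases hind.ind₁_pair A.1 (hind.ind₁_subset A.2) (D.A t).1 (hind.ind₁_subset (D.A t).2)
          h ⟨s.symm⟩ with ⟨-, h'⟩ | ⟨-, h'⟩
        · exact h' (D.A t).2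
        · exact h' A.2
      · exact ⟨fun s => (hind.not_iso₁₀ A (D.B p.1).1).false s.symm⟩
    · rw [if_neg h, one_mul]

/-- The `B_j` are pairwise distinct, so the copies of `B` come from a single form, and they carry
both its frame and the full multiplicity of `B`. The equations `hj`, `hφ` allow the form to be
stated over a representation named by the other decomposition. -/
theorem exists_frame
    (hind : IsIndSystem ind ind₀ ind₁) {w : ∀ l, Summand.toSelfRep S F (D.summand l) ⟶ M}
    (hw : IsOrthDecomp w)
    {B : ind₀} {j : Fin D.n} (hj : D.B j = B) {φ : HermForm B.1} (hφ : hj ▸ D.φ j = φ) :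
    ∃ (i : Fin φ.rank → (B.1 ⟶ M)) (p : Fin φ.rank → (M ⟶ B.1)), IsFrame (F B) φ i p ∧
      IsIsotypic (fun s => toRep (i s)) (fun s => toRep (p s)) := by
  subst hj
  subst hφ
  have hd := isDecomp hw
  let e : Fin (D.φ j).rank → D.PieceIndex := fun s => .inr ⟨j, s⟩
  have he : Function.Injective e := Sum.inr_injective.comp sigma_mk_injective
  have hne : ∀ l, l ∉ Set.range e → IsEmpty (D.piece l ≅ (D.B j).1.rep) := by
    rintro ((t | t) | ⟨j', s⟩) hl
    · exact hind.not_iso₁₀ _ _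
    · exact hind.not_iso_adj _ _
    · refine ⟨fun s' => hl ?_⟩
      have : j' = j := D.B_injective (hind.eq_of_iso₀ s')
      subst this
      exact ⟨s, rfl⟩
  have I := hd.isIsotypic (hind.indecomposable₀ (D.B j).2) (D.indecomposable_piece hind) e he
    (fun s => Iso.refl (D.piece (e s))) hne
  have hfr := IsFrame.of_isometry (F := F (D.B j)) S (D.φ j) (w := fun s => twistι w ⟨j, s⟩)
    (fun s => hw.comp_dag (.inr ⟨j, s⟩))
    (fun s t h => hw.comp_dag_ne (.inr ⟨j, s⟩) (.inr ⟨j, t⟩) (by simpa using h))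
  have hsum : ∑ s, (pieceπ w (e s) ≫ 𝟙 (D.piece (e s))) ≫ 𝟙 (D.piece (e s)) ≫ pieceι w (e s) =
      ∑ s, pieceπ w (e s) ≫ pieceι w (e s) :=
    Finset.sum_congr rfl fun s _ => by rw [Category.comp_id, Category.id_comp]
  have hrest : ∀ f g, IsRad (f ≫ (𝟙 M.rep - ∑ s, pieceπ w (e s) ≫ pieceι w (e s)) ≫ g) :=
    fun f g => hsum ▸ I.rest f g
  exact ⟨_, _, hfr, ⟨hfr.comp_self, hfr.comp_ne, hrest⟩⟩

theorem isIsotypic_empty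
    (hind : IsIndSystem ind ind₀ ind₁) {w : ∀ l, Summand.toSelfRep S F (D.summand l) ⟶ M}
    (hw : IsOrthDecomp w) {B : ind₀} (hB : B ∉ Set.range D.B) :
    IsIsotypic (B := B.1.rep) (A := M.rep) (fun x : Empty => x.elim) (fun x : Empty => x.elim) := by
  have hd := isDecomp hw
  have I := hd.isIsotypic (hind.indecomposable₀ B.2) (D.indecomposable_piece hind)
    (fun x : Empty => x.elim) (fun x => x.elim) (fun x => x.elim) (by
      rintro ((t | t) | p) _
      · exact hind.not_iso₁₀ _ _
      · exact hind.not_iso_adj _ _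
      · exact ⟨fun s => hB ⟨p.1, hind.eq_of_iso₀ s⟩⟩)
  exact ⟨fun k => k.elim, fun k => k.elim, fun f g => by
    simpa only [Finset.univ_eq_empty, Finset.sum_empty] using I.rest f g⟩

variable {D} {D' : SumData ind₀ ind₁}

/-- A `B_j` missing on the right would have multiplicity 0 there but positive rank on the left; this
is where `r ≥ 1` matters. -/
theorem range_subset
    (hind : IsIndSystem ind ind₀ ind₁) (e : (D.toSelfRep S F).rep ≅ (D'.toSelfRep S F).rep) :
    Set.range D.B ⊆ Set.range D'.B := by
  rintro _ ⟨j, rfl⟩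
  by_contra hj
  obtain ⟨w, hw⟩ := D.exists_isOrthDecomp_index S F
  obtain ⟨w', hw'⟩ := D'.exists_isOrthDecomp_index S F
  obtain ⟨i, p, -, I⟩ := D.exists_frame hind hw (j := j) rfl rfl
  have h := I.card_eq (hind.indecomposable₀ (D.B j).2) (D'.isIsotypic_empty hind hw' hj) e
  rw [Fintype.card_fin, Fintype.card_empty] at h
  exact (D.φ j).rank_pos.ne' h

theorem equivalent_of_unitary
    (hind : IsIndSystem ind ind₀ ind₁) (hF : ∀ B a, (F B a).toT = a.1)
    {W : D.toSelfRep S F ⟶ D'.toSelfRep S F} (hW : IsUnitary W) : D.Equivalent D' := by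
  classical
  obtain ⟨w, hw⟩ := D.exists_isOrthDecomp_index S F
  obtain ⟨w', hw'⟩ := D'.exists_isOrthDecomp_index S F
  let e : (D.toSelfRep S F).rep ≅ (D'.toSelfRep S F).rep := ⟨toRep W, toRep (dag W), hW.1, hW.2⟩
  constructor
  · have hcard : ∀ A : ind₁, Fintype.card {t // D.A t = A} = Fintype.card {t // D'.A t = A} := by
      intro A
      obtain ⟨κ, _, i, p, I, hc⟩ := D.exists_isIsotypic₁ hind hw A
      obtain ⟨κ', _, i', p', I', hc'⟩ := D'.exists_isIsotypic₁ hind hw' A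
      have h := I.card_eq (hind.indecomposable₁ A.2) I' e
      rw [hc, hc'] at h
      -- The factor 1 or 2 depends on `A` alone and cancels.
      refine Nat.eq_of_mul_eq_mul_left ?_ h
      split_ifs <;> norm_num
    let σ : Fin D.m ≃ Fin D'.m := (Equiv.sigmaFiberEquiv D.A).symm.trans
      ((Equiv.sigmaCongrRight fun A => Fintype.equivOfCardEq (hcard A)).trans
        (Equiv.sigmaFiberEquiv D'.A))
    exact ⟨σ, fun t => ((Fintype.equivOfCardEq (hcard (D.A t))) ⟨t, rfl⟩).2.symm⟩
  · have hrange : Set.range D.B = Set.range D'.B :=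
      (range_subset hind e).antisymm (range_subset hind e.symm)
    let τ : Fin D.n ≃ Fin D'.n := (Equiv.ofInjective _ D.B_injective).trans
      ((Equiv.setCongr hrange).trans (Equiv.ofInjective _ D'.B_injective).symm)
    refine ⟨τ, fun j => ?_⟩
    have hj : D.B j = D'.B (τ j) := (Equiv.apply_ofInjective_symm D'.B_injective
      ((Equiv.setCongr hrange) (Equiv.ofInjective _ D.B_injective j))).symm
    refine ⟨hj, ?_⟩
    obtain ⟨i, p, h, I⟩ := D.exists_frame hind hw hj rfl
    obtain ⟨i', p', h', I'⟩ := D'.exists_frame hind hw' (j := τ j) rfl rfl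
    exact h.equivalent (hF _) (hind.indecomposable₀ (D'.B (τ j)).2) h'
      (fun f g => isRad_rep.1 (I.rest f g)) (fun f g => isRad_rep.1 (I'.rest f g)) hW

theorem Equivalent.exists_unitary (hK : ringChar K ≠ 2)
    (hind : IsIndSystem ind ind₀ ind₁) (hF : ∀ B a, (F B a).toT = a.1) (h : D.Equivalent D') :
    ∃ f : D.toSelfRep S F ⟶ D'.toSelfRep S F, IsUnitary f := by
  obtain ⟨⟨σ, hσ⟩, τ, hτ⟩ := h
  have hw : IsOrthDecomp (M := D.toSelfRep S F) (orthι _) := isOrthDecomp_orthι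
    (Sum.elim (fun i : Fin D.m => (D.A i).1.plus)
      (fun j : Fin D.n => (D.φ j).toSelfRep S (F (D.B j))))
  have hw' : IsOrthDecomp (M := D'.toSelfRep S F) (orthι _) := isOrthDecomp_orthι
    (Sum.elim (fun i : Fin D'.m => (D'.A i).1.plus)
      (fun j : Fin D'.n => (D'.φ j).toSelfRep S (F (D'.B j))))
  have form : ∀ {B B' : ind₀} (hB : B = B') (φ : HermForm B.1) (ψ : HermForm B'.1),
      HermForm.Equivalent (hB ▸ φ : HermForm B'.1) ψ →
      ∃ f : φ.toSelfRep S (F B) ⟶ ψ.toSelfRep S (F B'), IsUnitary f := by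
    rintro B _ rfl φ ψ he
    exact he.exists_unitary (hF B) hK (hind.indecomposable₀ B.2) S
  have plus : ∀ {A A' : ind₁}, A = A' → ∃ f : A.1.plus ⟶ A'.1.plus, IsUnitary f := by
    rintro A _ rfl
    exact ⟨_, IsUnitary.refl _⟩
  have key : ∀ l : Fin D.m ⊕ Fin D.n, ∃ f :
      Sum.elim (fun i : Fin D.m => (D.A i).1.plus)
        (fun j : Fin D.n => (D.φ j).toSelfRep S (F (D.B j))) l ⟶
      Sum.elim (fun i : Fin D'.m => (D'.A i).1.plus)
        (fun j : Fin D'.n => (D'.φ j).toSelfRep S (F (D'.B j))) (Equiv.sumCongr σ τ l),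
      IsUnitary f := by
    rintro (t | j)
    · exact plus (hσ t)
    · obtain ⟨hB, he⟩ := hτ j
      exact form hB _ _ he
  choose g hg using key
  exact hw.exists_unitary ((hw'.reindex (Equiv.sumCongr σ τ)).unitary_comp hg)

end SumData

end Adjoint

end CatInv

theorem theorem1
    {K : Type*} [DivisionRing K] [StarRing K] (hK : ringChar K ≠ 2)
    {C : Type*} [Category C] [Preadditive C] [Linear (Subring.center K) C]
    [Involution C] [LinearInvolution K C]
    (S₀ : HalfObjects C)
    (ind : Set (LRep K C)) (ind₀ : Set (SelfRep K C)) (ind₁ : Set (LRep K C))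
    (hind : IsIndSystem ind ind₀ ind₁) :
    -- `T(B)` is a skew field, and its nonzero selfadjoint elements contain selfadjoint automorphisms
    (∀ B ∈ ind₀, Nontrivial B.T ∧ (∀ a : B.T, a ≠ 0 → IsUnit a) ∧
      ∀ a : B.HermUnit, ∃ f : SelfAut B, f.toT = a.1) ∧
    -- for every choice of selfadjoint automorphisms `f_a ∈ a`
    ∀ F : ∀ B : ind₀, B.1.HermUnit → SelfAut B.1, (∀ B a, (F B a).toT = a.1) →
      (∀ M : SelfRep K C, ∃ D : SumData ind₀ ind₁, M.Congruent (D.toSelfRep S₀ F)) ∧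
      (∀ D D' : SumData ind₀ ind₁,
        (D.toSelfRep S₀ F).Congruent (D'.toSelfRep S₀ F) ↔ D.Equivalent D') := by
  refine ⟨fun B hB => ?_, fun F hF => ⟨exists_sumData S₀ hK hind hF, fun D D' => ?_⟩⟩
  · have h := hind.indecomposable₀ hB
    exact ⟨h.nontrivial_residue, h.isUnit_residue, SelfRep.exists_selfAut hK h⟩
  · rw [SelfRep.congruent_iff]
    exact ⟨fun ⟨_, hW⟩ => SumData.equivalent_of_unitary hind hF hW,
      fun h => h.exists_unitary hK hind hF⟩
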